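/- Let $B$ be a connected smooth $n$-dimensional manifold (Hausdorff and second countable). A \emph{Lagrangian fibration} over $B$ is a smooth locally trivial fibre bundle $F \hookrightarrow M \xrightarrow{\pi} B$ whose fibre $F$ is a compact connected smooth manifold and whose total space is a $2n$-dimensional symplectic manifold $(M,\omega)$ such that $\omega|_{\pi^{-1}(b)} = 0$ for all $b \in B$. The manifold $B$ is an \emph{integral affine manifold} if it has an open cover $\{U_\alpha\}$ by the domains of smooth coordinate charts $\varphi_\alpha : U_\alpha \to \mathbb{R}^n$ such that each transition function $\varphi_\beta \circ \varphi_\alpha^{-1} : \varphi_\alpha(U_\alpha \cap U_\beta) \to \varphi_\beta(U_\alpha \cap U_\beta)$ is the restriction of an element of $\mathrm{GL}(n,\mathbb{Z}) \ltimes \mathbb{R}^n$, i.e. of a map $x \mapsto Ax + c$ with $A \in \mathrm{GL}(n,\mathbb{Z})$ and $c \in \mathbb{R}^n$. Then $B$ is the base space of some Lagrangian fibration if and only if $B$ is an integral affine manifold. -/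

import Mathlib

open scoped Manifold ContDiff

universe u

section IntegralAffine

/-- The integral affine transformation `x ↦ A x + c` of `ℝⁿ` given by the element `(A, c)` of
`GL(n, ℤ) ⋉ ℝⁿ`. -/
noncomputable def integralAffineMap {n : ℕ} (A : Matrix.GeneralLinearGroup (Fin n) ℤ)
    (c : EuclideanSpace ℝ (Fin n)) (x : EuclideanSpace ℝ (Fin n)) : EuclideanSpace ℝ (Fin n) :=
  WithLp.toLp 2 ((A.val.map (Int.cast : ℤ → ℝ)).mulVec (WithLp.ofLp x)) + c

/-- A smooth `n`-manifold `B` is an integral affine manifold if it is covered by the domains of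
a family of coordinate charts (charts of its smooth structure) such that all transition functions
between members of the family are restrictions of elements of `GL(n, ℤ) ⋉ ℝⁿ`. -/
def IsIntegralAffineManifold (n : ℕ) (B : Type*) [TopologicalSpace B]
    [ChartedSpace (EuclideanSpace ℝ (Fin n)) B] : Prop :=
  ∃ 𝒜 : Set (OpenPartialHomeomorph B (EuclideanSpace ℝ (Fin n))),
    𝒜 ⊆ IsManifold.maximalAtlas (𝓡 n) ∞ B ∧
    (∀ b : B, ∃ e ∈ 𝒜, b ∈ e.source) ∧
    ∀ e ∈ 𝒜, ∀ e' ∈ 𝒜, ∃ (A : Matrix.GeneralLinearGroup (Fin n) ℤ)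
      (c : EuclideanSpace ℝ (Fin n)),
      ∀ x ∈ (e.symm.trans e').source, e.symm.trans e' x = integralAffineMap A c x

end IntegralAffine

section Symplectic

/-- A (not necessarily smooth) differential 2-form on an `m`-manifold. -/
abbrev TwoForm (m : ℕ) (M : Type*) [TopologicalSpace M]
    [ChartedSpace (EuclideanSpace ℝ (Fin m)) M] : Type _ :=
  ∀ x : M, TangentSpace (𝓡 m) x [⋀^Fin 2]→L[ℝ] ℝ

/-- The coordinate expression of the 2-form `σ` in the preferred chart at `p`: the pullback of `σ`
under the inverse of that chart. It is meaningful on the target of the chart. -/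
noncomputable def TwoForm.inChart {m : ℕ} {M : Type*} [TopologicalSpace M]
    [ChartedSpace (EuclideanSpace ℝ (Fin m)) M] (σ : TwoForm m M) (p : M)
    (y : EuclideanSpace ℝ (Fin m)) : EuclideanSpace ℝ (Fin m) [⋀^Fin 2]→L[ℝ] ℝ :=
  (σ ((extChartAt (𝓡 m) p).symm y)).compContinuousLinearMap
    (mfderiv (𝓡 m) (𝓡 m) (extChartAt (𝓡 m) p).symm y)

/-- A symplectic form: a smooth, closed, non-degenerate 2-form. Smoothness and closedness are
expressed in the charts of the manifold. -/
structure IsSymplecticForm {m : ℕ} {M : Type*} [TopologicalSpace M]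
    [ChartedSpace (EuclideanSpace ℝ (Fin m)) M] (σ : TwoForm m M) : Prop where
  smooth : ∀ p : M, ContDiffOn ℝ ∞ (σ.inChart p) (extChartAt (𝓡 m) p).target
  closed : ∀ p : M, ∀ y ∈ (extChartAt (𝓡 m) p).target, extDeriv (σ.inChart p) y = 0
  nondegenerate : ∀ (x : M) (v : TangentSpace (𝓡 m) x),
    (∀ w : TangentSpace (𝓡 m) x, σ x ![v, w] = 0) → v = 0

end Symplectic

section LagrangianFibration

/-- `π : M → B` is a Lagrangian fibration with fibre `F` with respect to the 2-form `σ` on the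
`2n`-manifold `M`: a smooth locally trivial fibre bundle with compact connected fibre `F`, such
that `σ` is symplectic and restricts to zero on each fibre. -/
structure IsLagrangianFibration {n : ℕ} {B M F : Type*}
    [TopologicalSpace B] [ChartedSpace (EuclideanSpace ℝ (Fin n)) B]
    [TopologicalSpace M] [ChartedSpace (EuclideanSpace ℝ (Fin (2 * n))) M]
    [TopologicalSpace F] [ChartedSpace (EuclideanSpace ℝ (Fin n)) F]
    (σ : TwoForm (2 * n) M) (π : M → B) : Prop where
  symplectic : IsSymplecticForm σ
  compact_fibre : CompactSpace F
  connected_fibre : ConnectedSpace F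
  smooth : ContMDiff (𝓡 (2 * n)) (𝓡 n) ∞ π
  /-- Around each point of `B` there is a local trivialization `π⁻¹(U) ≅ U × F` over `U` that is a
  diffeomorphism. -/
  locallyTrivial : ∀ b : B, ∃ e : Bundle.Trivialization F π, b ∈ e.baseSet ∧
    ContMDiffOn (𝓡 (2 * n)) ((𝓡 n).prod (𝓡 n)) ∞ e e.source ∧
    ContMDiffOn ((𝓡 n).prod (𝓡 n)) (𝓡 (2 * n)) ∞ e.toOpenPartialHomeomorph.symm e.target
  /-- `σ` vanishes on each fibre; the tangent space at `x` of the fibre through `x` is the kernel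
  of the differential of `π` at `x`. -/
  lagrangian : ∀ (x : M) (v w : TangentSpace (𝓡 (2 * n)) x),
    mfderiv (𝓡 (2 * n)) (𝓡 n) π x v = 0 → mfderiv (𝓡 (2 * n)) (𝓡 n) π x w = 0 →
      σ x ![v, w] = 0

/-- The smooth `n`-manifold `B` is the base space of some Lagrangian fibration `F ↪ M → B`, where
`M` is a smooth `2n`-manifold and `F` a smooth `n`-manifold (both Hausdorff and second
countable). -/
def IsBaseOfLagrangianFibration (n : ℕ) (B : Type u) [TopologicalSpace B]
    [ChartedSpace (EuclideanSpace ℝ (Fin n)) B] : Prop :=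
  ∃ (M : Type u) (_ : TopologicalSpace M) (_ : ChartedSpace (EuclideanSpace ℝ (Fin (2 * n))) M)
    (F : Type u) (_ : TopologicalSpace F) (_ : ChartedSpace (EuclideanSpace ℝ (Fin n)) F),
    (IsManifold (𝓡 (2 * n)) ∞ M ∧ T2Space M ∧ SecondCountableTopology M) ∧
    (IsManifold (𝓡 n) ∞ F ∧ T2Space F ∧ SecondCountableTopology F) ∧
    ∃ (σ : TwoForm (2 * n) M) (π : M → B), IsLagrangianFibration (F := F) σ π

end LagrangianFibration

/-!
If `π : M → B` is a Lagrangian fibration, a covector `α` on `B` is turned by `ω` into a vector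
tangent to the fibres: nondegeneracy and the Lagrangian condition make `T*_b B` isomorphic to the
tangent spaces of the fibre `π⁻¹(b)`, and closedness of `ω` makes the resulting coframe on the
fibre closed. A compact connected manifold with a closed coframe is a quotient `ℝⁿ / Λ` by a full
lattice, so the periods form a lattice bundle in `T*B`. Integrating `ω` over the cylinders swept
out by the period loops shows that the local sections of the lattice bundle are closed 1-forms.
Their primitives are action coordinates, and two systems of action coordinates differ by an affine
map whose linear part preserves `ℤⁿ`.

Conversely, the differentials of integral affine coordinates span a lattice bundle in `T*B`, and
the standard symplectic form on `T*B` descends to the quotient torus bundle.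
-/

section ParametricIntegral

open Set Filter Topology

theorem hasFDerivAt_intervalIntegral_of_contDiffOn {X G : Type*} [NormedAddCommGroup X]
    [NormedSpace ℝ X] [FiniteDimensional ℝ X] [NormedAddCommGroup G] [NormedSpace ℝ G]
    {D : Set X} (hD : IsOpen D) {f : X × ℝ → G} (hf : ContDiffOn ℝ 1 f (D ×ˢ univ)) (a b : ℝ)
    {z : X} (hz : z ∈ D) :
    HasFDerivAt (fun z => ∫ t in a..b, f (z, t))
      (∫ t in a..b, (fderiv ℝ f (z, t)).comp (ContinuousLinearMap.inl ℝ X ℝ)) z := by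
  have : ProperSpace X := FiniteDimensional.proper ℝ X
  have hopen : IsOpen (D ×ˢ (univ : Set ℝ)) := hD.prod isOpen_univ
  obtain ⟨r, hr, hrD⟩ := Metric.nhds_basis_closedBall.mem_iff.1 (hD.mem_nhds hz)
  have hderiv : ContinuousOn (fun p => (fderiv ℝ f p).comp (ContinuousLinearMap.inl ℝ X ℝ))
      (D ×ˢ univ) :=
    (hf.continuousOn_fderiv_of_isOpen hopen le_rfl).clm_comp continuousOn_const
  obtain ⟨C, hC⟩ := ((isCompact_closedBall z r).prod isCompact_uIcc).exists_bound_of_continuousOn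
    (hderiv.mono (prod_mono hrD (subset_univ (uIcc a b))))
  refine intervalIntegral.hasFDerivAt_integral_of_dominated_of_fderiv_le
    (F := fun z t => f (z, t))
    (F' := fun z t => (fderiv ℝ f (z, t)).comp (ContinuousLinearMap.inl ℝ X ℝ))
    (bound := fun _ => C) (Metric.closedBall_mem_nhds z hr) ?_
    ((hf.continuousOn.comp_continuous (by fun_prop)
      fun t => ⟨hz, mem_univ _⟩).intervalIntegrable _ _)
    (hderiv.comp_continuous (by fun_prop) fun t => ⟨hz, mem_univ _⟩).aestronglyMeasurable ?_
    intervalIntegrable_const ?_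
  · filter_upwards [hD.mem_nhds hz] with y hy
    exact (hf.continuousOn.comp_continuous (by fun_prop)
      fun t => ⟨hy, mem_univ _⟩).aestronglyMeasurable
  · exact Eventually.of_forall fun t ht y hy => hC (y, t) ⟨hy, uIoc_subset_uIcc ht⟩
  · refine Eventually.of_forall fun t _ y hy => ?_
    have hfderiv : HasFDerivAt f (fderiv ℝ f (y, t)) (y, t) :=
      ((hf.contDiffAt (hopen.mem_nhds ⟨hrD hy, mem_univ _⟩)).differentiableAt
        one_ne_zero).hasFDerivAt
    exact hfderiv.comp y (hasFDerivAt_prodMk_left y t)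

theorem fderiv_intervalIntegral_apply {X G : Type*} [NormedAddCommGroup X]
    [NormedSpace ℝ X] [FiniteDimensional ℝ X] [NormedAddCommGroup G] [NormedSpace ℝ G]
    [CompleteSpace G] {D : Set X} (hD : IsOpen D) {f : X × ℝ → G}
    (hf : ContDiffOn ℝ 1 f (D ×ˢ univ)) (a b : ℝ) {z : X} (hz : z ∈ D) (v : X) :
    fderiv ℝ (fun z => ∫ t in a..b, f (z, t)) z v = ∫ t in a..b, fderiv ℝ f (z, t) (v, 0) := by
  have hcont : Continuous fun t : ℝ => (fderiv ℝ f (z, t)).comp (ContinuousLinearMap.inl ℝ X ℝ) :=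
    ((hf.continuousOn_fderiv_of_isOpen (hD.prod isOpen_univ) le_rfl).comp_continuous
      (by fun_prop) fun t => ⟨hz, mem_univ t⟩).clm_comp continuous_const
  rw [(hasFDerivAt_intervalIntegral_of_contDiffOn hD hf a b hz).fderiv,
    ContinuousLinearMap.intervalIntegral_apply (hcont.intervalIntegrable _ _)]
  rfl

theorem contDiffOn_intervalIntegral {X G : Type u} [NormedAddCommGroup X] [NormedSpace ℝ X]
    [FiniteDimensional ℝ X] [NormedAddCommGroup G] [NormedSpace ℝ G] {D : Set X} (hD : IsOpen D)
    {f : X × ℝ → G} (hf : ContDiffOn ℝ ∞ f (D ×ˢ univ)) (a b : ℝ) :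
    ContDiffOn ℝ ∞ (fun z => ∫ t in a..b, f (z, t)) D := by
  rw [contDiffOn_infty]
  intro k
  induction k generalizing G with
  | zero =>
    exact contDiffOn_zero.2 fun z hz => (hasFDerivAt_intervalIntegral_of_contDiffOn hD
      (hf.of_le (by simp)) a b hz).continuousAt.continuousWithinAt
  | succ k ih =>
    have hderiv (z : X) (hz : z ∈ D) :=
      hasFDerivAt_intervalIntegral_of_contDiffOn hD (hf.of_le (by simp)) a b hz
    push_cast
    refine (contDiffOn_succ_iff_fderiv_of_isOpen hD).2
      ⟨fun z hz => (hderiv z hz).differentiableAt.differentiableWithinAt, by simp, ?_⟩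
    refine (ih (f := fun p => (fderiv ℝ f p).comp (ContinuousLinearMap.inl ℝ X ℝ)) ?_).congr
      fun z hz => (hderiv z hz).fderiv
    exact (hf.fderiv_of_isOpen (hD.prod isOpen_univ) (by simp)).clm_comp contDiffOn_const

end ParametricIntegral

section AlternatingMaps

variable {ι X Y Z G : Type*} [Fintype ι] [NormedAddCommGroup X] [NormedSpace ℝ X]
  [NormedAddCommGroup Y] [NormedSpace ℝ Y] [NormedAddCommGroup Z] [NormedSpace ℝ Z]
  [NormedAddCommGroup G] [NormedSpace ℝ G]

theorem norm_alternatization_le [DecidableEq ι]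
    (f : ContinuousMultilinearMap ℝ (fun _ : ι => X) G) :
    ‖f.alternatization‖ ≤ (Fintype.card ι).factorial * ‖f‖ := by
  refine ContinuousAlternatingMap.opNorm_le_bound _ (by positivity) fun v => ?_
  have hterm (τ : Equiv.Perm ι) :
      ‖Equiv.Perm.sign τ • f (v ∘ τ)‖ ≤ ‖f‖ * ∏ i, ‖v i‖ := by
    have hsign : ‖Equiv.Perm.sign τ • f (v ∘ τ)‖ = ‖f (v ∘ τ)‖ := by
      rcases Int.units_eq_one_or (Equiv.Perm.sign τ) with h | h <;> simp [h]
    rw [hsign, ← Equiv.prod_comp τ fun i => ‖v i‖]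
    exact f.le_opNorm _
  rw [ContinuousMultilinearMap.alternatization_apply_apply, mul_assoc, ← nsmul_eq_mul,
    ← Fintype.card_perm, ← Finset.card_univ]
  exact (norm_sum_le _ _).trans (Finset.sum_le_card_nsmul _ _ _ fun τ _ => hterm τ)

/-- Alternatization of continuous multilinear maps, as a continuous linear map. -/
noncomputable def continuousAlternatization [DecidableEq ι] :
    ContinuousMultilinearMap ℝ (fun _ : ι => X) G →L[ℝ] X [⋀^ι]→L[ℝ] G :=
  LinearMap.mkContinuous
    { toFun := ContinuousMultilinearMap.alternatization
      map_add' := map_add _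
      map_smul' := fun c f => by
        ext v
        simp only [ContinuousMultilinearMap.alternatization_apply_apply,
          smul_apply, ContinuousAlternatingMap.smul_apply,
          Finset.smul_sum, RingHom.id_apply]
        exact Finset.sum_congr rfl fun τ _ => smul_comm _ _ _ }
    (Fintype.card ι).factorial norm_alternatization_le

theorem continuousAlternatization_toContinuousMultilinearMap [DecidableEq ι]
    (f : X [⋀^ι]→L[ℝ] G) :
    continuousAlternatization f.toContinuousMultilinearMap =
      ((Fintype.card ι).factorial : ℝ) • f := by
  ext v
  rw [Nat.cast_smul_eq_nsmul]
  refine Eq.trans ?_ (DFunLike.congr_fun f.toAlternatingMap.coe_alternatization v)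
  exact DFunLike.congr_fun
    (ContinuousMultilinearMap.alternatization_apply_toAlternatingMap
      f.toContinuousMultilinearMap) v

/-- An alternating map is recovered from its underlying multilinear map by alternatization, so
that smoothness can be checked on multilinear maps. -/
theorem contDiffAt_alternatingMap_compContinuousLinearMap {k : WithTop ℕ∞}
    {f : Z → Y [⋀^ι]→L[ℝ] G} {g : Z → X →L[ℝ] Y} {z : Z} (hf : ContDiffAt ℝ k f z)
    (hg : ContDiffAt ℝ k g z) :
    ContDiffAt ℝ k (fun z => (f z).compContinuousLinearMap (g z)) z := by
  classical
  have hcomp : ContDiffAt ℝ k (fun z =>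
      ContinuousMultilinearMap.compContinuousLinearMapContinuousMultilinear ℝ
        (fun _ : ι => X) (fun _ : ι => Y) G (fun _ => g z)) z :=
    (ContinuousMultilinearMap.contDiff _).contDiffAt.comp z (contDiffAt_pi.2 fun _ => hg)
  have hmultilinear : ContDiffAt ℝ k (fun z =>
      ((f z).compContinuousLinearMap (g z)).toContinuousMultilinearMap) z :=
    hcomp.clm_apply (ContDiffAt.comp
      (g := ContinuousAlternatingMap.toContinuousMultilinearMapCLM ℝ) z
      (ContinuousLinearMap.contDiff _).contDiffAt hf)
  refine ((continuousAlternatization.contDiff.contDiffAt.comp z hmultilinear).const_smul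
    ((Fintype.card ι).factorial : ℝ)⁻¹).congr_of_eventuallyEq (.of_forall fun z => ?_)
  simp only [Function.comp_apply]
  rw [continuousAlternatization_toContinuousMultilinearMap,
    inv_smul_smul₀ (by exact_mod_cast (Fintype.card ι).factorial_ne_zero)]

end AlternatingMaps

section Pullback

open Set Filter Topology

variable {m : ℕ} {M : Type*} [TopologicalSpace M] [ChartedSpace (EuclideanSpace ℝ (Fin m)) M]
  {X : Type*} [NormedAddCommGroup X] [NormedSpace ℝ X]

/-- The pullback of a 2-form under a map from a normed space. -/
noncomputable def TwoForm.pullback (σ : TwoForm m M) (G : X → M) (y : X) :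
    X [⋀^Fin 2]→L[ℝ] ℝ :=
  (σ (G y)).compContinuousLinearMap (mfderiv 𝓘(ℝ, X) (𝓡 m) G y)

theorem TwoForm.pullback_apply (σ : TwoForm m M) (G : X → M) (y : X) (v w : X) :
    σ.pullback G y ![v, w] =
      σ (G y) ![mfderiv 𝓘(ℝ, X) (𝓡 m) G y v, mfderiv 𝓘(ℝ, X) (𝓡 m) G y w] := by
  refine congrArg (σ (G y)) (funext fun i => ?_)
  fin_cases i <;> rfl

theorem contDiffAt_extChartAt_comp {G : X → M} {y : X} (hG : ContMDiffAt 𝓘(ℝ, X) (𝓡 m) ∞ G y) :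
    ContDiffAt ℝ ∞ (fun x => extChartAt (𝓡 m) (G y) (G x)) y := by
  rw [← contMDiffAt_iff_contDiffAt]
  exact (contMDiffAt_extChartAt (I := 𝓡 m) (n := ∞) (x := G y)).comp y hG

theorem IsSymplecticForm.contDiffAt_inChart {σ : TwoForm m M} (hσ : IsSymplecticForm σ)
    (p : M) : ContDiffAt ℝ ∞ (σ.inChart p) (extChartAt (𝓡 m) p p) :=
  (hσ.smooth p).contDiffAt (extChartAt_target_mem_nhds _)

variable [IsManifold (𝓡 m) ∞ M]

theorem mfderiv_eq_comp_fderiv_extChartAt {G : X → M} {y : X} {p : M}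
    (hG : MDifferentiableAt 𝓘(ℝ, X) (𝓡 m) G y)
    (hp : G y ∈ (chartAt (EuclideanSpace ℝ (Fin m)) p).source) :
    mfderiv 𝓘(ℝ, X) (𝓡 m) G y =
      (mfderiv (𝓡 m) (𝓡 m) (extChartAt (𝓡 m) p).symm (extChartAt (𝓡 m) p (G y))).comp
        (fderiv ℝ (fun y => extChartAt (𝓡 m) p (G y)) y) := by
  have hsymm : MDifferentiableAt (𝓡 m) (𝓡 m) (extChartAt (𝓡 m) p).symm
      (extChartAt (𝓡 m) p (G y)) :=
    ((contMDiffOn_extChartAt_symm (n := ∞) p).contMDiffAt ((isOpen_extChartAt_target p).mem_nhds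
      ((extChartAt (𝓡 m) p).map_source (by rwa [extChartAt_source])))).mdifferentiableAt (by simp)
  have hchart : HasMFDerivAt 𝓘(ℝ, X) (𝓡 m) (fun y => extChartAt (𝓡 m) p (G y)) y
      (fderiv ℝ (fun y => extChartAt (𝓡 m) p (G y)) y) :=
    ((mdifferentiableAt_extChartAt (I := 𝓡 m) hp).comp y
      hG).differentiableAt.hasFDerivAt.hasMFDerivAt
  refine ((hsymm.hasMFDerivAt.comp y hchart).congr_of_eventuallyEq ?_).mfderiv
  filter_upwards [hG.continuousAt.preimage_mem_nhds
    ((chartAt (EuclideanSpace ℝ (Fin m)) p).open_source.mem_nhds hp)] with y' hy'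
  exact ((extChartAt (𝓡 m) p).left_inv (by rwa [extChartAt_source])).symm

theorem TwoForm.pullback_eventuallyEq (σ : TwoForm m M) {G : X → M} {s : Set X} (hs : IsOpen s)
    (hG : ContMDiffOn 𝓘(ℝ, X) (𝓡 m) ∞ G s) {y₀ : X} (hy₀ : y₀ ∈ s) :
    σ.pullback G =ᶠ[𝓝 y₀] fun y =>
      (σ.inChart (G y₀) (extChartAt (𝓡 m) (G y₀) (G y))).compContinuousLinearMap
        (fderiv ℝ (fun y => extChartAt (𝓡 m) (G y₀) (G y)) y) := by
  filter_upwards [hs.mem_nhds hy₀, (hG.continuousOn.continuousAt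
    (hs.mem_nhds hy₀)).preimage_mem_nhds
    (chart_source_mem_nhds (EuclideanSpace ℝ (Fin m)) (G y₀))] with y hys hyc
  have hleft : (extChartAt (𝓡 m) (G y₀)).symm (extChartAt (𝓡 m) (G y₀) (G y)) = G y :=
    (extChartAt (𝓡 m) (G y₀)).left_inv (by rwa [extChartAt_source])
  -- Erasing the dependence of the tangent spaces on the base point makes `rw` possible.
  let σ' : M → EuclideanSpace ℝ (Fin m) [⋀^Fin 2]→L[ℝ] ℝ := σ
  change (σ' (G y)).compContinuousLinearMap _ = ((σ' _).compContinuousLinearMap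
    _).compContinuousLinearMap _
  rw [hleft, mfderiv_eq_comp_fderiv_extChartAt
    ((hG.contMDiffAt (hs.mem_nhds hys)).mdifferentiableAt (by simp)) hyc]
  rfl

namespace IsSymplecticForm

variable {σ : TwoForm m M}

theorem contDiffOn_pullback (hσ : IsSymplecticForm σ) {G : X → M} {s : Set X} (hs : IsOpen s)
    (hG : ContMDiffOn 𝓘(ℝ, X) (𝓡 m) ∞ G s) : ContDiffOn ℝ ∞ (σ.pullback G) s := by
  intro y₀ hy₀
  have hchart := contDiffAt_extChartAt_comp (hG.contMDiffAt (hs.mem_nhds hy₀))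
  refine ContDiffAt.contDiffWithinAt (ContDiffAt.congr_of_eventuallyEq ?_
    (σ.pullback_eventuallyEq hs hG hy₀))
  exact contDiffAt_alternatingMap_compContinuousLinearMap
    (ContDiffAt.comp (g := σ.inChart (G y₀)) y₀ (hσ.contDiffAt_inChart _) hchart)
    (hchart.fderiv_right (by simp))

theorem extDeriv_pullback (hσ : IsSymplecticForm σ) {G : X → M} {s : Set X} (hs : IsOpen s)
    (hG : ContMDiffOn 𝓘(ℝ, X) (𝓡 m) ∞ G s) {y₀ : X} (hy₀ : y₀ ∈ s) :
    extDeriv (σ.pullback G) y₀ = 0 := by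
  rw [(σ.pullback_eventuallyEq hs hG hy₀).extDeriv_eq,
    _root_.extDeriv_pullback (f := fun y => extChartAt (𝓡 m) (G y₀) (G y))
      ((hσ.contDiffAt_inChart _).differentiableAt (by simp))
      (contDiffAt_extChartAt_comp (hG.contMDiffAt (hs.mem_nhds hy₀)))
      (minSmoothness_of_isRCLikeNormedField.trans_le
        (WithTop.coe_le_coe.2 (le_top : (2 : ℕ∞) ≤ ⊤))),
    hσ.closed (G y₀) _ (mem_extChartAt_target (G y₀))]
  ext v
  simp

end IsSymplecticForm

theorem fderiv_cyclic_of_extDeriv_eq_zero {τ : X → X [⋀^Fin 2]→L[ℝ] ℝ} {x : X}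
    (hτ : extDeriv τ x = 0) (a b c : X) :
    fderiv ℝ τ x a ![b, c] - fderiv ℝ τ x b ![a, c] + fderiv ℝ τ x c ![a, b] = 0 := by
  have hremove (i : Fin 3) :
      Fin.removeNth i ![a, b, c] = ![![b, c], ![a, c], ![a, b]] i := by
    fin_cases i <;> ext j <;> fin_cases j <;> rfl
  have happly := congrArg (fun φ => φ ![a, b, c]) hτ
  simp only [extDeriv, ContinuousAlternatingMap.alternatizeUncurryFin_apply, hremove] at happly
  simpa [Fin.sum_univ_succ, sub_eq_add_neg, add_assoc] using happly

end Pullback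

section Coframe

open Set Filter Topology

variable {E : Type*} [NormedAddCommGroup E] [NormedSpace ℝ E]
  {F : Type*} [TopologicalSpace F] [ChartedSpace E F]
  {W : Type*} [NormedAddCommGroup W] [NormedSpace ℝ W]
  {X : Type*} [NormedAddCommGroup X] [NormedSpace ℝ X]

/-- A flat coframe: a vector valued 1-form which is locally the differential of a diffeomorphism
onto an open subset of the vector space. -/
def IsFlatCoframe (η : F → E →L[ℝ] W) : Prop :=
  ∀ x, ∃ ψ : OpenPartialHomeomorph F W, x ∈ ψ.source ∧
    ContMDiffOn 𝓘(ℝ, E) 𝓘(ℝ, W) ∞ ψ ψ.source ∧ ContMDiffOn 𝓘(ℝ, W) 𝓘(ℝ, E) ∞ ψ.symm ψ.target ∧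
    ∀ y ∈ ψ.source, mfderiv 𝓘(ℝ, E) 𝓘(ℝ, W) ψ y = η y

/-- The pullback of a vector valued 1-form under a map from a normed space. -/
noncomputable def pullbackForm (η : F → E →L[ℝ] W) (k : X → F) (p : X) : X →L[ℝ] W :=
  (η (k p)).comp (mfderiv 𝓘(ℝ, X) 𝓘(ℝ, E) k p)

variable {η : F → E →L[ℝ] W}

theorem pullbackForm_congr {k k' : X → F} {p : X} (h : k =ᶠ[𝓝 p] k') :
    pullbackForm η k p = pullbackForm η k' p := by
  have hderiv : (mfderiv 𝓘(ℝ, X) 𝓘(ℝ, E) k p : X →L[ℝ] E) = mfderiv 𝓘(ℝ, X) 𝓘(ℝ, E) k' p :=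
    h.mfderiv_eq
  change (η (k p)).comp (mfderiv 𝓘(ℝ, X) 𝓘(ℝ, E) k p : X →L[ℝ] E) = _
  rw [h.self_of_nhds, hderiv]
  rfl

theorem pullbackForm_comp {Y : Type*} [NormedAddCommGroup Y] [NormedSpace ℝ Y]
    {k : X → F} {g : Y → X} {p : Y} {g' : Y →L[ℝ] X}
    (hk : MDifferentiableAt 𝓘(ℝ, X) 𝓘(ℝ, E) k (g p)) (hg : HasFDerivAt g g' p) :
    pullbackForm η (fun y => k (g y)) p = (pullbackForm η k (g p)).comp g' := by
  have h : mfderiv 𝓘(ℝ, Y) 𝓘(ℝ, E) (fun y => k (g y)) p =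
      (mfderiv 𝓘(ℝ, X) 𝓘(ℝ, E) k (g p)).comp g' :=
    (hk.hasMFDerivAt.comp p hg.hasMFDerivAt).mfderiv
  simp only [pullbackForm]
  rw [h]
  rfl

theorem hasFDerivAt_comp_pullbackForm {ψ : F → W} {k : X → F} {p : X}
    (hψ : MDifferentiableAt 𝓘(ℝ, E) 𝓘(ℝ, W) ψ (k p))
    (hη : mfderiv 𝓘(ℝ, E) 𝓘(ℝ, W) ψ (k p) = η (k p))
    (hk : MDifferentiableAt 𝓘(ℝ, X) 𝓘(ℝ, E) k p) :
    HasFDerivAt (fun p => ψ (k p)) (pullbackForm η k p) p := by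
  have h := hψ.hasMFDerivAt.comp p hk.hasMFDerivAt
  rw [hη] at h
  exact h.hasFDerivAt

/-- A local orbit map through `y`: a local parametrization of `F`, defined on a ball, that pulls
the coframe `η` back to the constant form `id`. -/
structure IsLocalOrbitMap (η : F → E →L[ℝ] W) (ε : ℝ) (y : F) (s : W → F) : Prop where
  map_zero : s 0 = y
  contMDiffOn : ContMDiffOn 𝓘(ℝ, W) 𝓘(ℝ, E) ∞ s (Metric.ball 0 ε)
  pullback : ∀ v ∈ Metric.ball (0 : W) ε, pullbackForm η s v = ContinuousLinearMap.id ℝ W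
  injOn : InjOn s (Metric.ball 0 ε)
  nhds_le : 𝓝 y ≤ map s (𝓝 0)

namespace IsLocalOrbitMap

variable {ε : ℝ} {y : F} {s : W → F}

theorem mono {ε' : ℝ} (h : IsLocalOrbitMap η ε y s) (hε : ε' ≤ ε) : IsLocalOrbitMap η ε' y s where
  map_zero := h.map_zero
  contMDiffOn := h.contMDiffOn.mono (Metric.ball_subset_ball hε)
  pullback v hv := h.pullback v (Metric.ball_subset_ball hε hv)
  injOn := h.injOn.mono (Metric.ball_subset_ball hε)
  nhds_le := h.nhds_le

theorem mdifferentiableAt (h : IsLocalOrbitMap η ε y s) {v : W} (hv : v ∈ Metric.ball 0 ε) :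
    MDifferentiableAt 𝓘(ℝ, W) 𝓘(ℝ, E) s v :=
  (h.contMDiffOn.contMDiffAt (Metric.isOpen_ball.mem_nhds hv)).mdifferentiableAt (by simp)

end IsLocalOrbitMap

theorem isLocalOrbitMap_symm_add {ψ : OpenPartialHomeomorph F W} {ε : ℝ} {y : F}
    (hψ : ContMDiffOn 𝓘(ℝ, E) 𝓘(ℝ, W) ∞ ψ ψ.source)
    (hψs : ContMDiffOn 𝓘(ℝ, W) 𝓘(ℝ, E) ∞ ψ.symm ψ.target)
    (hη : ∀ y ∈ ψ.source, mfderiv 𝓘(ℝ, E) 𝓘(ℝ, W) ψ y = η y) (hy : y ∈ ψ.source)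
    (hball : ∀ v ∈ Metric.ball (0 : W) ε, ψ y + v ∈ ψ.target) :
    IsLocalOrbitMap η ε y fun v => ψ.symm (ψ y + v) := by
  have hsm : ContMDiffOn 𝓘(ℝ, W) 𝓘(ℝ, E) ∞ (fun v => ψ.symm (ψ y + v)) (Metric.ball 0 ε) :=
    hψs.comp (contMDiff_iff_contDiff.2 (by fun_prop)).contMDiffOn hball
  refine ⟨by simp [ψ.left_inv hy], hsm, fun v hv => ?_, fun v hv w hw h =>
    add_left_cancel (ψ.symm.injOn (hball v hv) (hball w hw) h), ?_⟩
  · have hsrc : ψ.symm (ψ y + v) ∈ ψ.source := ψ.map_target (hball v hv)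
    have hpull := hasFDerivAt_comp_pullbackForm (k := fun v => ψ.symm (ψ y + v)) (p := v)
      ((hψ.contMDiffAt (ψ.open_source.mem_nhds hsrc)).mdifferentiableAt (by simp)) (hη _ hsrc)
      ((hsm.contMDiffAt (Metric.isOpen_ball.mem_nhds hv)).mdifferentiableAt (by simp))
    have htranslation : (fun v => ψ (ψ.symm (ψ y + v))) =ᶠ[𝓝 v] fun v => ψ y + v := by
      filter_upwards [Metric.isOpen_ball.mem_nhds hv] with w hw
      exact ψ.right_inv (hball w hw)
    exact (hpull.congr_of_eventuallyEq htranslation.symm).unique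
      ((hasFDerivAt_id v).const_add (ψ y))
  · have hsymm : map ψ.symm (𝓝 (ψ y)) = 𝓝 y := by
      rw [ψ.symm.map_nhds_eq (ψ.map_source hy), ψ.left_inv hy]
    have htranslation : map (fun v => ψ y + v) (𝓝 0) = 𝓝 (ψ y) := by simp
    rw [← hsymm, ← htranslation, map_map]
    rfl

namespace IsFlatCoframe

theorem eventuallyEq_of_pullbackForm_eq (hη : IsFlatCoframe η) {s : Set X} (hs : IsOpen s)
    {k k' : X → F} (hk : MDifferentiableOn 𝓘(ℝ, X) 𝓘(ℝ, E) k s)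
    (hk' : MDifferentiableOn 𝓘(ℝ, X) 𝓘(ℝ, E) k' s)
    (h : ∀ p ∈ s, pullbackForm η k p = pullbackForm η k' p) {p : X} (hp : p ∈ s)
    (heq : k p = k' p) : k =ᶠ[𝓝 p] k' := by
  obtain ⟨ψ, hxψ, hψ, -, hd⟩ := hη (k p)
  have hderiv {k : X → F} (hk : MDifferentiableOn 𝓘(ℝ, X) 𝓘(ℝ, E) k s) {q : X} (hq : q ∈ s)
      (hkq : k q ∈ ψ.source) : HasFDerivAt (fun p => ψ (k p)) (pullbackForm η k q) q :=
    hasFDerivAt_comp_pullbackForm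
      ((hψ.contMDiffAt (ψ.open_source.mem_nhds hkq)).mdifferentiableAt (by simp))
      (hd _ hkq) (hk.mdifferentiableAt (hs.mem_nhds hq))
  have hsource {k : X → F} (hk : MDifferentiableOn 𝓘(ℝ, X) 𝓘(ℝ, E) k s)
      (hkp : k p ∈ ψ.source) : ∀ᶠ q in 𝓝 p, k q ∈ ψ.source :=
    (hk.continuousOn.continuousAt (hs.mem_nhds hp)).preimage_mem_nhds
      (ψ.open_source.mem_nhds hkp)
  obtain ⟨r, hr, hball⟩ := Metric.eventually_nhds_iff_ball.1
    ((hs.eventually_mem hp).and ((hsource hk hxψ).and (hsource hk' (heq ▸ hxψ))))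
  have hψeq : EqOn (fun p => ψ (k p)) (fun p => ψ (k' p)) (Metric.ball p r) := by
    refine Metric.isOpen_ball.eqOn_of_fderiv_eq (𝕜 := ℝ) (convex_ball p r).isPreconnected
      (fun q hq => ?_) (fun q hq => ?_) (fun q hq => ?_) (Metric.mem_ball_self hr)
      (congrArg ψ heq) <;> obtain ⟨hqs, hkq, hkq'⟩ := hball q hq
    · exact (hderiv hk hqs hkq).differentiableAt.differentiableWithinAt
    · exact (hderiv hk' hqs hkq').differentiableAt.differentiableWithinAt
    · rw [(hderiv hk hqs hkq).fderiv, (hderiv hk' hqs hkq').fderiv, h q hqs]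
  filter_upwards [Metric.ball_mem_nhds p hr] with q hq
  exact ψ.injOn (hball q hq).2.1 (hball q hq).2.2 (hψeq hq)

theorem eqOn_of_pullbackForm_eq (hη : IsFlatCoframe η) [T2Space F] {s : Set X} (hs : IsOpen s)
    (hsc : IsPreconnected s) {k k' : X → F}
    (hk : MDifferentiableOn 𝓘(ℝ, X) 𝓘(ℝ, E) k s) (hk' : MDifferentiableOn 𝓘(ℝ, X) 𝓘(ℝ, E) k' s)
    (h : ∀ p ∈ s, pullbackForm η k p = pullbackForm η k' p) {p₀ : X} (hp₀ : p₀ ∈ s)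
    (h0 : k p₀ = k' p₀) : EqOn k k' s := by
  have hopen : IsOpen {p | p ∈ s ∧ k p = k' p} := by
    rw [isOpen_iff_mem_nhds]
    rintro p ⟨hps, hp⟩
    exact (hs.eventually_mem hps).and
      (hη.eventuallyEq_of_pullbackForm_eq hs hk hk' h hps hp)
  refine fun p hp => (hsc.subset_of_closure_inter_subset hopen ⟨p₀, hp₀, hp₀, h0⟩ ?_ hp).2
  rintro p ⟨hpc, hps⟩
  have : (𝓝[{p | p ∈ s ∧ k p = k' p}] p).NeBot := mem_closure_iff_nhdsWithin_neBot.1 hpc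
  have htendsto {f : X → F} (hf : MDifferentiableOn 𝓘(ℝ, X) 𝓘(ℝ, E) f s) :
      Tendsto f (𝓝[{p | p ∈ s ∧ k p = k' p}] p) (𝓝 (f p)) :=
    (hf.continuousOn.continuousAt (hs.mem_nhds hps)).tendsto.mono_left nhdsWithin_le_nhds
  refine ⟨hps, tendsto_nhds_unique ((htendsto hk).congr' ?_) (htendsto hk')⟩
  filter_upwards [self_mem_nhdsWithin] with q hq using hq.2

theorem exists_isLocalOrbitMap_nhds (hη : IsFlatCoframe η) (x : F) :
    ∃ t ∈ 𝓝 x, ∃ ε > 0, ∀ y ∈ t, ∃ s, IsLocalOrbitMap η ε y s := by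
  obtain ⟨ψ, hxψ, hψ, hψs, hd⟩ := hη x
  obtain ⟨r, hr, hball⟩ := Metric.isOpen_iff.1 ψ.open_target _ (ψ.map_source hxψ)
  refine ⟨ψ.source ∩ ψ ⁻¹' Metric.ball (ψ x) (r / 2), (ψ.continuousOn.isOpen_inter_preimage
    ψ.open_source Metric.isOpen_ball).mem_nhds ⟨hxψ, Metric.mem_ball_self (half_pos hr)⟩, r / 2,
    half_pos hr, ?_⟩
  rintro y ⟨hyψ, hy⟩
  refine ⟨_, isLocalOrbitMap_symm_add hψ hψs hd hyψ fun v hv => hball ?_⟩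
  rw [mem_ball_zero_iff] at hv
  rw [mem_preimage, mem_ball_iff_norm] at hy
  rw [mem_ball_iff_norm, add_sub_right_comm]
  exact (norm_add_le _ _).trans_lt (by linarith)

theorem exists_forall_isLocalOrbitMap [CompactSpace F] (hη : IsFlatCoframe η) :
    ∃ ε > 0, ∀ y, ∃ s, IsLocalOrbitMap η ε y s := by
  have huniform := isCompact_univ.induction_on
    (p := fun t : Set F => ∃ ε > 0, ∀ y ∈ t, ∃ s, IsLocalOrbitMap η ε y s)
    ⟨1, one_pos, by simp⟩
    (fun s t hst ⟨ε, hε, h⟩ => ⟨ε, hε, fun y hy => h y (hst hy)⟩)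
    (fun s t ⟨ε, hε, h⟩ ⟨ε', hε', h'⟩ => ⟨min ε ε', lt_min hε hε', fun y hy =>
      hy.elim (fun hy => (h y hy).imp fun _ hs => hs.mono (min_le_left _ _))
        (fun hy => (h' y hy).imp fun _ hs => hs.mono (min_le_right _ _))⟩)
    (fun x _ => by
      obtain ⟨t, ht, h⟩ := exists_isLocalOrbitMap_nhds hη x
      exact ⟨t, mem_nhdsWithin_of_mem_nhds ht, h⟩)
  simpa using huniform

theorem localOrbitMap_add [T2Space F] (hη : IsFlatCoframe η) {ε : ℝ} {s : F → W → F}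
    (hs : ∀ y, IsLocalOrbitMap η ε y (s y)) (y : F) {v w : W} (hv : ‖v‖ < ε) (hw : ‖w‖ < ε)
    (hvw : ‖v + w‖ < ε) : s (s y v) w = s y (v + w) := by
  have hε : 0 < ε := (norm_nonneg v).trans_lt hv
  set U : Set W := Metric.ball 0 ε ∩ (fun t => v + t) ⁻¹' Metric.ball 0 ε with hU
  have hUo : IsOpen U := Metric.isOpen_ball.inter (Metric.isOpen_ball.preimage (by fun_prop))
  have hUc : Convex ℝ U :=
    (convex_ball 0 ε).inter ((convex_ball (0 : W) ε).translate_preimage_right v)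
  have hshift : ContMDiffOn 𝓘(ℝ, W) 𝓘(ℝ, E) ∞ (fun t => s y (v + t)) U :=
    (hs y).contMDiffOn.comp (contMDiff_iff_contDiff.2 (by fun_prop)).contMDiffOn fun t ht => ht.2
  refine hη.eqOn_of_pullbackForm_eq (k := s (s y v)) (k' := fun t => s y (v + t)) hUo
    hUc.isPreconnected (((hs _).contMDiffOn.mono inter_subset_left).mdifferentiableOn (by simp))
    (hshift.mdifferentiableOn (by simp)) (fun t ht => ?_) (p₀ := 0) (by simpa [hU, hε] using hv)
    (by simp only [(hs _).map_zero, add_zero])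
    (show w ∈ U from ⟨mem_ball_zero_iff.2 hw, mem_ball_zero_iff.2 hvw⟩)
  rw [(hs _).pullback t ht.1, pullbackForm_comp (g := fun t => v + t)
    (g' := ContinuousLinearMap.id ℝ W) ((hs y).mdifferentiableAt ht.2)
    ((hasFDerivAt_id t).const_add v), (hs y).pullback _ ht.2]
  rfl

end IsFlatCoframe

end Coframe

section HomOnBall

open Multiplicative

/-- A local homomorphism from a normed space to a monoid, defined on the ball of radius `ε`. -/
structure IsHomOnBall {W N : Type*} [NormedAddCommGroup W] [Monoid N] (ε : ℝ) (ρ : W → N) :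
    Prop where
  map_zero : ρ 0 = 1
  map_add : ∀ v w, ‖v‖ < ε → ‖w‖ < ε → ‖v + w‖ < ε → ρ (v + w) = ρ v * ρ w

namespace IsHomOnBall

variable {W N : Type*} [NormedAddCommGroup W] [Monoid N] {ε : ℝ} {ρ : W → N}

theorem commute (hρ : IsHomOnBall ε ρ) {v w : W} (hv : ‖v‖ < ε) (hw : ‖w‖ < ε)
    (hvw : ‖v + w‖ < ε) : Commute (ρ v) (ρ w) := by
  rw [Commute, SemiconjBy, ← hρ.map_add v w hv hw hvw, add_comm,
    hρ.map_add w v hw hv (by rwa [add_comm])]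

variable [NormedSpace ℝ W]

theorem map_natCast_smul (hρ : IsHomOnBall ε ρ) {v : W} (hv : ‖v‖ < ε) (j : ℕ)
    (hj : ‖(j : ℝ) • v‖ < ε) : ρ ((j : ℝ) • v) = ρ v ^ j := by
  induction j with
  | zero => simp [hρ.map_zero]
  | succ j ih =>
    have hsum : ((j + 1 : ℕ) : ℝ) • v = (j : ℝ) • v + v := by push_cast; module
    have hj' : ‖(j : ℝ) • v‖ < ε := by
      refine lt_of_le_of_lt ?_ hj
      rw [norm_smul, norm_smul]
      gcongr
      simp only [Real.norm_natCast]
      push_cast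
      linarith
    rw [hsum, hρ.map_add _ _ hj' hv (hsum ▸ hj), ih hj', pow_succ]

theorem norm_inv_natCast_smul_lt {k : ℕ} (hk : 0 < k) {v : W} (hv : ‖v‖ < k * ε) :
    ‖(k : ℝ)⁻¹ • v‖ < ε := by
  rwa [norm_smul, norm_inv, Real.norm_natCast, inv_mul_lt_iff₀ (by positivity)]

theorem pow_inv_natCast_smul (hρ : IsHomOnBall ε ρ) {v : W} {k l : ℕ} (hk : 0 < k) (hl : 0 < l)
    (hvk : ‖v‖ < k * ε) (hvl : ‖v‖ < l * ε) :
    ρ ((k : ℝ)⁻¹ • v) ^ k = ρ ((l : ℝ)⁻¹ • v) ^ l := by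
  have hrefine {k l : ℕ} (hk : 0 < k) (hl : 0 < l) (hv : ‖v‖ < k * ε) :
      ρ ((k : ℝ)⁻¹ • v) ^ k = ρ ((k * l : ℝ)⁻¹ • v) ^ (l * k) := by
    have hsmul : (l : ℝ) • (k * l : ℝ)⁻¹ • v = (k : ℝ)⁻¹ • v := by
      rw [smul_smul]
      congr 1
      field_simp
    have hkv : ‖(k : ℝ)⁻¹ • v‖ < ε := norm_inv_natCast_smul_lt hk hv
    have hklv : ‖(k * l : ℝ)⁻¹ • v‖ < ε := by
      refine lt_of_le_of_lt ?_ hkv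
      rw [← hsmul, norm_smul (l : ℝ), Real.norm_natCast]
      exact le_mul_of_one_le_left (norm_nonneg _) (by exact_mod_cast hl)
    rw [pow_mul, ← hρ.map_natCast_smul hklv l (hsmul ▸ hkv), hsmul]
  rw [hrefine hk hl hvk, hrefine hl hk hvl, mul_comm l k, mul_comm (l : ℝ)]

/-- The value of the extension at `v` is `ρ (v / k) ^ k` for every large `k`. -/
theorem exists_monoidHom (hρ : IsHomOnBall ε ρ) (hε : 0 < ε) :
    ∃ φ : Multiplicative W →* N, ∀ v, ‖v‖ < ε → φ (ofAdd v) = ρ v := by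
  have hlarge (r : ℝ) : ∃ k : ℕ, 0 < k ∧ r < k * ε := by
    obtain ⟨k, hk⟩ := exists_nat_gt (max 0 (r / ε))
    exact ⟨k, by exact_mod_cast (le_max_left _ _).trans_lt hk,
      (div_lt_iff₀ hε).1 ((le_max_right _ _).trans_lt hk)⟩
  choose K hK0 hK using fun v : W => hlarge ‖v‖
  let φ (v : W) : N := ρ ((K v : ℝ)⁻¹ • v) ^ K v
  have hφ {v : W} {k : ℕ} (hk : 0 < k) (hv : ‖v‖ < k * ε) : φ v = ρ ((k : ℝ)⁻¹ • v) ^ k :=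
    hρ.pow_inv_natCast_smul (hK0 v) hk (hK v) hv
  have hφball (v : W) (hv : ‖v‖ < ε) : φ v = ρ v := by
    rw [hφ one_pos (by simpa using hv)]
    simp
  refine ⟨⟨⟨fun v => φ v.toAdd, ?_⟩, fun v w => ?_⟩, hφball⟩
  · exact (hφball 0 (by simpa using hε)).trans hρ.map_zero
  · induction v with | ofAdd v => ?_
    induction w with | ofAdd w => ?_
    obtain ⟨k, hk0, hk⟩ := hlarge (‖v‖ + ‖w‖)
    have hv : ‖v‖ < k * ε := by linarith [norm_nonneg w]
    have hw : ‖w‖ < k * ε := by linarith [norm_nonneg v]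
    have hvw : ‖v + w‖ < k * ε := (norm_add_le v w).trans_lt hk
    have hsum : ‖(k : ℝ)⁻¹ • v + (k : ℝ)⁻¹ • w‖ < ε := by
      rw [← smul_add]
      exact norm_inv_natCast_smul_lt hk0 hvw
    change φ (v + w) = φ v * φ w
    have hv' := norm_inv_natCast_smul_lt hk0 hv
    have hw' := norm_inv_natCast_smul_lt hk0 hw
    rw [hφ hk0 hvw, hφ hk0 hv, hφ hk0 hw, smul_add, hρ.map_add _ _ hv' hw' hsum,
      (hρ.commute hv' hw' hsum).mul_pow]

end IsHomOnBall

end HomOnBall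

section CoframeAction

open Set Filter Topology

variable {E : Type*} [NormedAddCommGroup E] [NormedSpace ℝ E]
  {F : Type*} [TopologicalSpace F] [ChartedSpace E F]
  {W : Type*} [NormedAddCommGroup W] [NormedSpace ℝ W]
  {η : F → E →L[ℝ] W} {act : W → F → F}

/-- The action on `F` integrating the coframe `η`: an additive action of `W` whose orbit maps pull
`η` back to the constant form `id`, are open, and are uniformly locally injective. It is a plain
function since two actions on the same `F`, for different coframes, are compared below. -/
structure IsCoframeAction (η : F → E →L[ℝ] W) (act : W → F → F) : Prop where
  zero_act : ∀ y, act 0 y = y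
  add_act : ∀ v w y, act (v + w) y = act v (act w y)
  contMDiff : ∀ y, ContMDiff 𝓘(ℝ, W) 𝓘(ℝ, E) ∞ fun v => act v y
  pullback : ∀ y v, pullbackForm η (fun v => act v y) v = ContinuousLinearMap.id ℝ W
  isOpenMap : ∀ y, IsOpenMap fun v => act v y
  locallyFree : ∃ ε > 0, ∀ y v, ‖v‖ < ε → act v y = y → v = 0

theorem isCoframeAction_of_isLocalOrbitMap {ε : ℝ} (hε : 0 < ε) {s : F → W → F}
    (hs : ∀ y, IsLocalOrbitMap η ε y (s y)) (hact : ∀ y v, ‖v‖ < ε → act v y = s y v)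
    (hadd : ∀ v w y, act (v + w) y = act v (act w y)) : IsCoframeAction η act := by
  have hball : (0 : W) ∈ Metric.ball 0 ε := Metric.mem_ball_self hε
  have hloc (y : F) (v : W) : (fun w => act w y) =ᶠ[𝓝 v] fun w => s (act v y) (w - v) := by
    filter_upwards [Metric.ball_mem_nhds v hε] with w hw
    rw [← hact _ _ (mem_ball_iff_norm.1 hw), ← hadd, sub_add_cancel]
  have hdiff (y : F) (v : W) : ContMDiffAt 𝓘(ℝ, W) 𝓘(ℝ, E) ∞ (s y) (v - v) :=
    (hs y).contMDiffOn.contMDiffAt (Metric.isOpen_ball.mem_nhds (by simpa using hε))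
  refine ⟨fun y => ?_, hadd, fun y v => ?_, fun y v => ?_, fun y => ?_, ε, hε, fun y v hv h => ?_⟩
  · rw [hact y 0 (by simpa using hε), (hs y).map_zero]
  · refine ContMDiffAt.congr_of_eventuallyEq ?_ (hloc y v)
    exact ContMDiffAt.comp (f := fun w => w - v) v (hdiff (act v y) v)
      (contMDiff_iff_contDiff.2 (by fun_prop)).contMDiffAt
  · rw [pullbackForm_congr (hloc y v), pullbackForm_comp (g := fun w => w - v)
      ((hdiff _ v).mdifferentiableAt (by simp)) ((hasFDerivAt_id v).sub_const v),
      (hs _).pullback _ (by rwa [sub_self])]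
    rfl
  · refine isOpenMap_iff_nhds_le.2 fun v => ?_
    have htranslation : map (fun w => w - v) (𝓝 v) = 𝓝 0 := by simp [sub_eq_add_neg]
    rw [map_congr (hloc y v)]
    refine (hs (act v y)).nhds_le.trans_eq ?_
    rw [← htranslation, map_map]
    rfl
  · rw [hact y v hv] at h
    exact (hs y).injOn (mem_ball_zero_iff.2 hv) hball (h.trans (hs y).map_zero.symm)

theorem IsFlatCoframe.exists_isCoframeAction [CompactSpace F] [T2Space F]
    (hη : IsFlatCoframe η) : ∃ act, IsCoframeAction η act := by
  obtain ⟨ε, hε, h⟩ := hη.exists_forall_isLocalOrbitMap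
  choose s hs using h
  have hadd (v w : W) (hv : ‖v‖ < ε) (hw : ‖w‖ < ε) (hvw : ‖v + w‖ < ε) (y : F) :
      s y (v + w) = s (s y w) v := by
    rw [add_comm] at hvw ⊢
    exact (hη.localOrbitMap_add hs y hw hv hvw).symm
  have hhom : IsHomOnBall (N := Function.End F) ε (fun v y => s y v) :=
    ⟨funext fun y => (hs y).map_zero, fun v w hv hw hvw => funext (hadd v w hv hw hvw)⟩
  obtain ⟨φ, hφ⟩ := hhom.exists_monoidHom hε
  exact ⟨fun v => φ (Multiplicative.ofAdd v), isCoframeAction_of_isLocalOrbitMap hε hs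
    (fun y v hv => congrFun (hφ v hv) y)
    fun v w y => congrFun (map_mul φ (Multiplicative.ofAdd v) (Multiplicative.ofAdd w)) y⟩

namespace IsCoframeAction

theorem mdifferentiable (h : IsCoframeAction η act) (y : F) :
    MDifferentiable 𝓘(ℝ, W) 𝓘(ℝ, E) fun v => act v y :=
  (h.contMDiff y).mdifferentiable (by simp)

/-- The action as an instance of Mathlib's additive actions. -/
abbrev toAddAction (h : IsCoframeAction η act) : AddAction W F where
  vadd := act
  zero_vadd := h.zero_act
  add_vadd := h.add_act

theorem surjective (h : IsCoframeAction η act) [ConnectedSpace F] (y : F) :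
    Function.Surjective fun v => act v y := by
  let := h.toAddAction
  rw [← range_eq_univ]
  refine IsClopen.eq_univ ⟨⟨?_⟩, (h.isOpenMap y).isOpen_range⟩ (range_nonempty _)
  rw [isOpen_iff_mem_nhds]
  intro x hx
  filter_upwards [(h.isOpenMap x).isOpen_range.mem_nhds ⟨0, h.zero_act x⟩] with z hzx hzy
  exact hx (AddAction.orbit_eq_iff.1 ((AddAction.orbit_eq_iff.2 hzx).symm.trans
    (AddAction.orbit_eq_iff.2 hzy)))

/-- The period lattice of a coframe: the stabilizer of a point under its action. -/
def stabilizer (h : IsCoframeAction η act) (y : F) : Submodule ℤ W :=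
  let := h.toAddAction
  AddSubgroup.toIntSubmodule (AddAction.stabilizer W y)

theorem mem_stabilizer (h : IsCoframeAction η act) {y : F} {v : W} :
    v ∈ h.stabilizer y ↔ act v y = y := Iff.rfl

theorem sub_mem_stabilizer (h : IsCoframeAction η act) {v w : W} {y : F}
    (hvw : act v y = act w y) : v - w ∈ h.stabilizer y := by
  rw [h.mem_stabilizer, sub_eq_neg_add, h.add_act, hvw, ← h.add_act, neg_add_cancel, h.zero_act]

theorem stabilizer_eq (h : IsCoframeAction η act) [ConnectedSpace F] (y y' : F) :
    h.stabilizer y = h.stabilizer y' := by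
  obtain ⟨w, rfl⟩ := h.surjective y y'
  have hinj : Function.Injective (act w) := let := h.toAddAction; AddAction.injective w
  ext v
  rw [h.mem_stabilizer, h.mem_stabilizer, ← h.add_act, add_comm, h.add_act, hinj.eq_iff]

instance discreteTopology_stabilizer (h : IsCoframeAction η act) (y : F) :
    DiscreteTopology (h.stabilizer y) := by
  obtain ⟨ε, hε, hfree⟩ := h.locallyFree
  rw [discreteTopology_iff_isOpen_singleton_zero, Metric.isOpen_singleton_iff]
  refine ⟨ε, hε, fun v hv => Subtype.ext (hfree y v ?_ v.2)⟩
  rwa [dist_zero_right] at hv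

theorem exists_norm_lt_sub_mem_stabilizer (h : IsCoframeAction η act) [CompactSpace F]
    [ConnectedSpace F] (y : F) : ∃ R : ℝ, ∀ v, ∃ w, ‖w‖ < R ∧ v - w ∈ h.stabilizer y := by
  obtain ⟨R, hR⟩ := isCompact_univ.elim_directed_cover
    (fun R : ℕ => (fun v => act v y) '' Metric.ball 0 (R : ℝ))
    (fun R => h.isOpenMap y _ Metric.isOpen_ball) (fun x _ => by
      obtain ⟨v, rfl⟩ := h.surjective y x
      obtain ⟨R, hR⟩ := exists_nat_gt ‖v‖
      exact mem_iUnion.2 ⟨R, v, by simpa using hR, rfl⟩)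
    (Monotone.directed_le fun R R' hRR' => image_mono
      (Metric.ball_subset_ball (by exact_mod_cast hRR')))
  refine ⟨R, fun v => ?_⟩
  obtain ⟨w, hw, hwv⟩ := hR (mem_univ (act v y))
  exact ⟨w, by simpa using hw, h.sub_mem_stabilizer hwv.symm⟩

/-- A linear form vanishing on the stabilizer is bounded, since the stabilizer is cocompact. -/
instance isZLattice_stabilizer (h : IsCoframeAction η act) [FiniteDimensional ℝ W]
    [CompactSpace F] [ConnectedSpace F] (y : F) : IsZLattice ℝ (h.stabilizer y) := by
  refine ⟨?_⟩
  by_contra hne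
  obtain ⟨R, hR⟩ := h.exists_norm_lt_sub_mem_stabilizer y
  obtain ⟨f, hf0, hf⟩ := Submodule.exists_le_ker_of_lt_top _ (lt_top_iff_ne_top.2 hne)
  obtain ⟨v, hv⟩ : ∃ v, f v ≠ 0 := by
    by_contra! hall
    exact hf0 (LinearMap.ext hall)
  set g : W →L[ℝ] ℝ := LinearMap.toContinuousLinearMap f
  obtain ⟨N, hN⟩ := exists_nat_gt (‖g‖ * R / |f v|)
  obtain ⟨w, hw, hmem⟩ := hR ((N : ℝ) • v)
  have hfw : f ((N : ℝ) • v) = f w := by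
    rw [← sub_eq_zero, ← map_sub]
    exact hf (Submodule.subset_span hmem)
  have hbound : |f w| ≤ ‖g‖ * R := (g.le_opNorm w).trans (by gcongr)
  rw [← hfw, map_smul, smul_eq_mul, abs_mul, Nat.abs_cast] at hbound
  rw [div_lt_iff₀ (abs_pos.2 hv)] at hN
  linarith

theorem nonempty_basis_stabilizer (h : IsCoframeAction η act) [FiniteDimensional ℝ W]
    [CompactSpace F] [ConnectedSpace F] {n : ℕ} (hn : Module.finrank ℝ W = n) (y : F) :
    Nonempty (Module.Basis (Fin n) ℤ (h.stabilizer y)) := by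
  have := ZLattice.module_free ℝ (h.stabilizer y)
  have := ZLattice.module_finite ℝ (h.stabilizer y)
  exact ⟨Module.finBasisOfFinrankEq ℤ (h.stabilizer y) ((ZLattice.rank ℝ _).trans hn)⟩

end IsCoframeAction

end CoframeAction

section Comparison

open Set Filter Topology

variable {E : Type*} [NormedAddCommGroup E] [NormedSpace ℝ E]
  {F : Type*} [TopologicalSpace F] [ChartedSpace E F]
  {W : Type*} [NormedAddCommGroup W] [NormedSpace ℝ W]
  {X : Type*} [NormedAddCommGroup X] [NormedSpace ℝ X]
  {η η' : F → E →L[ℝ] W} {act act' : W → F → F}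

/-- `g` is the primitive, vanishing at the origin, of the pullback of the coframe `η` under `k`. -/
structure IsCoframePrimitive (η : F → E →L[ℝ] W) (k : X → F) (g : X → W) : Prop where
  map_zero : g 0 = 0
  hasFDerivAt : ∀ p, HasFDerivAt g (pullbackForm η k p) p

namespace IsCoframePrimitive

variable {k : X → F} {g : X → W}

theorem unique {g' : X → W} (hg : IsCoframePrimitive η k g) (hg' : IsCoframePrimitive η k g') :
    g = g' := by
  refine (eqOn_univ _ _).1 (isOpen_univ.eqOn_of_fderiv_eq (𝕜 := ℝ) isPreconnected_univ
    (fun p _ => (hg.hasFDerivAt p).differentiableAt.differentiableWithinAt)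
    (fun p _ => (hg'.hasFDerivAt p).differentiableAt.differentiableWithinAt) (fun p _ => ?_)
    (mem_univ 0) (hg.map_zero.trans hg'.map_zero.symm))
  rw [(hg.hasFDerivAt p).fderiv, (hg'.hasFDerivAt p).fderiv]

theorem comp {Y : Type*} [NormedAddCommGroup Y] [NormedSpace ℝ Y] {f : Y → X}
    (hg : IsCoframePrimitive η k g) (hk : MDifferentiable 𝓘(ℝ, X) 𝓘(ℝ, E) k)
    (hf : Differentiable ℝ f) (hf0 : f 0 = 0) :
    IsCoframePrimitive η (fun p => k (f p)) fun p => g (f p) where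
  map_zero := by rw [hf0, hg.map_zero]
  hasFDerivAt p := by
    rw [pullbackForm_comp (hk _) (hf p).hasFDerivAt]
    exact (hg.hasFDerivAt (f p)).comp p (hf p).hasFDerivAt

theorem differentiable (hg : IsCoframePrimitive η k g) : Differentiable ℝ g :=
  fun p => (hg.hasFDerivAt p).differentiableAt

/-- Both sides start at `k 0` and have the same pullback of `η`. -/
theorem act_eq [T2Space F] (hg : IsCoframePrimitive η k g) (h : IsCoframeAction η act)
    (hη : IsFlatCoframe η) (hk : MDifferentiable 𝓘(ℝ, X) 𝓘(ℝ, E) k) (p : X) :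
    act (g p) (k 0) = k p := by
  refine hη.eqOn_of_pullbackForm_eq (k := fun p => act (g p) (k 0)) (k' := k)
    isOpen_univ isPreconnected_univ
    ((h.mdifferentiable _).comp hg.differentiable.mdifferentiable).mdifferentiableOn
    hk.mdifferentiableOn (fun p _ => ?_) (mem_univ 0) ?_ (mem_univ p)
  · rw [pullbackForm_comp (h.mdifferentiable _ (g p)) (hg.hasFDerivAt p), h.pullback,
      ContinuousLinearMap.id_comp]
  · rw [hg.map_zero, h.zero_act]

theorem _root_.IsCoframeAction.isCoframePrimitive_id (h : IsCoframeAction η act) (y : F) :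
    IsCoframePrimitive η (fun v => act v y) id where
  map_zero := rfl
  hasFDerivAt v := by
    rw [h.pullback]
    exact hasFDerivAt_id v

variable {y : F} {g : W → W}

theorem act_orbit_eq [T2Space F] (h : IsCoframeAction η act) (h' : IsCoframeAction η' act')
    (hη' : IsFlatCoframe η') (hg : IsCoframePrimitive η' (fun v => act v y) g) (v : W) :
    act' (g v) y = act v y := by
  simpa only [h.zero_act] using hg.act_eq h' hη' (h.mdifferentiable y) v

theorem leftInverse [T2Space F] (h : IsCoframeAction η act) (h' : IsCoframeAction η' act')
    (hη' : IsFlatCoframe η') (hg : IsCoframePrimitive η' (fun v => act v y) g) {g' : W → W}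
    (hg' : IsCoframePrimitive η (fun v => act' v y) g') : Function.LeftInverse g' g := by
  have hcomp : IsCoframePrimitive η (fun v => act v y) fun v => g' (g v) := by
    simpa only [act_orbit_eq h h' hη' hg] using
      hg'.comp (h'.mdifferentiable y) hg.differentiable hg.map_zero
  exact congrFun (hcomp.unique (h.isCoframePrimitive_id y))

theorem map_add (h : IsCoframeAction η act) (hg : IsCoframePrimitive η' (fun v => act v y) g)
    {l : W} (hl : l ∈ h.stabilizer y) (v : W) : g (v + l) = g v + g l := by
  have hperiodic : (fun v => act (v + l) y) = fun v => act v y := by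
    funext v
    rw [h.add_act, h.mem_stabilizer.1 hl]
  have hshift : IsCoframePrimitive η' (fun v => act v y) fun v => g (v + l) - g l := by
    refine ⟨by simp, fun v => ?_⟩
    have htranslate : HasFDerivAt (fun v => v + l) (ContinuousLinearMap.id ℝ W) v :=
      (hasFDerivAt_id v).add_const l
    rw [← hperiodic, pullbackForm_comp (h.mdifferentiable y _) htranslate]
    exact ((hg.hasFDerivAt (v + l)).comp v htranslate).sub_const (g l)
  exact sub_eq_iff_eq_add.1 (congrFun (hshift.unique hg) v)

theorem span_range_basis [T2Space F] (h : IsCoframeAction η act) (h' : IsCoframeAction η' act')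
    (hη : IsFlatCoframe η) (hη' : IsFlatCoframe η')
    (hg : IsCoframePrimitive η' (fun v => act v y) g) {g' : W → W}
    (hg' : IsCoframePrimitive η (fun v => act' v y) g') {ι : Type*}
    (b : Module.Basis ι ℤ (h.stabilizer y)) :
    Submodule.span ℤ (range fun i => g (b i)) = h'.stabilizer y := by
  let f : h.stabilizer y →ₗ[ℤ] W :=
    (AddMonoidHom.mk' (fun v : h.stabilizer y => g v) fun v w =>
      map_add h hg w.2 v).toIntLinearMap
  have hrange : LinearMap.range f = h'.stabilizer y := by
    refine le_antisymm ?_ fun w hw => ?_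
    · rintro _ ⟨v, rfl⟩
      exact (act_orbit_eq h h' hη' hg v).trans v.2
    · exact ⟨⟨g' w, (act_orbit_eq h' h hη hg' w).trans hw⟩, leftInverse h' h hη hg' hg w⟩
  rw [← hrange, LinearMap.range_eq_map, ← b.span_eq, Submodule.map_span, ← range_comp]
  rfl

/-- The values of a primitive on the lattice are loop integrals. -/
theorem eq_intervalIntegral [CompleteSpace W] {k : X → F} {g : X → W}
    (hg : IsCoframePrimitive η k g) (hk : MDifferentiable 𝓘(ℝ, X) 𝓘(ℝ, E) k) (p : X)
    (hcont : Continuous fun t : ℝ => pullbackForm η (fun t : ℝ => k (t • p)) t) :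
    g p = ∫ t in (0 : ℝ)..1, pullbackForm η (fun t : ℝ => k (t • p)) t 1 := by
  have hline : IsCoframePrimitive η (fun t : ℝ => k (t • p)) fun t : ℝ => g (t • p) :=
    hg.comp hk (by fun_prop) (zero_smul ℝ p)
  rw [intervalIntegral.integral_eq_sub_of_hasDerivAt
    (fun t _ => (hline.hasFDerivAt t).hasDerivAt)
    ((hcont.clm_apply continuous_const).intervalIntegrable _ _)]
  simp [hg.map_zero]

end IsCoframePrimitive

theorem IsCoframeAction.mem_stabilizer_iff_exists_loop [T2Space F] [ConnectedSpace F]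
    (h : IsCoframeAction η act) (hη : IsFlatCoframe η) {y : F} {l : W} :
    l ∈ h.stabilizer y ↔ ∃ k : ℝ → F, ContMDiff 𝓘(ℝ, ℝ) 𝓘(ℝ, E) ∞ k ∧
      (∀ t, pullbackForm η k t 1 = l) ∧ k 1 = k 0 := by
  constructor
  · intro hl
    refine ⟨fun t => act (t • l) y, (h.contMDiff y).comp (contMDiff_iff_contDiff.2 (by fun_prop)),
      fun t => ?_, ?_⟩
    · have hline : HasFDerivAt (fun t : ℝ => t • l) _ t :=
        ((hasDerivAt_id t).smul_const l).hasFDerivAt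
      rw [pullbackForm_comp (h.mdifferentiable y _) hline, h.pullback]
      simp
    · simp only [one_smul, zero_smul, h.zero_act, h.mem_stabilizer.1 hl]
  · rintro ⟨k, hk, hpull, hclosed⟩
    have hprimitive : IsCoframePrimitive η k fun t : ℝ => t • l := by
      refine ⟨zero_smul ℝ l, fun t => ?_⟩
      refine ((hasDerivAt_id t).smul_const l).hasFDerivAt.congr_fderiv ?_
      exact ContinuousLinearMap.ext_ring (by simpa using (hpull t).symm)
    have hact := hprimitive.act_eq h hη (hk.mdifferentiable (by simp)) 1
    rw [h.stabilizer_eq y (k 0), h.mem_stabilizer, ← one_smul ℝ l, hact, hclosed]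

end Comparison

section InverseFunction

open Set Filter Topology

variable {X Y : Type*} [NormedAddCommGroup X] [NormedSpace ℝ X] [CompleteSpace X]
  [NormedAddCommGroup Y] [NormedSpace ℝ Y] [CompleteSpace Y]

theorem exists_openPartialHomeomorph_of_bijective {s : Set X} (hs : IsOpen s) {g : X → Y}
    {g' : X → X →L[ℝ] Y} (hg' : ContDiffOn ℝ ∞ g' s) (hg : ∀ x ∈ s, HasFDerivAt g (g' x) x)
    (hbij : ∀ x ∈ s, Function.Bijective (g' x)) {x₀ : X} (hx₀ : x₀ ∈ s) :
    ∃ G : OpenPartialHomeomorph X Y, x₀ ∈ G.source ∧ G.source ⊆ s ∧ ⇑G = g ∧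
      ContDiffOn ℝ ∞ G G.source ∧ ContDiffOn ℝ ∞ G.symm G.target := by
  have hgs : ContDiffOn ℝ ∞ g s := by
    rw [contDiffOn_infty_iff_fderiv_of_isOpen hs]
    exact ⟨fun x hx => (hg x hx).differentiableAt.differentiableWithinAt,
      hg'.congr fun x hx => (hg x hx).fderiv⟩
  have hgx (x : X) (hx : x ∈ s) : ContDiffAt ℝ ∞ g x := hgs.contDiffAt (hs.mem_nhds hx)
  let L (x : X) (hx : x ∈ s) : X ≃L[ℝ] Y := ContinuousLinearEquiv.ofBijective (g' x)
    (LinearMap.ker_eq_bot.2 (hbij x hx).1) (LinearMap.range_eq_top.2 (hbij x hx).2)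
  have hL (x : X) (hx : x ∈ s) : HasFDerivAt g (L x hx : X →L[ℝ] Y) x := by
    exact hg x hx
  let G := ((hgx x₀ hx₀).toOpenPartialHomeomorph g (hL x₀ hx₀) (by simp)).restrOpen s hs
  have hsrc : G.source ⊆ s := fun x hx => hx.2
  refine ⟨G, ⟨(hgx x₀ hx₀).mem_toOpenPartialHomeomorph_source (hL x₀ hx₀) (by simp), hx₀⟩, hsrc,
    rfl, hgs.mono hsrc, fun y hy => ?_⟩
  have hmem : G.symm y ∈ s := hsrc (G.map_target hy)
  exact (G.contDiffAt_symm hy (hL _ hmem) (hgx _ hmem)).contDiffWithinAt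

end InverseFunction

section MixedPart

open Set Filter Topology

variable {X Y : Type*} [NormedAddCommGroup X] [NormedSpace ℝ X]
  [NormedAddCommGroup Y] [NormedSpace ℝ Y]

/-- The bilinear map underlying an alternating 2-form. -/
noncomputable def twoFormToBilin : X [⋀^Fin 2]→L[ℝ] ℝ →L[ℝ] X →L[ℝ] X →L[ℝ] ℝ :=
  (ContinuousLinearMap.compL ℝ X (X [⋀^Fin 1]→L[ℝ] ℝ) (X →L[ℝ] ℝ)
    ((ContinuousAlternatingMap.ofSubsingletonLIE (𝕜 := ℝ) (E := X) (F := ℝ)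
      (0 : Fin 1)).symm.toContinuousLinearEquiv.toContinuousLinearMap)).comp
    (ContinuousAlternatingMap.curryLeftLI (𝕜 := ℝ) (E := X) (F := ℝ)
      (n := 1)).toContinuousLinearMap

theorem twoFormToBilin_apply (τ : X [⋀^Fin 2]→L[ℝ] ℝ) (v w : X) :
    twoFormToBilin τ v w = τ ![v, w] := by
  change τ (Matrix.vecCons v fun _ => w) = _
  refine congrArg τ (funext fun i => ?_)
  fin_cases i <;> rfl

theorem twoFormToBilin_swap (τ : X [⋀^Fin 2]→L[ℝ] ℝ) (v w : X) :
    twoFormToBilin τ v w = -twoFormToBilin τ w v := by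
  have hswap : ![w, v] ∘ Equiv.swap (0 : Fin 2) 1 = ![v, w] := by
    funext i
    fin_cases i <;> rfl
  rw [twoFormToBilin_apply, twoFormToBilin_apply, ← hswap]
  exact τ.toAlternatingMap.map_swap ![w, v] (zero_ne_one (α := Fin 2))

/-- The mixed part `w ↦ (v ↦ τ ((v, 0), (0, w)))` of a 2-form on a product. -/
noncomputable def mixedPart : (X × Y) [⋀^Fin 2]→L[ℝ] ℝ →L[ℝ] Y →L[ℝ] X →L[ℝ] ℝ :=
  (ContinuousLinearMap.flipₗᵢ ℝ X Y ℝ).toContinuousLinearEquiv.toContinuousLinearMap.comp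
    ((((ContinuousLinearMap.compL ℝ X (X × Y →L[ℝ] ℝ) (Y →L[ℝ] ℝ))
      ((ContinuousLinearMap.compL ℝ Y (X × Y) ℝ).flip (ContinuousLinearMap.inr ℝ X Y))).comp
      ((ContinuousLinearMap.compL ℝ X (X × Y) (X × Y →L[ℝ] ℝ)).flip
        (ContinuousLinearMap.inl ℝ X Y))).comp twoFormToBilin)

theorem mixedPart_apply (τ : (X × Y) [⋀^Fin 2]→L[ℝ] ℝ) (v : X) (w : Y) :
    mixedPart τ w v = τ ![(v, 0), (0, w)] :=
  twoFormToBilin_apply τ _ _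

attribute [irreducible] twoFormToBilin mixedPart

theorem hasFDerivAt_mixedPart {Z : Type*} [NormedAddCommGroup Z] [NormedSpace ℝ Z]
    {Ω : Z → (X × Y) [⋀^Fin 2]→L[ℝ] ℝ} {Ω' : Z →L[ℝ] (X × Y) [⋀^Fin 2]→L[ℝ] ℝ} {q : Z}
    (hΩ : HasFDerivAt Ω Ω' q) :
    HasFDerivAt (fun q => mixedPart (Ω q)) (mixedPart.comp Ω') q :=
  HasFDerivAt.comp (g := mixedPart (X := X) (Y := Y)) q (ContinuousLinearMap.hasFDerivAt _) hΩ

/-- For a closed 2-form vanishing on vertical vectors, `dΩ((v, 0), (0, w), (0, w')) = 0` says that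
the mixed part of `Ω` is closed along the second factor. -/
theorem fderiv_mixedPart_symm {Ω : X × Y → (X × Y) [⋀^Fin 2]→L[ℝ] ℝ} {z : X} {p : Y}
    (hΩ : DifferentiableAt ℝ Ω (z, p)) (hclosed : extDeriv Ω (z, p) = 0)
    (hvert : ∀ᶠ q in 𝓝 (z, p), ∀ w w' : Y, Ω q ![(0, w), (0, w')] = 0) (w w' : Y) :
    fderiv ℝ (fun p => mixedPart (Ω (z, p))) p w w' =
      fderiv ℝ (fun p => mixedPart (Ω (z, p))) p w' w := by
  have happly (a b : Y) (v : X) : fderiv ℝ (fun p => mixedPart (Ω (z, p))) p a b v =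
      fderiv ℝ Ω (z, p) (0, a) ![(v, 0), (0, b)] := by
    have hslice : HasFDerivAt (fun p => Ω (z, p)) _ p :=
      hΩ.hasFDerivAt.comp p (hasFDerivAt_prodMk_right z p)
    rw [(hasFDerivAt_mixedPart hslice).fderiv]
    exact mixedPart_apply _ v b
  ext v
  have hzero : fderiv ℝ Ω (z, p) (v, 0) ![(0, w), (0, w')] = 0 := by
    rw [← fderiv_continuousAlternatingMap_apply_const_apply hΩ, Filter.EventuallyEq.fderiv_eq
      (f := fun _ => (0 : ℝ)) (hvert.mono fun q hq => hq w w')]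
    simp
  have hcyclic := fderiv_cyclic_of_extDeriv_eq_zero hclosed (v, (0 : Y)) ((0 : X), w) ((0 : X), w')
  rw [happly, happly]
  linarith

theorem fderiv_intervalIntegral_mixedPart_apply [FiniteDimensional ℝ X] {D : Set X} (hD : IsOpen D)
    {Ω : X × ℝ → (X × ℝ) [⋀^Fin 2]→L[ℝ] ℝ} (hΩ : ContDiffOn ℝ 1 Ω (D ×ˢ univ)) {z : X}
    (hz : z ∈ D) (a b : ℝ) (v v' : X) :
    fderiv ℝ (fun z => ∫ t in a..b, mixedPart (Ω (z, t)) 1) z v v' =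
      ∫ t in a..b, fderiv ℝ Ω (z, t) (v, 0) ![(v', 0), (0, 1)] := by
  have hopen : IsOpen (D ×ˢ (univ : Set ℝ)) := hD.prod isOpen_univ
  let f : X × ℝ → X →L[ℝ] ℝ := fun q => mixedPart (Ω q) 1
  have hf : ContDiffOn ℝ 1 f (D ×ˢ univ) :=
    ((mixedPart (X := X) (Y := ℝ)).contDiff.comp_contDiffOn hΩ).clm_apply contDiffOn_const
  have hfderiv (t : ℝ) : fderiv ℝ f (z, t) (v, 0) v' =
      fderiv ℝ Ω (z, t) (v, 0) ![(v', 0), (0, 1)] := by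
    have hΩt : DifferentiableAt ℝ Ω (z, t) :=
      (hΩ.contDiffAt (hopen.mem_nhds ⟨hz, mem_univ t⟩)).differentiableAt one_ne_zero
    rw [((hasFDerivAt_mixedPart hΩt.hasFDerivAt).clm_apply (hasFDerivAt_const 1 _)).fderiv]
    simp [mixedPart_apply]
  have hint : Continuous fun t => fderiv ℝ f (z, t) (v, 0) :=
    ((hf.continuousOn_fderiv_of_isOpen hopen le_rfl).comp_continuous (by fun_prop)
      fun t => ⟨hz, mem_univ t⟩).clm_apply continuous_const
  simp only [← hfderiv]
  rw [← ContinuousLinearMap.intervalIntegral_apply (hint.intervalIntegrable a b)]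
  exact congrArg (· v') (fderiv_intervalIntegral_apply hD hf a b hz v)

/-- The two sides differ by the integral over `t` of the derivative of `Ω (z, t) (v, v')`, which
has the same value at both ends. -/
theorem fderiv_intervalIntegral_mixedPart_symm [FiniteDimensional ℝ X] {D : Set X} (hD : IsOpen D)
    {Ω : X × ℝ → (X × ℝ) [⋀^Fin 2]→L[ℝ] ℝ} (hΩ : ContDiffOn ℝ 1 Ω (D ×ˢ univ)) {z : X}
    (hz : z ∈ D) (hclosed : ∀ t, extDeriv Ω (z, t) = 0) {a b : ℝ}
    (hends : ∀ v v' : X, Ω (z, b) ![(v, 0), (v', 0)] = Ω (z, a) ![(v, 0), (v', 0)]) (v v' : X) :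
    fderiv ℝ (fun z => ∫ t in a..b, mixedPart (Ω (z, t)) 1) z v v' =
      fderiv ℝ (fun z => ∫ t in a..b, mixedPart (Ω (z, t)) 1) z v' v := by
  have hopen : IsOpen (D ×ˢ (univ : Set ℝ)) := hD.prod isOpen_univ
  have hΩd (t : ℝ) : DifferentiableAt ℝ Ω (z, t) :=
    (hΩ.contDiffAt (hopen.mem_nhds ⟨hz, mem_univ t⟩)).differentiableAt one_ne_zero
  have hcont (u u₁ u₂ : X × ℝ) : Continuous fun t => fderiv ℝ Ω (z, t) u ![u₁, u₂] := by
    have hfderiv : Continuous fun t => fderiv ℝ Ω (z, t) :=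
      (hΩ.continuousOn_fderiv_of_isOpen hopen le_rfl).comp_continuous (by fun_prop)
        fun t => ⟨hz, mem_univ t⟩
    exact (ContinuousAlternatingMap.apply ℝ (X × ℝ) ℝ ![u₁, u₂]).continuous.comp
      (hfderiv.clm_apply continuous_const)
  have hcyclic (t : ℝ) : fderiv ℝ Ω (z, t) (v, 0) ![(v', 0), (0, 1)] -
      fderiv ℝ Ω (z, t) (v', 0) ![(v, 0), (0, 1)] =
        -fderiv ℝ Ω (z, t) (0, 1) ![(v, 0), (v', 0)] := by
    linarith [fderiv_cyclic_of_extDeriv_eq_zero (hclosed t) (v, (0 : ℝ)) (v', (0 : ℝ))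
      ((0 : X), (1 : ℝ))]
  have hprimitive (t : ℝ) : HasDerivAt (fun t => Ω (z, t) ![(v, 0), (v', 0)])
      (fderiv ℝ Ω (z, t) (0, 1) ![(v, 0), (v', 0)]) t :=
    ((hΩd t).hasFDerivAt.continuousAlternatingMap_apply_const _).comp_hasDerivAt t
      ((hasDerivAt_const t z).prodMk (hasDerivAt_id t))
  rw [fderiv_intervalIntegral_mixedPart_apply hD hΩ hz,
    fderiv_intervalIntegral_mixedPart_apply hD hΩ hz, ← sub_eq_zero,
    ← intervalIntegral.integral_sub ((hcont _ _ _).intervalIntegrable _ _)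
      ((hcont _ _ _).intervalIntegrable _ _)]
  simp only [hcyclic]
  rw [intervalIntegral.integral_neg, intervalIntegral.integral_eq_sub_of_hasDerivAt
    (fun t _ => hprimitive t) ((hcont _ _ _).intervalIntegrable _ _), hends, sub_self, neg_zero]

end MixedPart

section BilinAt

variable {m : ℕ} {M : Type*} [TopologicalSpace M] [ChartedSpace (EuclideanSpace ℝ (Fin m)) M]

/-- The bilinear form on the model space given by a 2-form at a point. -/
noncomputable def TwoForm.bilinAt (σ : TwoForm m M) (x : M) :
    EuclideanSpace ℝ (Fin m) →L[ℝ] EuclideanSpace ℝ (Fin m) →L[ℝ] ℝ :=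
  twoFormToBilin (σ x)

theorem TwoForm.bilinAt_apply (σ : TwoForm m M) (x : M) (v w : EuclideanSpace ℝ (Fin m)) :
    σ.bilinAt x v w = σ x ![v, w] :=
  twoFormToBilin_apply (X := EuclideanSpace ℝ (Fin m)) (σ x) v w

theorem TwoForm.bilinAt_swap (σ : TwoForm m M) (x : M) (v w : EuclideanSpace ℝ (Fin m)) :
    σ.bilinAt x v w = -σ.bilinAt x w v :=
  twoFormToBilin_swap (X := EuclideanSpace ℝ (Fin m)) (σ x) v w

end BilinAt

section LagrangianChart

open Set Filter Topology

theorem finrank_continuousDual (V : Type*) [NormedAddCommGroup V] [NormedSpace ℝ V]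
    [FiniteDimensional ℝ V] : Module.finrank ℝ (V →L[ℝ] ℝ) = Module.finrank ℝ V :=
  (LinearMap.toContinuousLinearMap (𝕜 := ℝ) (E := V) (F' := ℝ)).finrank_eq.symm.trans
    Subspace.dual_finrank_eq

variable {n : ℕ}

section ChartParam

variable {B M F : Type*} [TopologicalSpace B] [TopologicalSpace M] [TopologicalSpace F] {π : M → B}

/-- The part of the target of the chart `φ` over which `e` trivializes. -/
def chartDomain (e : Bundle.Trivialization F π)
    (φ : OpenPartialHomeomorph B (EuclideanSpace ℝ (Fin n))) : Set (EuclideanSpace ℝ (Fin n)) :=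
  φ.target ∩ φ.symm ⁻¹' e.baseSet

/-- The parametrization of the total space by `chartDomain e φ × F`. -/
noncomputable def chartParam (e : Bundle.Trivialization F π)
    (φ : OpenPartialHomeomorph B (EuclideanSpace ℝ (Fin n))) :
    OpenPartialHomeomorph (EuclideanSpace ℝ (Fin n) × F) M :=
  (φ.symm.prod (OpenPartialHomeomorph.refl F)).trans e.toOpenPartialHomeomorph.symm

variable {e : Bundle.Trivialization F π} {φ : OpenPartialHomeomorph B (EuclideanSpace ℝ (Fin n))}

theorem isOpen_chartDomain : IsOpen (chartDomain e φ) :=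
  φ.symm.continuousOn.isOpen_inter_preimage φ.open_target e.open_baseSet

theorem chartParam_source : (chartParam e φ).source = chartDomain e φ ×ˢ univ := by
  ext q
  simp [chartParam, chartDomain, e.target_eq]

theorem mem_chartParam_source {z : EuclideanSpace ℝ (Fin n)} (hz : z ∈ chartDomain e φ) (x : F) :
    (z, x) ∈ (chartParam e φ).source := by
  rw [chartParam_source]
  exact ⟨hz, mem_univ x⟩

theorem chartParam_injective {z : EuclideanSpace ℝ (Fin n)} (hz : z ∈ chartDomain e φ) :
    Function.Injective fun x : F => chartParam e φ (z, x) := fun x y hxy =>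
  congrArg Prod.snd ((chartParam e φ).injOn (mem_chartParam_source hz x)
    (mem_chartParam_source hz y) hxy)

theorem proj_chartParam {z : EuclideanSpace ℝ (Fin n)} (hz : z ∈ chartDomain e φ) (x : F) :
    π (chartParam e φ (z, x)) = φ.symm z :=
  e.proj_symm_apply (e.mem_target.2 hz.2)

theorem chartParam_proj {m : M} (hm : m ∈ e.source) (hφ : π m ∈ φ.source) :
    chartParam e φ (φ (π m), (e m).2) = m := by
  change e.toOpenPartialHomeomorph.symm (φ.symm (φ (π m)), (e m).2) = m
  rw [φ.left_inv hφ, ← e.coe_fst hm]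
  exact e.left_inv hm

end ChartParam

variable {B M F : Type*} [TopologicalSpace B]
  [TopologicalSpace M] [ChartedSpace (EuclideanSpace ℝ (Fin (2 * n))) M]
  [TopologicalSpace F] [ChartedSpace (EuclideanSpace ℝ (Fin n)) F]

/-- The differential of `chartParam`. -/
noncomputable def chartParamDeriv {π : M → B} (e : Bundle.Trivialization F π)
    (φ : OpenPartialHomeomorph B (EuclideanSpace ℝ (Fin n)))
    (q : EuclideanSpace ℝ (Fin n) × F) :
    EuclideanSpace ℝ (Fin n) × EuclideanSpace ℝ (Fin n) →L[ℝ] EuclideanSpace ℝ (Fin (2 * n)) :=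
  mfderiv ((𝓡 n).prod (𝓡 n)) (𝓡 (2 * n)) (chartParam e φ) q

/-- The form `w ↦ σ(·, w)` on the fibre over `φ.symm z`, with values in the dual of the model space
of the base. -/
noncomputable def fibreForm {π : M → B} (σ : TwoForm (2 * n) M) (e : Bundle.Trivialization F π)
    (φ : OpenPartialHomeomorph B (EuclideanSpace ℝ (Fin n))) (z : EuclideanSpace ℝ (Fin n))
    (x : F) : EuclideanSpace ℝ (Fin n) →L[ℝ] EuclideanSpace ℝ (Fin n) →L[ℝ] ℝ :=
  mixedPart (ContinuousAlternatingMap.compContinuousLinearMap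
    (σ (chartParam e φ (z, x)) : EuclideanSpace ℝ (Fin (2 * n)) [⋀^Fin 2]→L[ℝ] ℝ)
    (chartParamDeriv e φ (z, x)))

variable {π : M → B} {σ : TwoForm (2 * n) M} {e : Bundle.Trivialization F π}
  {φ : OpenPartialHomeomorph B (EuclideanSpace ℝ (Fin n))}

theorem fibreForm_apply (z : EuclideanSpace ℝ (Fin n)) (x : F) (v w : EuclideanSpace ℝ (Fin n)) :
    fibreForm σ e φ z x w v = σ.bilinAt (chartParam e φ (z, x))
      (chartParamDeriv e φ (z, x) (v, 0)) (chartParamDeriv e φ (z, x) (0, w)) := by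
  rw [fibreForm, mixedPart_apply, σ.bilinAt_apply]
  refine congrArg (σ (chartParam e φ (z, x))) (funext fun i => ?_)
  fin_cases i <;> rfl

variable [ChartedSpace (EuclideanSpace ℝ (Fin n)) B]

/-- A smooth local trivialization of a Lagrangian fibration together with a chart of the base. -/
structure IsLagrangianChart (σ : TwoForm (2 * n) M) (π : M → B) (e : Bundle.Trivialization F π)
    (φ : OpenPartialHomeomorph B (EuclideanSpace ℝ (Fin n))) : Prop where
  fibration : IsLagrangianFibration (F := F) σ π
  chart_mem : φ ∈ IsManifold.maximalAtlas (𝓡 n) ∞ B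
  smooth_triv : ContMDiffOn (𝓡 (2 * n)) ((𝓡 n).prod (𝓡 n)) ∞ e e.source
  smooth_triv_symm : ContMDiffOn ((𝓡 n).prod (𝓡 n)) (𝓡 (2 * n)) ∞
    e.toOpenPartialHomeomorph.symm e.target

namespace IsLagrangianChart

theorem contMDiffOn_chartParam (h : IsLagrangianChart σ π e φ) :
    ContMDiffOn ((𝓡 n).prod (𝓡 n)) (𝓡 (2 * n)) ∞ (chartParam e φ) (chartParam e φ).source := by
  refine h.smooth_triv_symm.comp (t := e.target) (f := fun q : EuclideanSpace ℝ (Fin n) × F =>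
    (φ.symm q.1, q.2)) (ContMDiffOn.prodMk ?_ contMDiffOn_snd) fun q hq => hq.2
  exact (contMDiffOn_symm_of_mem_maximalAtlas h.chart_mem).comp contMDiffOn_fst
    fun q hq => hq.1.1

theorem contMDiffOn_chartParam_symm (h : IsLagrangianChart σ π e φ) :
    ContMDiffOn (𝓡 (2 * n)) ((𝓡 n).prod (𝓡 n)) ∞ (chartParam e φ).symm (chartParam e φ).target := by
  refine ContMDiffOn.prodMk ?_ (contMDiffOn_snd.comp (t := univ)
    (h.smooth_triv.mono fun m hm => hm.1) fun m _ => mem_univ _)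
  exact (contMDiffOn_of_mem_maximalAtlas h.chart_mem).comp
    (contMDiffOn_fst.comp (t := univ) (h.smooth_triv.mono fun m hm => hm.1) fun m _ => mem_univ _)
    fun m hm => hm.2.1

variable {z : EuclideanSpace ℝ (Fin n)}

theorem hasMFDerivAt_chartParam (h : IsLagrangianChart σ π e φ) (hz : z ∈ chartDomain e φ)
    (x : F) : HasMFDerivAt ((𝓡 n).prod (𝓡 n)) (𝓡 (2 * n)) (chartParam e φ) (z, x)
      (chartParamDeriv e φ (z, x)) :=
  ((h.contMDiffOn_chartParam.contMDiffAt ((chartParam e φ).open_source.mem_nhds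
    (mem_chartParam_source hz x))).mdifferentiableAt (by simp)).hasMFDerivAt

theorem chartParamDeriv_bijective [IsManifold (𝓡 n) ∞ B] [IsManifold (𝓡 n) ∞ F]
    [IsManifold (𝓡 (2 * n)) ∞ M] (h : IsLagrangianChart σ π e φ)
    (hz : z ∈ chartDomain e φ) (x : F) : Function.Bijective (chartParamDeriv e φ (z, x)) :=
  OpenPartialHomeomorph.MDifferentiable.mfderiv_bijective
    ⟨h.contMDiffOn_chartParam.mdifferentiableOn (by simp),
      h.contMDiffOn_chartParam_symm.mdifferentiableOn (by simp)⟩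
    (mem_chartParam_source hz x)

theorem mfderiv_proj_chartParamDeriv (h : IsLagrangianChart σ π e φ) (hz : z ∈ chartDomain e φ)
    (x : F) (v w : EuclideanSpace ℝ (Fin n)) :
    mfderiv (𝓡 (2 * n)) (𝓡 n) π (chartParam e φ (z, x)) (chartParamDeriv e φ (z, x) (v, w)) =
      mfderiv (𝓡 n) (𝓡 n) φ.symm z v := by
  have hproj := ((h.fibration.smooth (chartParam e φ (z, x))).mdifferentiableAt
    (by simp)).hasMFDerivAt.comp (z, x) (h.hasMFDerivAt_chartParam hz x)
  have hsymm := ((contMDiffAt_symm_of_mem_maximalAtlas h.chart_mem hz.1).mdifferentiableAt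
    (by simp)).hasMFDerivAt.comp (z, x) (hasMFDerivAt_fst (I := 𝓡 n) (I' := 𝓡 n) (z, x))
  have heq : π ∘ chartParam e φ =ᶠ[𝓝 (z, x)] φ.symm ∘ Prod.fst := by
    filter_upwards [(isOpen_chartDomain.prod isOpen_univ).mem_nhds ⟨hz, mem_univ x⟩] with q hq
    exact proj_chartParam hq.1 q.2
  exact DFunLike.congr_fun (hasMFDerivAt_unique (hproj.congr_of_eventuallyEq heq.symm) hsymm) (v, w)

theorem bilinAt_vertical (h : IsLagrangianChart σ π e φ) (hz : z ∈ chartDomain e φ) (x : F)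
    (v w w' : EuclideanSpace ℝ (Fin n)) :
    σ.bilinAt (chartParam e φ (z, x)) (chartParamDeriv e φ (z, x) (v, w))
      (chartParamDeriv e φ (z, x) (0, w')) = fibreForm σ e φ z x w' v := by
  have hsplit : chartParamDeriv e φ (z, x) (v, w) =
      chartParamDeriv e φ (z, x) (v, 0) + chartParamDeriv e φ (z, x) (0, w) := by
    rw [← map_add, Prod.mk_add_mk, add_zero, zero_add]
  have hlagrangian : σ.bilinAt (chartParam e φ (z, x)) (chartParamDeriv e φ (z, x) (0, w))
      (chartParamDeriv e φ (z, x) (0, w')) = 0 := by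
    rw [σ.bilinAt_apply]
    exact h.fibration.lagrangian _ _ _
      ((h.mfderiv_proj_chartParamDeriv hz x 0 w).trans (map_zero _))
      ((h.mfderiv_proj_chartParamDeriv hz x 0 w').trans (map_zero _))
  rw [fibreForm_apply, hsplit, map_add, add_apply, hlagrangian, add_zero]

theorem fibreForm_bijective [IsManifold (𝓡 n) ∞ B] [IsManifold (𝓡 n) ∞ F]
    [IsManifold (𝓡 (2 * n)) ∞ M] (h : IsLagrangianChart σ π e φ) (hz : z ∈ chartDomain e φ)
    (x : F) : Function.Bijective (fibreForm σ e φ z x) := by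
  have hinj : Function.Injective (fibreForm σ e φ z x) := by
    rw [injective_iff_map_eq_zero]
    intro w hw
    have hzero : chartParamDeriv e φ (z, x) (0, w) = 0 := by
      refine h.fibration.symplectic.nondegenerate (chartParam e φ (z, x))
        (chartParamDeriv e φ (z, x) (0, w)) fun u => ?_
      obtain ⟨⟨v, w'⟩, rfl⟩ := (h.chartParamDeriv_bijective hz x).2 u
      refine (σ.bilinAt_apply _ _ _).symm.trans ?_
      rw [σ.bilinAt_swap, h.bilinAt_vertical hz x v w' w, hw, zero_apply, neg_zero]
    exact congrArg Prod.snd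
      ((h.chartParamDeriv_bijective hz x).1 (hzero.trans (map_zero _).symm))
  exact ⟨hinj, (LinearMap.injective_iff_surjective_of_finrank_eq_finrank
    (f := (fibreForm σ e φ z x).toLinearMap) (finrank_continuousDual _).symm).1 hinj⟩

end IsLagrangianChart

end LagrangianChart

section LagrangianChartClosed

open Set Filter Topology

variable {n : ℕ} {B M F : Type*} [TopologicalSpace B]
  [TopologicalSpace M] [ChartedSpace (EuclideanSpace ℝ (Fin (2 * n))) M]
  [TopologicalSpace F] {π : M → B}
  {X : Type*} [NormedAddCommGroup X] [NormedSpace ℝ X]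

/-- The expression of `σ` in the coordinates `(z, p) ↦ chartParam e φ (z, k p)`, where `k` is a map
into the typical fibre. -/
noncomputable def chartPullback (σ : TwoForm (2 * n) M) (e : Bundle.Trivialization F π)
    (φ : OpenPartialHomeomorph B (EuclideanSpace ℝ (Fin n))) (k : X → F) :
    EuclideanSpace ℝ (Fin n) × X → (EuclideanSpace ℝ (Fin n) × X) [⋀^Fin 2]→L[ℝ] ℝ :=
  σ.pullback fun q => chartParam e φ (q.1, k q.2)

variable [ChartedSpace (EuclideanSpace ℝ (Fin n)) B] [ChartedSpace (EuclideanSpace ℝ (Fin n)) F]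
  {σ : TwoForm (2 * n) M} {e : Bundle.Trivialization F π}
  {φ : OpenPartialHomeomorph B (EuclideanSpace ℝ (Fin n))} {z : EuclideanSpace ℝ (Fin n)}
  {k : X → F} {s : Set X} {p : X}

namespace IsLagrangianChart

theorem hasMFDerivAt_chartParam_comp (h : IsLagrangianChart σ π e φ) (hz : z ∈ chartDomain e φ)
    {k' : X →L[ℝ] EuclideanSpace ℝ (Fin n)} (hk : HasMFDerivAt 𝓘(ℝ, X) (𝓡 n) k p k') :
    HasMFDerivAt 𝓘(ℝ, EuclideanSpace ℝ (Fin n) × X) (𝓡 (2 * n))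
      (fun q => chartParam e φ (q.1, k q.2)) (z, p)
      ((chartParamDeriv e φ (z, k p)).comp
        ((ContinuousLinearMap.fst ℝ (EuclideanSpace ℝ (Fin n)) X).prod
          (k'.comp (ContinuousLinearMap.snd ℝ (EuclideanSpace ℝ (Fin n)) X)))) := by
  have hfst : HasMFDerivAt 𝓘(ℝ, EuclideanSpace ℝ (Fin n) × X) (𝓡 n)
      (fun q : EuclideanSpace ℝ (Fin n) × X => q.1) (z, p)
      (ContinuousLinearMap.fst ℝ (EuclideanSpace ℝ (Fin n)) X) :=
    hasFDerivAt_fst.hasMFDerivAt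
  have hsnd : HasMFDerivAt 𝓘(ℝ, EuclideanSpace ℝ (Fin n) × X) 𝓘(ℝ, X)
      (fun q : EuclideanSpace ℝ (Fin n) × X => q.2) (z, p)
      (ContinuousLinearMap.snd ℝ (EuclideanSpace ℝ (Fin n)) X) :=
    hasFDerivAt_snd.hasMFDerivAt
  exact HasMFDerivAt.comp (g := chartParam e φ) (z, p) (h.hasMFDerivAt_chartParam hz (k p))
    (hfst.prodMk (HasMFDerivAt.comp (g := k) (z, p) hk hsnd))

theorem contMDiffOn_chartParam_comp (h : IsLagrangianChart σ π e φ)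
    (hk : ContMDiffOn 𝓘(ℝ, X) (𝓡 n) ∞ k s) :
    ContMDiffOn 𝓘(ℝ, EuclideanSpace ℝ (Fin n) × X) (𝓡 (2 * n)) ∞
      (fun q => chartParam e φ (q.1, k q.2)) (chartDomain e φ ×ˢ s) := by
  have hfst : ContMDiff 𝓘(ℝ, EuclideanSpace ℝ (Fin n) × X) (𝓡 n) ∞
      (fun q : EuclideanSpace ℝ (Fin n) × X => q.1) :=
    contMDiff_iff_contDiff.2 contDiff_fst
  have hsnd : ContMDiff 𝓘(ℝ, EuclideanSpace ℝ (Fin n) × X) 𝓘(ℝ, X) ∞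
      (fun q : EuclideanSpace ℝ (Fin n) × X => q.2) :=
    contMDiff_iff_contDiff.2 contDiff_snd
  exact h.contMDiffOn_chartParam.comp (f := fun q : EuclideanSpace ℝ (Fin n) × X => (q.1, k q.2))
    (hfst.contMDiffOn.prodMk (hk.comp hsnd.contMDiffOn fun q hq => hq.2))
    fun q hq => mem_chartParam_source hq.1 _

theorem chartPullback_apply (h : IsLagrangianChart σ π e φ) (hz : z ∈ chartDomain e φ)
    {k' : X →L[ℝ] EuclideanSpace ℝ (Fin n)} (hk : HasMFDerivAt 𝓘(ℝ, X) (𝓡 n) k p k')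
    (v v' : EuclideanSpace ℝ (Fin n)) (w w' : X) :
    chartPullback σ e φ k (z, p) ![(v, w), (v', w')] =
      σ.bilinAt (chartParam e φ (z, k p)) (chartParamDeriv e φ (z, k p) (v, k' w))
        (chartParamDeriv e φ (z, k p) (v', k' w')) := by
  rw [chartPullback, σ.pullback_apply, (h.hasMFDerivAt_chartParam_comp hz hk).mfderiv,
    σ.bilinAt_apply]
  rfl

theorem mixedPart_chartPullback (h : IsLagrangianChart σ π e φ) (hz : z ∈ chartDomain e φ)
    (hk : MDifferentiableAt 𝓘(ℝ, X) (𝓡 n) k p) :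
    mixedPart (chartPullback σ e φ k (z, p)) = pullbackForm (fibreForm σ e φ z) k p := by
  let k' : X →L[ℝ] EuclideanSpace ℝ (Fin n) := mfderiv 𝓘(ℝ, X) (𝓡 n) k p
  have hk' : HasMFDerivAt 𝓘(ℝ, X) (𝓡 n) k p k' := hk.hasMFDerivAt
  ext w v
  rw [mixedPart_apply, h.chartPullback_apply hz hk', map_zero]
  exact (fibreForm_apply _ _ _ _).symm

theorem chartPullback_vertical (h : IsLagrangianChart σ π e φ) (hz : z ∈ chartDomain e φ)
    (hk : MDifferentiableAt 𝓘(ℝ, X) (𝓡 n) k p) (w w' : X) :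
    chartPullback σ e φ k (z, p) ![(0, w), (0, w')] = 0 := by
  let k' : X →L[ℝ] EuclideanSpace ℝ (Fin n) := mfderiv 𝓘(ℝ, X) (𝓡 n) k p
  have hk' : HasMFDerivAt 𝓘(ℝ, X) (𝓡 n) k p k' := hk.hasMFDerivAt
  rw [h.chartPullback_apply hz hk', h.bilinAt_vertical hz, map_zero]

variable {γ : ℝ → F}

theorem intervalIntegral_pullbackForm (h : IsLagrangianChart σ π e φ) (hz : z ∈ chartDomain e φ)
    (hγ : ContMDiff 𝓘(ℝ, ℝ) (𝓡 n) ∞ γ) (a b : ℝ) :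
    ∫ t in a..b, pullbackForm (fibreForm σ e φ z) γ t 1 =
      ∫ t in a..b, mixedPart (chartPullback σ e φ γ (z, t)) 1 :=
  intervalIntegral.integral_congr fun t _ => (DFunLike.congr_fun
    (h.mixedPart_chartPullback hz ((hγ t).mdifferentiableAt (by simp))) 1).symm

variable [IsManifold (𝓡 (2 * n)) ∞ M]

theorem contDiffOn_chartPullback (h : IsLagrangianChart σ π e φ) (hs : IsOpen s)
    (hk : ContMDiffOn 𝓘(ℝ, X) (𝓡 n) ∞ k s) :
    ContDiffOn ℝ ∞ (chartPullback σ e φ k) (chartDomain e φ ×ˢ s) :=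
  h.fibration.symplectic.contDiffOn_pullback (isOpen_chartDomain.prod hs)
    (h.contMDiffOn_chartParam_comp hk)

theorem extDeriv_chartPullback (h : IsLagrangianChart σ π e φ) (hz : z ∈ chartDomain e φ)
    (hs : IsOpen s) (hk : ContMDiffOn 𝓘(ℝ, X) (𝓡 n) ∞ k s) (hp : p ∈ s) :
    extDeriv (chartPullback σ e φ k) (z, p) = 0 :=
  h.fibration.symplectic.extDeriv_pullback (isOpen_chartDomain.prod hs)
    (h.contMDiffOn_chartParam_comp hk) ⟨hz, hp⟩

theorem contDiffOn_pullbackForm (h : IsLagrangianChart σ π e φ) (hz : z ∈ chartDomain e φ)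
    (hs : IsOpen s) (hk : ContMDiffOn 𝓘(ℝ, X) (𝓡 n) ∞ k s) :
    ContDiffOn ℝ ∞ (pullbackForm (fibreForm σ e φ z) k) s := by
  have hslice : ContDiffOn ℝ ∞ (fun p => chartPullback σ e φ k (z, p)) s :=
    (h.contDiffOn_chartPullback hs hk).comp (by fun_prop) fun p hp => ⟨hz, hp⟩
  refine ((mixedPart (X := EuclideanSpace ℝ (Fin n)) (Y := X)).contDiff.comp_contDiffOn
    hslice).congr fun p hp => ?_
  exact (h.mixedPart_chartPullback hz
    ((hk.contMDiffAt (hs.mem_nhds hp)).mdifferentiableAt (by simp))).symm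

theorem fderiv_pullbackForm_symm (h : IsLagrangianChart σ π e φ) (hz : z ∈ chartDomain e φ)
    (hs : IsOpen s) (hk : ContMDiffOn 𝓘(ℝ, X) (𝓡 n) ∞ k s) (hp : p ∈ s) (w w' : X) :
    fderiv ℝ (pullbackForm (fibreForm σ e φ z) k) p w w' =
      fderiv ℝ (pullbackForm (fibreForm σ e φ z) k) p w' w := by
  have hopen : IsOpen (chartDomain e φ ×ˢ s) := isOpen_chartDomain.prod hs
  have hkd {p : X} (hp : p ∈ s) : MDifferentiableAt 𝓘(ℝ, X) (𝓡 n) k p :=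
    (hk.contMDiffAt (hs.mem_nhds hp)).mdifferentiableAt (by simp)
  have hmixed : pullbackForm (fibreForm σ e φ z) k =ᶠ[𝓝 p]
      fun p => mixedPart (chartPullback σ e φ k (z, p)) := by
    filter_upwards [hs.mem_nhds hp] with p hp
    exact (h.mixedPart_chartPullback hz (hkd hp)).symm
  rw [hmixed.fderiv_eq]
  refine fderiv_mixedPart_symm (((h.contDiffOn_chartPullback hs hk).contDiffAt
    (hopen.mem_nhds ⟨hz, hp⟩)).differentiableAt (by simp)) (h.extDeriv_chartPullback hz hs hk hp)
    ?_ w w'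
  filter_upwards [hopen.mem_nhds ⟨hz, hp⟩] with q hq
  exact h.chartPullback_vertical hq.1 (hkd hq.2)

theorem contDiffOn_intervalIntegral_pullbackForm (h : IsLagrangianChart σ π e φ)
    (hγ : ContMDiff 𝓘(ℝ, ℝ) (𝓡 n) ∞ γ) (a b : ℝ) :
    ContDiffOn ℝ ∞ (fun z => ∫ t in a..b, pullbackForm (fibreForm σ e φ z) γ t 1)
      (chartDomain e φ) := by
  refine (contDiffOn_intervalIntegral isOpen_chartDomain
    (f := fun q => mixedPart (chartPullback σ e φ γ q) 1) ?_ a b).congr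
    fun z hz => h.intervalIntegral_pullbackForm hz hγ a b
  exact ((mixedPart (X := EuclideanSpace ℝ (Fin n)) (Y := ℝ)).contDiff.comp_contDiffOn
    (h.contDiffOn_chartPullback isOpen_univ hγ.contMDiffOn)).clm_apply contDiffOn_const

theorem fderiv_loopIntegral_symm (h : IsLagrangianChart σ π e φ) (hz : z ∈ chartDomain e φ)
    (hγ : ContMDiff 𝓘(ℝ, ℝ) (𝓡 n) ∞ γ) {a b : ℝ} (hloop : γ b = γ a)
    (v v' : EuclideanSpace ℝ (Fin n)) :
    fderiv ℝ (fun z => ∫ t in a..b, pullbackForm (fibreForm σ e φ z) γ t 1) z v v' =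
      fderiv ℝ (fun z => ∫ t in a..b, pullbackForm (fibreForm σ e φ z) γ t 1) z v' v := by
  have hmixed : (fun z => ∫ t in a..b, pullbackForm (fibreForm σ e φ z) γ t 1) =ᶠ[𝓝 z]
      fun z => ∫ t in a..b, mixedPart (chartPullback σ e φ γ (z, t)) 1 := by
    filter_upwards [isOpen_chartDomain.mem_nhds hz] with z hz
    exact h.intervalIntegral_pullbackForm hz hγ a b
  have hhorizontal (t : ℝ) (v v' : EuclideanSpace ℝ (Fin n)) :
      chartPullback σ e φ γ (z, t) ![(v, 0), (v', 0)] = σ.bilinAt (chartParam e φ (z, γ t))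
        (chartParamDeriv e φ (z, γ t) (v, 0)) (chartParamDeriv e φ (z, γ t) (v', 0)) := by
    let γ' : ℝ →L[ℝ] EuclideanSpace ℝ (Fin n) := mfderiv 𝓘(ℝ, ℝ) (𝓡 n) γ t
    have hγ' : HasMFDerivAt 𝓘(ℝ, ℝ) (𝓡 n) γ t γ' :=
      ((hγ t).mdifferentiableAt (by simp)).hasMFDerivAt
    rw [h.chartPullback_apply hz hγ', map_zero]
  rw [hmixed.fderiv_eq]
  exact fderiv_intervalIntegral_mixedPart_symm isOpen_chartDomain
    ((h.contDiffOn_chartPullback isOpen_univ hγ.contMDiffOn).of_le (by exact_mod_cast le_top)) hz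
    (fun t => h.extDeriv_chartPullback hz isOpen_univ hγ.contMDiffOn (mem_univ t))
    (fun v v' => by rw [hhorizontal, hhorizontal, hloop]) v v'

end IsLagrangianChart

end LagrangianChartClosed

section PeriodLattice

open Set Filter Topology

variable {n : ℕ} {B M F : Type*}
  [TopologicalSpace B] [ChartedSpace (EuclideanSpace ℝ (Fin n)) B]
  [TopologicalSpace M] [ChartedSpace (EuclideanSpace ℝ (Fin (2 * n))) M]
  [TopologicalSpace F] [ChartedSpace (EuclideanSpace ℝ (Fin n)) F]
  {π : M → B} {σ : TwoForm (2 * n) M} {e : Bundle.Trivialization F π}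
  {φ : OpenPartialHomeomorph B (EuclideanSpace ℝ (Fin n))} {z : EuclideanSpace ℝ (Fin n)}
  {μ : EuclideanSpace ℝ (Fin n) →L[ℝ] ℝ}

/-- An orbit, in the fibre over `b`, of the Hamiltonian flow of the covector `μ` at `b`: its
velocity is the vertical vector `X` with `σ(·, X) = π^*μ`. -/
structure IsHamiltonianOrbit (σ : TwoForm (2 * n) M) (π : M → B) (b : B)
    (μ : EuclideanSpace ℝ (Fin n) →L[ℝ] ℝ) (c : ℝ → M) : Prop where
  contMDiff : ContMDiff 𝓘(ℝ, ℝ) (𝓡 (2 * n)) ∞ c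
  proj_eq : ∀ t, π (c t) = b
  bilinAt_eq : ∀ (t : ℝ) (u : EuclideanSpace ℝ (Fin (2 * n))),
    σ.bilinAt (c t) u (mfderiv 𝓘(ℝ, ℝ) (𝓡 (2 * n)) c t (1 : ℝ)) =
      μ (mfderiv (𝓡 (2 * n)) (𝓡 n) π (c t) u)

/-- A covector at `b` is a period if its Hamiltonian flow on the fibre over `b` has a closed orbit
of period `1`. -/
def IsPeriodCovector (σ : TwoForm (2 * n) M) (π : M → B) (b : B)
    (μ : EuclideanSpace ℝ (Fin n) →L[ℝ] ℝ) : Prop :=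
  ∃ c : ℝ → M, IsHamiltonianOrbit σ π b μ c ∧ c 1 = c 0

namespace IsLagrangianChart

theorem mfderiv_chartParam_curve (h : IsLagrangianChart σ π e φ) (hz : z ∈ chartDomain e φ)
    {k : ℝ → F} {t : ℝ} {k' : ℝ →L[ℝ] EuclideanSpace ℝ (Fin n)}
    (hk : HasMFDerivAt 𝓘(ℝ, ℝ) (𝓡 n) k t k') :
    (mfderiv 𝓘(ℝ, ℝ) (𝓡 (2 * n)) (fun t => chartParam e φ (z, k t)) t (1 : ℝ) :
      EuclideanSpace ℝ (Fin (2 * n))) = chartParamDeriv e φ (z, k t) (0, k' 1) :=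
  DFunLike.congr_fun (HasMFDerivAt.comp (g := chartParam e φ) t
    (h.hasMFDerivAt_chartParam hz (k t)) ((hasMFDerivAt_const z t).prodMk hk)).mfderiv (1 : ℝ)

theorem contMDiff_chartParam_curve (h : IsLagrangianChart σ π e φ) (hz : z ∈ chartDomain e φ)
    {k : ℝ → F} (hk : ContMDiff 𝓘(ℝ, ℝ) (𝓡 n) ∞ k) :
    ContMDiff 𝓘(ℝ, ℝ) (𝓡 (2 * n)) ∞ fun t => chartParam e φ (z, k t) := fun t =>
  (h.contMDiffOn_chartParam.contMDiffAt ((chartParam e φ).open_source.mem_nhds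
    (mem_chartParam_source hz _))).comp t (contMDiffAt_const.prodMk (hk t))

theorem exists_eq_chartParam_curve (h : IsLagrangianChart σ π e φ) (hz : z ∈ chartDomain e φ)
    {c : ℝ → M} (hc : ContMDiff 𝓘(ℝ, ℝ) (𝓡 (2 * n)) ∞ c) (hπ : ∀ t, π (c t) = φ.symm z) :
    ∃ k : ℝ → F, ContMDiff 𝓘(ℝ, ℝ) (𝓡 n) ∞ k ∧ c = fun t => chartParam e φ (z, k t) := by
  have hsource (t : ℝ) : c t ∈ e.source := by
    rw [e.source_eq, mem_preimage, hπ]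
    exact hz.2
  refine ⟨fun t => (e (c t)).2, fun t => contMDiffAt_snd.comp t
    ((h.smooth_triv.contMDiffAt (e.open_source.mem_nhds (hsource t))).comp t (hc t)), ?_⟩
  funext t
  have hproj := chartParam_proj (φ := φ) (hsource t) (by rw [hπ]; exact φ.map_target hz.1)
  rw [hπ, φ.right_inv hz.1] at hproj
  exact hproj.symm

theorem exists_isCoframePrimitive [IsManifold (𝓡 (2 * n)) ∞ M]
    (h : IsLagrangianChart σ π e φ) (hz : z ∈ chartDomain e φ)
    {X : Type*} [NormedAddCommGroup X] [NormedSpace ℝ X] {k : X → F}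
    (hk : ContMDiff 𝓘(ℝ, X) (𝓡 n) ∞ k) :
    ∃ g, IsCoframePrimitive (fibreForm σ e φ z) k g := by
  obtain ⟨g, hg⟩ := convex_univ.exists_forall_hasFDerivAt_of_fderiv_symmetric isOpen_univ
    ((h.contDiffOn_pullbackForm hz isOpen_univ hk.contMDiffOn).differentiableOn (by simp))
    (fun y _ v w => h.fderiv_pullbackForm_symm hz isOpen_univ hk.contMDiffOn (mem_univ y) v w)
  exact ⟨fun v => g v - g 0, sub_self _, fun v => (hg v (mem_univ v)).sub_const _⟩

variable [IsManifold (𝓡 n) ∞ B] [IsManifold (𝓡 n) ∞ F] [IsManifold (𝓡 (2 * n)) ∞ M]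

theorem isHamiltonianOrbit_iff (h : IsLagrangianChart σ π e φ) (hz : z ∈ chartDomain e φ)
    {k : ℝ → F} (hk : ContMDiff 𝓘(ℝ, ℝ) (𝓡 n) ∞ k) :
    IsHamiltonianOrbit σ π (φ.symm z) μ (fun t => chartParam e φ (z, k t)) ↔
      ∀ t, pullbackForm (fibreForm σ e φ z) k t 1 = μ.comp (mfderiv (𝓡 n) (𝓡 n) φ.symm z) := by
  let k' (t : ℝ) : ℝ →L[ℝ] EuclideanSpace ℝ (Fin n) := mfderiv 𝓘(ℝ, ℝ) (𝓡 n) k t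
  have hk' (t : ℝ) : HasMFDerivAt 𝓘(ℝ, ℝ) (𝓡 n) k t (k' t) :=
    ((hk t).mdifferentiableAt (by simp)).hasMFDerivAt
  have hbilin (t : ℝ) (v w : EuclideanSpace ℝ (Fin n)) :
      σ.bilinAt (chartParam e φ (z, k t)) (chartParamDeriv e φ (z, k t) (v, w))
        (mfderiv 𝓘(ℝ, ℝ) (𝓡 (2 * n)) (fun t => chartParam e φ (z, k t)) t (1 : ℝ)) =
          pullbackForm (fibreForm σ e φ z) k t 1 v := by
    rw [h.mfderiv_chartParam_curve hz (hk' t), h.bilinAt_vertical hz]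
    rfl
  have hproj (t : ℝ) (v w : EuclideanSpace ℝ (Fin n)) :
      μ (mfderiv (𝓡 (2 * n)) (𝓡 n) π (chartParam e φ (z, k t))
        (chartParamDeriv e φ (z, k t) (v, w))) =
          μ.comp (mfderiv (𝓡 n) (𝓡 n) φ.symm z) v :=
    congrArg μ (h.mfderiv_proj_chartParamDeriv hz (k t) v w)
  refine ⟨fun horbit t => ?_, fun hpull => ⟨h.contMDiff_chartParam_curve hz hk,
    fun t => proj_chartParam hz _, fun t u => ?_⟩⟩
  · ext v
    exact (hbilin t v 0).symm.trans ((horbit.bilinAt_eq t _).trans (hproj t v 0))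
  · obtain ⟨⟨v, w⟩, rfl⟩ := (h.chartParamDeriv_bijective hz (k t)).2 u
    exact (hbilin t v w).trans ((DFunLike.congr_fun (hpull t) v).trans (hproj t v w).symm)

theorem exists_isCoframePrimitive_chart (h : IsLagrangianChart σ π e φ)
    (hz : z ∈ chartDomain e φ) (x : F) :
    ∃ G : OpenPartialHomeomorph (EuclideanSpace ℝ (Fin n)) (EuclideanSpace ℝ (Fin n) →L[ℝ] ℝ),
      chartAt (EuclideanSpace ℝ (Fin n)) x x ∈ G.source ∧
      ContDiffOn ℝ ∞ G G.source ∧ ContDiffOn ℝ ∞ G.symm G.target ∧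
      ∀ y ∈ G.source, HasFDerivAt G (pullbackForm (fibreForm σ e φ z)
        (chartAt (EuclideanSpace ℝ (Fin n)) x).symm y) y := by
  set c := chartAt (EuclideanSpace ℝ (Fin n)) x
  have hcsymm : ContMDiffOn (𝓡 n) (𝓡 n) ∞ c.symm c.target := contMDiffOn_chart_symm
  obtain ⟨r, hr, hball⟩ := Metric.isOpen_iff.1 c.open_target _ (c.map_source (mem_chart_source _ x))
  have hsmooth := (h.contDiffOn_pullbackForm hz c.open_target hcsymm).mono hball
  obtain ⟨g, hg⟩ := (convex_ball (c x) r).exists_forall_hasFDerivAt_of_fderiv_symmetric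
    Metric.isOpen_ball (hsmooth.differentiableOn (by simp))
    (fun y hy v w => h.fderiv_pullbackForm_symm hz c.open_target hcsymm (hball hy) v w)
  have hbij (y) (hy : y ∈ Metric.ball (c x) r) :
      Function.Bijective (pullbackForm (fibreForm σ e φ z) c.symm y) :=
    (h.fibreForm_bijective hz (c.symm y)).comp
      ((mdifferentiable_chart x).symm.mfderiv_bijective (hball hy))
  obtain ⟨G, hxG, hGsource, hGg, hG, hGsymm⟩ := exists_openPartialHomeomorph_of_bijective
    Metric.isOpen_ball hsmooth hg hbij (Metric.mem_ball_self hr)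
  exact ⟨G, hxG, hG, hGsymm, fun y hy => hGg ▸ hg y (hGsource hy)⟩

theorem isFlatCoframe_fibreForm (h : IsLagrangianChart σ π e φ) (hz : z ∈ chartDomain e φ) :
    IsFlatCoframe (fibreForm σ e φ z) := by
  intro x
  set c := chartAt (EuclideanSpace ℝ (Fin n)) x
  have hcd : c.MDifferentiable (𝓡 n) (𝓡 n) := mdifferentiable_chart x
  obtain ⟨G, hxG, hG, hGsymm, hGderiv⟩ := h.exists_isCoframePrimitive_chart hz x
  refine ⟨c.trans G, ⟨mem_chart_source _ x, hxG⟩, ?_, ?_, ?_⟩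
  · exact (contMDiffOn_iff_contDiffOn.2 hG).comp
      ((contMDiffOn_chart (x := x)).mono fun y hy => hy.1) fun y hy => hy.2
  · exact (contMDiffOn_chart_symm (x := x)).comp
      ((contMDiffOn_iff_contDiffOn.2 hGsymm).mono fun y hy => hy.1) fun y hy => hy.2
  · rintro y ⟨hyc, hyG⟩
    have hcomp : mfderiv (𝓡 n) 𝓘(ℝ, EuclideanSpace ℝ (Fin n) →L[ℝ] ℝ) (c.trans G) y =
        (pullbackForm (fibreForm σ e φ z) c.symm (c y)).comp (mfderiv (𝓡 n) (𝓡 n) c y) :=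
      ((hGderiv _ hyG).hasMFDerivAt.comp y (hcd.mdifferentiableAt hyc).hasMFDerivAt).mfderiv
    rw [hcomp]
    ext v : 1
    change fibreForm σ e φ z (c.symm (c y)) _ = _
    rw [c.left_inv hyc]
    exact congrArg (fibreForm σ e φ z y) (DFunLike.congr_fun (hcd.symm_comp_deriv hyc) v)

variable [T2Space F]

theorem isPeriodCovector_iff (h : IsLagrangianChart σ π e φ)
    (hz : z ∈ chartDomain e φ) {act : (EuclideanSpace ℝ (Fin n) →L[ℝ] ℝ) → F → F}
    (ha : IsCoframeAction (fibreForm σ e φ z) act) (y : F)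
    (μ : EuclideanSpace ℝ (Fin n) →L[ℝ] ℝ) :
    IsPeriodCovector σ π (φ.symm z) μ ↔
      μ.comp (mfderiv (𝓡 n) (𝓡 n) φ.symm z) ∈ ha.stabilizer y := by
  have := h.fibration.connected_fibre
  refine Iff.trans ?_ (ha.mem_stabilizer_iff_exists_loop (h.isFlatCoframe_fibreForm hz)).symm
  constructor
  · rintro ⟨c, hc, hclosed⟩
    obtain ⟨k, hk, rfl⟩ := h.exists_eq_chartParam_curve hz hc.contMDiff hc.proj_eq
    exact ⟨k, hk, (h.isHamiltonianOrbit_iff hz hk).1 hc, chartParam_injective hz hclosed⟩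
  · rintro ⟨k, hk, hpull, hclosed⟩
    exact ⟨fun t => chartParam e φ (z, k t), (h.isHamiltonianOrbit_iff hz hk).2 hpull,
      congrArg (fun x => chartParam e φ (z, x)) hclosed⟩

/-- The forms are the integrals of the fibre forms over loops in the typical fibre that generate
the period lattice of one fibre. -/
theorem exists_closed_forms_span_eq_stabilizer (h : IsLagrangianChart σ π e φ)
    (hz₀ : (chartDomain e φ).Nonempty) :
    ∃ α : Fin n → EuclideanSpace ℝ (Fin n) → EuclideanSpace ℝ (Fin n) →L[ℝ] ℝ,
      (∀ i, ContDiffOn ℝ ∞ (α i) (chartDomain e φ)) ∧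
      (∀ i, ∀ z ∈ chartDomain e φ, ∀ v w, fderiv ℝ (α i) z v w = fderiv ℝ (α i) z w v) ∧
      ∀ z ∈ chartDomain e φ, ∃ act, ∃ ha : IsCoframeAction (fibreForm σ e φ z) act, ∃ y,
        Submodule.span ℤ (range fun i => α i z) = ha.stabilizer y := by
  obtain ⟨z₀, hz₀⟩ := hz₀
  have := h.fibration.compact_fibre
  have := h.fibration.connected_fibre
  obtain ⟨act₀, ha₀⟩ := (h.isFlatCoframe_fibreForm hz₀).exists_isCoframeAction
  obtain ⟨y⟩ : Nonempty F := inferInstance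
  obtain ⟨b⟩ := ha₀.nonempty_basis_stabilizer
    ((finrank_continuousDual _).trans finrank_euclideanSpace_fin) y
  have hloop (i : Fin n) : ContMDiff 𝓘(ℝ, ℝ) (𝓡 n) ∞
      fun t : ℝ => act₀ (t • (b i : EuclideanSpace ℝ (Fin n) →L[ℝ] ℝ)) y :=
    (ha₀.contMDiff y).comp (contMDiff_iff_contDiff.2 (by fun_prop))
  refine ⟨fun i z => ∫ t in (0 : ℝ)..1, pullbackForm (fibreForm σ e φ z)
    (fun t : ℝ => act₀ (t • (b i : EuclideanSpace ℝ (Fin n) →L[ℝ] ℝ)) y) t 1,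
    fun i => h.contDiffOn_intervalIntegral_pullbackForm (hloop i) 0 1, fun i z hz =>
      h.fderiv_loopIntegral_symm hz (hloop i) ?_, fun z hz => ?_⟩
  · simp only [one_smul, zero_smul, ha₀.zero_act]
    exact (b i).2
  · obtain ⟨act, ha⟩ := (h.isFlatCoframe_fibreForm hz).exists_isCoframeAction
    obtain ⟨g, hg⟩ := h.exists_isCoframePrimitive hz (ha₀.contMDiff y)
    obtain ⟨g', hg'⟩ := h.exists_isCoframePrimitive hz₀ (ha.contMDiff y)
    refine ⟨act, ha, y, Eq.trans ?_ (hg.span_range_basis ha₀ ha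
      (h.isFlatCoframe_fibreForm hz₀) (h.isFlatCoframe_fibreForm hz) hg' b)⟩
    simp only [fun i => hg.eq_intervalIntegral (ha₀.mdifferentiable y) (b i)
      (continuousOn_univ.1
        (h.contDiffOn_pullbackForm hz isOpen_univ (hloop i).contMDiffOn).continuousOn)]

theorem exists_period_forms (h : IsLagrangianChart σ π e φ)
    (hz₀ : (chartDomain e φ).Nonempty) :
    ∃ α : Fin n → EuclideanSpace ℝ (Fin n) → EuclideanSpace ℝ (Fin n) →L[ℝ] ℝ,
      (∀ i, ContDiffOn ℝ ∞ (α i) (chartDomain e φ)) ∧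
      (∀ i, ∀ z ∈ chartDomain e φ, ∀ v w, fderiv ℝ (α i) z v w = fderiv ℝ (α i) z w v) ∧
      ∀ z ∈ chartDomain e φ, ⊤ ≤ Submodule.span ℝ (range fun i => α i z) ∧
        ∀ μ, IsPeriodCovector σ π (φ.symm z) μ ↔
          μ.comp (mfderiv (𝓡 n) (𝓡 n) φ.symm z) ∈ Submodule.span ℤ (range fun i => α i z) := by
  obtain ⟨α, hsmooth, hclosed, hα⟩ := h.exists_closed_forms_span_eq_stabilizer hz₀
  have := h.fibration.compact_fibre
  have := h.fibration.connected_fibre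
  refine ⟨α, hsmooth, hclosed, fun z hz => ?_⟩
  obtain ⟨act, ha, y, hspan⟩ := hα z hz
  refine ⟨?_, fun μ => hspan ▸ h.isPeriodCovector_iff hz ha y μ⟩
  rw [← (ha.isZLattice_stabilizer y).span_top, ← hspan, Submodule.span_le]
  exact Submodule.span_le_restrictScalars ℤ ℝ _

end IsLagrangianChart

end PeriodLattice

section MaximalAtlas

variable {n : ℕ} {B : Type*} [TopologicalSpace B] [ChartedSpace (EuclideanSpace ℝ (Fin n)) B]

theorem mem_contDiffGroupoid_of_contDiffOn
    {G : OpenPartialHomeomorph (EuclideanSpace ℝ (Fin n)) (EuclideanSpace ℝ (Fin n))}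
    (hG : ContDiffOn ℝ ∞ G G.source) (hG' : ContDiffOn ℝ ∞ G.symm G.target) :
    G ∈ contDiffGroupoid ∞ (𝓡 n) := by
  rw [contDiffGroupoid, mem_groupoid_of_pregroupoid]
  simpa [contDiffPregroupoid, Function.comp_def] using ⟨hG, hG'⟩

theorem trans_mem_maximalAtlas {φ : OpenPartialHomeomorph B (EuclideanSpace ℝ (Fin n))}
    (hφ : φ ∈ IsManifold.maximalAtlas (𝓡 n) ∞ B)
    {G : OpenPartialHomeomorph (EuclideanSpace ℝ (Fin n)) (EuclideanSpace ℝ (Fin n))}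
    (hG : ContDiffOn ℝ ∞ G G.source) (hG' : ContDiffOn ℝ ∞ G.symm G.target) :
    φ.trans G ∈ IsManifold.maximalAtlas (𝓡 n) ∞ B := by
  have hGmem := mem_contDiffGroupoid_of_contDiffOn hG hG'
  rw [IsManifold.maximalAtlas, mem_maximalAtlas_iff] at hφ ⊢
  intro e' he'
  constructor
  · rw [OpenPartialHomeomorph.trans_symm_eq_symm_trans_symm, OpenPartialHomeomorph.trans_assoc]
    exact (contDiffGroupoid ∞ (𝓡 n)).trans ((contDiffGroupoid ∞ (𝓡 n)).symm hGmem) (hφ e' he').1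
  · rw [← OpenPartialHomeomorph.trans_assoc]
    exact (contDiffGroupoid ∞ (𝓡 n)).trans (hφ e' he').2 hGmem

theorem contDiffOn_transition [IsManifold (𝓡 n) ∞ B]
    {e e' : OpenPartialHomeomorph B (EuclideanSpace ℝ (Fin n))}
    (he : e ∈ IsManifold.maximalAtlas (𝓡 n) ∞ B) (he' : e' ∈ IsManifold.maximalAtlas (𝓡 n) ∞ B) :
    ContDiffOn ℝ ∞ (e.symm.trans e') (e.symm.trans e').source := by
  rw [← contMDiffOn_iff_contDiffOn]
  exact (contMDiffOn_of_mem_maximalAtlas he').comp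
    ((contMDiffOn_symm_of_mem_maximalAtlas he).mono fun x hx => hx.1) fun x hx => hx.2

theorem mdifferentiable_of_mem_maximalAtlas [IsManifold (𝓡 n) ∞ B]
    {e : OpenPartialHomeomorph B (EuclideanSpace ℝ (Fin n))}
    (he : e ∈ IsManifold.maximalAtlas (𝓡 n) ∞ B) : e.MDifferentiable (𝓡 n) (𝓡 n) :=
  ⟨(contMDiffOn_of_mem_maximalAtlas he).mdifferentiableOn (by simp),
    (contMDiffOn_symm_of_mem_maximalAtlas he).mdifferentiableOn (by simp)⟩

theorem mfderiv_symm_mfderiv_chart [IsManifold (𝓡 n) ∞ B]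
    {e : OpenPartialHomeomorph B (EuclideanSpace ℝ (Fin n))}
    (he : e ∈ IsManifold.maximalAtlas (𝓡 n) ∞ B) {b : B} (hb : b ∈ e.source)
    (v : TangentSpace (𝓡 n) b) :
    mfderiv (𝓡 n) (𝓡 n) e.symm (e b) (mfderiv (𝓡 n) (𝓡 n) e b v) = v :=
  DFunLike.congr_fun ((mdifferentiable_of_mem_maximalAtlas he).symm_comp_deriv hb) v

theorem mfderiv_chart_mfderiv_symm [IsManifold (𝓡 n) ∞ B]
    {e : OpenPartialHomeomorph B (EuclideanSpace ℝ (Fin n))}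
    (he : e ∈ IsManifold.maximalAtlas (𝓡 n) ∞ B) {b : B} (hb : b ∈ e.source)
    (v : EuclideanSpace ℝ (Fin n)) :
    mfderiv (𝓡 n) (𝓡 n) e b (mfderiv (𝓡 n) (𝓡 n) e.symm (e b) v) = v := by
  have hcomp := (mdifferentiable_of_mem_maximalAtlas he).comp_symm_deriv (e.map_source hb)
  rw [e.left_inv hb] at hcomp
  exact DFunLike.congr_fun hcomp v

theorem mfderiv_comp_chart_comp_mfderiv_symm [IsManifold (𝓡 n) ∞ B]
    {e : OpenPartialHomeomorph B (EuclideanSpace ℝ (Fin n))}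
    (he : e ∈ IsManifold.maximalAtlas (𝓡 n) ∞ B) {b : B} (hb : b ∈ e.source)
    {g : EuclideanSpace ℝ (Fin n) → EuclideanSpace ℝ (Fin n)}
    {g' : EuclideanSpace ℝ (Fin n) →L[ℝ] EuclideanSpace ℝ (Fin n)} (hg : HasFDerivAt g g' (e b)) :
    (mfderiv (𝓡 n) (𝓡 n) (g ∘ e) b).comp (mfderiv (𝓡 n) (𝓡 n) e.symm (e b)) = g' := by
  have hchain : mfderiv (𝓡 n) (𝓡 n) (g ∘ e) b = g'.comp (mfderiv (𝓡 n) (𝓡 n) e b) :=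
    (hg.hasMFDerivAt.comp b
      ((mdifferentiable_of_mem_maximalAtlas he).mdifferentiableAt hb).hasMFDerivAt).mfderiv
  rw [hchain]
  ext1 v
  exact congrArg g' (mfderiv_chart_mfderiv_symm he hb v)

end MaximalAtlas

section ActionCoordinates

open Set

variable {n : ℕ}

/-- The endomorphism of `ℝⁿ` whose components are the given linear forms. -/
noncomputable def euclideanPi (α : Fin n → EuclideanSpace ℝ (Fin n) →L[ℝ] ℝ) :
    EuclideanSpace ℝ (Fin n) →L[ℝ] EuclideanSpace ℝ (Fin n) :=
  (EuclideanSpace.equiv (Fin n) ℝ).symm.toContinuousLinearMap.comp (ContinuousLinearMap.pi α)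

theorem euclideanPi_apply (α : Fin n → EuclideanSpace ℝ (Fin n) →L[ℝ] ℝ)
    (v : EuclideanSpace ℝ (Fin n)) (i : Fin n) : euclideanPi α v i = α i v := rfl

theorem comp_euclideanPi (l : EuclideanSpace ℝ (Fin n) →L[ℝ] ℝ)
    (α : Fin n → EuclideanSpace ℝ (Fin n) →L[ℝ] ℝ) :
    l.comp (euclideanPi α) = ∑ i, l (EuclideanSpace.single i 1) • α i := by
  ext v
  have hv : euclideanPi α v = ∑ i, α i v • EuclideanSpace.single i (1 : ℝ) := by
    ext j
    simp [euclideanPi_apply, Pi.single_apply]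
  simp only [ContinuousLinearMap.comp_apply, hv, map_sum, map_smul, smul_eq_mul,
    sum_apply, smul_apply]
  exact Finset.sum_congr rfl fun i _ => mul_comm _ _

theorem euclideanPi_bijective {α : Fin n → EuclideanSpace ℝ (Fin n) →L[ℝ] ℝ}
    (hα : ⊤ ≤ Submodule.span ℝ (range α)) : Function.Bijective (euclideanPi α) := by
  have hinj : Function.Injective (euclideanPi α) := by
    rw [injective_iff_map_eq_zero]
    intro v hv
    have hall (l : EuclideanSpace ℝ (Fin n) →L[ℝ] ℝ) : l v = 0 := by
      induction hα (Submodule.mem_top (x := l)) using Submodule.span_induction with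
      | mem _ hl =>
        obtain ⟨i, rfl⟩ := hl
        exact congrArg (fun w : EuclideanSpace ℝ (Fin n) => w i) hv
      | zero => rfl
      | add _ _ _ _ hl hl' => simp only [add_apply, hl, hl', add_zero]
      | smul _ _ _ hl => simp only [smul_apply, hl, smul_zero]
    ext i
    exact hall (EuclideanSpace.proj i)
  exact ⟨hinj, LinearMap.injective_iff_surjective.1 hinj⟩

theorem comp_euclideanPi_mem_span_int {α : Fin n → EuclideanSpace ℝ (Fin n) →L[ℝ] ℝ}
    (hα : ⊤ ≤ Submodule.span ℝ (range α)) (l : EuclideanSpace ℝ (Fin n) →L[ℝ] ℝ) :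
    l.comp (euclideanPi α) ∈ Submodule.span ℤ (range α) ↔
      ∀ i, ∃ k : ℤ, (k : ℝ) = l (EuclideanSpace.single i 1) := by
  have hli : LinearIndependent ℝ α :=
    linearIndependent_of_top_le_span_of_card_eq_finrank hα <| by
      rw [Fintype.card_fin, finrank_continuousDual, finrank_euclideanSpace_fin]
  let basis := Module.Basis.mk hli hα
  have hbasis : ⇑basis = α := Module.Basis.coe_mk hli hα
  rw [← hbasis, comp_euclideanPi, basis.mem_span_iff_repr_mem ℤ, basis.repr_sum_self]
  rfl

/-- Closed forms on a ball have primitives, which are the coordinates of the local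
diffeomorphism. -/
theorem exists_openPartialHomeomorph_of_closed_forms
    {α : Fin n → EuclideanSpace ℝ (Fin n) → EuclideanSpace ℝ (Fin n) →L[ℝ] ℝ}
    {U : Set (EuclideanSpace ℝ (Fin n))} (hU : IsOpen U) (hsmooth : ∀ i, ContDiffOn ℝ ∞ (α i) U)
    (hclosed : ∀ i, ∀ z ∈ U, ∀ v w, fderiv ℝ (α i) z v w = fderiv ℝ (α i) z w v)
    (hspan : ∀ z ∈ U, ⊤ ≤ Submodule.span ℝ (range fun i => α i z))
    {x : EuclideanSpace ℝ (Fin n)} (hx : x ∈ U) :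
    ∃ G : OpenPartialHomeomorph (EuclideanSpace ℝ (Fin n)) (EuclideanSpace ℝ (Fin n)),
      x ∈ G.source ∧ G.source ⊆ U ∧ ContDiffOn ℝ ∞ G G.source ∧ ContDiffOn ℝ ∞ G.symm G.target ∧
        ∀ z ∈ G.source, HasFDerivAt G (euclideanPi fun i => α i z) z := by
  obtain ⟨r, hr, hball⟩ := Metric.isOpen_iff.1 hU x hx
  have hprim (i : Fin n) : ∃ a : EuclideanSpace ℝ (Fin n) → ℝ, ∀ z ∈ Metric.ball x r,
      HasFDerivAt a (α i z) z :=
    (convex_ball x r).exists_forall_hasFDerivAt_of_fderiv_symmetric Metric.isOpen_ball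
      (((hsmooth i).mono hball).differentiableOn (by simp)) fun z hz => hclosed i z (hball hz)
  choose a ha using hprim
  have hderiv (z) (hz : z ∈ Metric.ball x r) :
      HasFDerivAt (fun z => (WithLp.toLp 2 fun i => a i z : EuclideanSpace ℝ (Fin n)))
        (euclideanPi fun i => α i z) z :=
    hasFDerivWithinAt_univ.1 <| hasFDerivWithinAt_euclidean.2 fun i => (ha i z hz).hasFDerivWithinAt
  have hderiv_smooth : ContDiffOn ℝ ∞ (fun z => euclideanPi fun i => α i z) (Metric.ball x r) :=
    contDiffOn_clm_apply.2 fun v => contDiffOn_euclidean.2 fun i =>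
      ((hsmooth i).mono hball).clm_apply contDiffOn_const
  obtain ⟨G, hxG, hGsource, hG_eq, hG, hGsymm⟩ := exists_openPartialHomeomorph_of_bijective
    Metric.isOpen_ball hderiv_smooth hderiv
    (fun z hz => euclideanPi_bijective (hspan z (hball hz))) (Metric.mem_ball_self hr)
  exact ⟨G, hxG, hGsource.trans hball, hG, hGsymm, fun z hz => hG_eq ▸ hderiv z (hGsource hz)⟩

variable {B M F : Type*}
  [TopologicalSpace B] [ChartedSpace (EuclideanSpace ℝ (Fin n)) B]
  [TopologicalSpace M] [ChartedSpace (EuclideanSpace ℝ (Fin (2 * n))) M]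
  [TopologicalSpace F] [ChartedSpace (EuclideanSpace ℝ (Fin n)) F]
  {π : M → B} {σ : TwoForm (2 * n) M}

/-- Action coordinates: a chart of the base in which the period lattice is the standard lattice
`ℤⁿ` of covectors with integral coefficients. -/
structure IsActionChart (σ : TwoForm (2 * n) M) (π : M → B)
    (ψ : OpenPartialHomeomorph B (EuclideanSpace ℝ (Fin n))) : Prop where
  mem_maximalAtlas : ψ ∈ IsManifold.maximalAtlas (𝓡 n) ∞ B
  isPeriodCovector_iff : ∀ b ∈ ψ.source, ∀ l : EuclideanSpace ℝ (Fin n) →L[ℝ] ℝ,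
    IsPeriodCovector σ π b (l.comp (mfderiv (𝓡 n) (𝓡 n) ψ b)) ↔
      ∀ i, ∃ k : ℤ, (k : ℝ) = l (EuclideanSpace.single i 1)

theorem IsLagrangianFibration.exists_isActionChart [IsManifold (𝓡 n) ∞ B]
    [IsManifold (𝓡 (2 * n)) ∞ M] [IsManifold (𝓡 n) ∞ F] [T2Space F]
    (hL : IsLagrangianFibration (F := F) σ π) (b₀ : B) :
    ∃ ψ, IsActionChart σ π ψ ∧ b₀ ∈ ψ.source := by
  obtain ⟨e, hbe, he, hesymm⟩ := hL.locallyTrivial b₀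
  set φ := chartAt (EuclideanSpace ℝ (Fin n)) b₀
  have hφmem : φ ∈ IsManifold.maximalAtlas (𝓡 n) ∞ B := IsManifold.chart_mem_maximalAtlas b₀
  have h : IsLagrangianChart σ π e φ := ⟨hL, hφmem, he, hesymm⟩
  have hb₀ : b₀ ∈ φ.source := mem_chart_source _ b₀
  have hz₀ : φ b₀ ∈ chartDomain e φ :=
    ⟨φ.map_source hb₀, by rwa [mem_preimage, φ.left_inv hb₀]⟩
  obtain ⟨α, hsmooth, hclosed, hα⟩ := h.exists_period_forms ⟨_, hz₀⟩
  obtain ⟨G, hzG, hGsource, hG, hGsymm, hGderiv⟩ := exists_openPartialHomeomorph_of_closed_forms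
    isOpen_chartDomain hsmooth hclosed (fun z hz => (hα z hz).1) hz₀
  refine ⟨φ.trans G, ⟨trans_mem_maximalAtlas hφmem hG hGsymm, ?_⟩, hb₀, hzG⟩
  rintro b ⟨hbφ, hbG⟩ l
  obtain ⟨hspan, hperiod⟩ := hα (φ b) (hGsource hbG)
  rw [← comp_euclideanPi_mem_span_int hspan,
    ← mfderiv_comp_chart_comp_mfderiv_symm hφmem hbφ (hGderiv _ hbG)]
  have hiff := hperiod (l.comp (mfderiv (𝓡 n) (𝓡 n) (φ.trans G) b))
  rw [φ.left_inv hbφ] at hiff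
  exact hiff

end ActionCoordinates

section IntegerLinear

open Set

variable {n : ℕ}

/-- The endomorphism of `ℝⁿ` given by an integer matrix. -/
noncomputable def integerLinear (P : Matrix (Fin n) (Fin n) ℤ) :
    EuclideanSpace ℝ (Fin n) →L[ℝ] EuclideanSpace ℝ (Fin n) :=
  (Matrix.toEuclideanLin (P.map (Int.cast : ℤ → ℝ))).toContinuousLinearMap

theorem integralAffineMap_eq (A : Matrix.GeneralLinearGroup (Fin n) ℤ)
    (c x : EuclideanSpace ℝ (Fin n)) : integralAffineMap A c x = integerLinear A.val x + c := rfl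

theorem integerLinear_apply (P : Matrix (Fin n) (Fin n) ℤ)
    (v : EuclideanSpace ℝ (Fin n)) (i : Fin n) :
    integerLinear P v i = ∑ j, (P i j : ℝ) * v j := rfl

theorem integerLinear_single (P : Matrix (Fin n) (Fin n) ℤ) (i j : Fin n) :
    integerLinear P (EuclideanSpace.single i 1) j = P j i := by
  simp [integerLinear_apply]

theorem euclidean_clm_ext {D D' : EuclideanSpace ℝ (Fin n) →L[ℝ] EuclideanSpace ℝ (Fin n)}
    (h : ∀ i j, D (EuclideanSpace.single i 1) j = D' (EuclideanSpace.single i 1) j) : D = D' := by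
  apply ContinuousLinearMap.coe_injective
  refine (EuclideanSpace.basisFun (Fin n) ℝ).toBasis.ext fun i => ?_
  ext j
  simpa using h i j

theorem integerLinear_one : integerLinear (1 : Matrix (Fin n) (Fin n) ℤ) = .id ℝ _ := by
  refine euclidean_clm_ext fun i j => ?_
  rw [integerLinear_single]
  simp [Matrix.one_apply]

theorem integerLinear_mul (P Q : Matrix (Fin n) (Fin n) ℤ) :
    integerLinear (P * Q) = (integerLinear P).comp (integerLinear Q) := by
  refine euclidean_clm_ext fun i j => ?_
  rw [integerLinear_single, ContinuousLinearMap.comp_apply, integerLinear_apply]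
  simp [integerLinear_single, Matrix.mul_apply]

theorem integerLinear_injective :
    Function.Injective (integerLinear : Matrix (Fin n) (Fin n) ℤ → _) := by
  intro P Q h
  ext j i
  have hentry := congrArg (fun L => L (EuclideanSpace.single i 1) j) h
  simp only [integerLinear_single] at hentry
  exact_mod_cast hentry

theorem exists_integerLinear_eq {D : EuclideanSpace ℝ (Fin n) →L[ℝ] EuclideanSpace ℝ (Fin n)}
    (hD : ∀ j i, ∃ k : ℤ, (k : ℝ) = D (EuclideanSpace.single i 1) j) :
    ∃ P, integerLinear P = D := by
  choose P hP using hD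
  exact ⟨Matrix.of P, euclidean_clm_ext fun i j => (integerLinear_single _ i j).trans (hP j i)⟩

theorem exists_generalLinearGroup_of_preserves_integral
    {D D' : EuclideanSpace ℝ (Fin n) →L[ℝ] EuclideanSpace ℝ (Fin n)}
    (hDD' : D.comp D' = .id ℝ _) (hD'D : D'.comp D = .id ℝ _)
    (hD : ∀ l : EuclideanSpace ℝ (Fin n) →L[ℝ] ℝ,
      (∀ i, ∃ k : ℤ, (k : ℝ) = l (D (EuclideanSpace.single i 1))) ↔
        ∀ i, ∃ k : ℤ, (k : ℝ) = l (EuclideanSpace.single i 1)) :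
    ∃ A : Matrix.GeneralLinearGroup (Fin n) ℤ, D = integerLinear A.val := by
  have hproj (j i : Fin n) : ∃ k : ℤ, (k : ℝ) =
      (EuclideanSpace.proj j : EuclideanSpace ℝ (Fin n) →L[ℝ] ℝ) (EuclideanSpace.single i 1) :=
    ⟨if j = i then 1 else 0, by simp⟩
  obtain ⟨P, rfl⟩ := exists_integerLinear_eq fun j => (hD (EuclideanSpace.proj j)).2 (hproj j)
  obtain ⟨Q, rfl⟩ := exists_integerLinear_eq fun j =>
    (hD ((EuclideanSpace.proj j).comp D')).1 fun i => by
      have hcancel := DFunLike.congr_fun hD'D (EuclideanSpace.single i 1)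
      obtain ⟨k, hk⟩ := hproj j i
      exact ⟨k, hk.trans (congrArg (fun v => v j) hcancel.symm)⟩
  rw [← integerLinear_mul, ← integerLinear_one] at hDD' hD'D
  exact ⟨⟨P, Q, integerLinear_injective hDD', integerLinear_injective hD'D⟩, rfl⟩

/-- The differential is locally constant because its entries are continuous with integer values. -/
theorem exists_integralAffineMap_eq {f : EuclideanSpace ℝ (Fin n) → EuclideanSpace ℝ (Fin n)}
    {S : Set (EuclideanSpace ℝ (Fin n))} (hS : IsOpen S) (hSconn : IsPreconnected S)
    (hf : ContDiffOn ℝ ∞ f S)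
    (h : ∀ x ∈ S, ∃ A : Matrix.GeneralLinearGroup (Fin n) ℤ, fderiv ℝ f x = integerLinear A.val) :
    ∃ A c, ∀ x ∈ S, f x = integralAffineMap A c x := by
  rcases S.eq_empty_or_nonempty with rfl | ⟨x₀, hx₀⟩
  · exact ⟨1, 0, by simp⟩
  obtain ⟨A, hA⟩ := h x₀ hx₀
  have hfderiv : ContinuousOn (fderiv ℝ f) S := hf.continuousOn_fderiv_of_isOpen hS (by simp)
  have hconst (x) (hx : x ∈ S) : fderiv ℝ f x = integerLinear A.val := by
    refine euclidean_clm_ext fun i j => ?_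
    rw [← hA]
    have hentry : ContinuousOn (fun x => fderiv ℝ f x (EuclideanSpace.single i 1) j) S :=
      (EuclideanSpace.proj j : EuclideanSpace ℝ (Fin n) →L[ℝ] ℝ).continuous.comp_continuousOn
        (hfderiv.clm_apply continuousOn_const)
    refine hSconn.constant_of_mapsTo (T := range ((↑) : ℤ → ℝ))
      Int.isClosedEmbedding_coe_real.isEmbedding.isDiscrete_range hentry (fun y hy => ?_) hx hx₀
    obtain ⟨A', hA'⟩ := h y hy
    exact ⟨A'.val j i, by simp only [hA', integerLinear_single]⟩
  refine ⟨A, f x₀ - integerLinear A.val x₀, fun x hx => ?_⟩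
  refine hS.eqOn_of_fderiv_eq (𝕜 := ℝ)
    (g := integralAffineMap A (f x₀ - integerLinear A.val x₀)) hSconn
    (hf.differentiableOn (by simp)) ?_ ?_ hx₀ ?_ hx
  · exact ((integerLinear A.val).differentiable.add_const _).differentiableOn
  · intro y hy
    rw [hconst y hy]
    exact (((integerLinear A.val).hasFDerivAt (x := y)).add_const _).fderiv.symm
  · simp [integralAffineMap_eq]

end IntegerLinear

section Refinement

open Set Topology

/-- Each `V b` lies in the ball of radius `r b` about `b`, where the ball of radius `3 * r b` is
contained in `U b`; of two such balls that meet, the bigger one absorbs the smaller. -/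
theorem exists_preconnected_refinement {B : Type*} [TopologicalSpace B]
    [TopologicalSpace.PseudoMetrizableSpace B] [LocallyConnectedSpace B] {U : B → Set B}
    (hU : ∀ b, U b ∈ 𝓝 b) :
    ∃ V : B → Set B, (∀ b, IsOpen (V b)) ∧ (∀ b, IsPreconnected (V b)) ∧ (∀ b, b ∈ V b) ∧
      (∀ b, V b ⊆ U b) ∧ ∀ a b, (V a ∩ V b).Nonempty → V a ⊆ U b ∨ V b ⊆ U a := by
  let := TopologicalSpace.pseudoMetrizableSpacePseudoMetric B
  have hradius (b : B) : ∃ r > 0, Metric.ball b (3 * r) ⊆ U b := by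
    obtain ⟨ε, hε, hb⟩ := Metric.mem_nhds_iff.1 (hU b)
    exact ⟨ε / 3, by positivity, by rwa [mul_div_cancel₀ _ (by norm_num)]⟩
  choose r hr hrU using hradius
  have hball (b : B) : connectedComponentIn (Metric.ball b (r b)) b ⊆ Metric.ball b (r b) :=
    connectedComponentIn_subset _ _
  have habsorb (a b : B) (hab : r a ≤ r b)
      (hmeet : (Metric.ball a (r a) ∩ Metric.ball b (r b)).Nonempty) :
      Metric.ball a (r a) ⊆ U b := by
    obtain ⟨z, hza, hzb⟩ := hmeet
    intro w hw
    refine hrU b ?_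
    rw [Metric.mem_ball] at hza hzb hw ⊢
    linarith [dist_triangle4 w a z b, dist_comm a z]
  refine ⟨fun b => connectedComponentIn (Metric.ball b (r b)) b,
    fun b => Metric.isOpen_ball.connectedComponentIn, fun b => isPreconnected_connectedComponentIn,
    fun b => mem_connectedComponentIn (Metric.mem_ball_self (hr b)), fun b => ?_,
    fun a b hmeet => ?_⟩
  · exact (hball b).trans ((Metric.ball_subset_ball (by linarith [hr b])).trans (hrU b))
  · have hmeet' := hmeet.mono (inter_subset_inter (hball a) (hball b))
    exact (le_total (r a) (r b)).imp (fun hab => (hball a).trans (habsorb a b hab hmeet'))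
      fun hab => (hball b).trans (habsorb b a hab (inter_comm _ _ ▸ hmeet'))

variable {n : ℕ} {B : Type*} [TopologicalSpace B] [ChartedSpace (EuclideanSpace ℝ (Fin n)) B]
  [IsManifold (𝓡 n) ∞ B]

theorem exists_integralAffineMap_transition_eq
    {e e' : OpenPartialHomeomorph B (EuclideanSpace ℝ (Fin n))}
    (he : e ∈ IsManifold.maximalAtlas (𝓡 n) ∞ B) (he' : e' ∈ IsManifold.maximalAtlas (𝓡 n) ∞ B)
    (h : ∀ b ∈ e.source ∩ e'.source, ∃ A : Matrix.GeneralLinearGroup (Fin n) ℤ,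
      fderiv ℝ (e.symm.trans e') (e b) = integerLinear A.val)
    {W : Set B} (hW : IsOpen W) (hWconn : IsPreconnected W) (hWe : W ⊆ e.source)
    (hWe' : W ⊆ e'.source) : ∃ A c, ∀ b ∈ W, e' b = integralAffineMap A c (e b) := by
  have hsub : e '' W ⊆ (e.symm.trans e').source := by
    rintro _ ⟨b, hb, rfl⟩
    refine ⟨e.map_source (hWe hb), ?_⟩
    change e.symm (e b) ∈ e'.source
    exact (e.left_inv (hWe hb)).symm ▸ hWe' hb
  obtain ⟨A, c, hA⟩ := exists_integralAffineMap_eq (e.isOpen_image_of_subset_source hW hWe)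
    (hWconn.image _ (e.continuousOn.mono hWe)) ((contDiffOn_transition he he').mono hsub)
    (by rintro _ ⟨b, hb, rfl⟩; exact h b ⟨hWe hb, hWe' hb⟩)
  refine ⟨A, c, fun b hb => ?_⟩
  rw [← hA _ (mem_image_of_mem e hb), OpenPartialHomeomorph.coe_trans, Function.comp_apply,
    e.left_inv (hWe hb)]

theorem isIntegralAffineManifold_of_fderiv [TopologicalSpace.PseudoMetrizableSpace B]
    {𝒞 : Set (OpenPartialHomeomorph B (EuclideanSpace ℝ (Fin n)))}
    (h𝒞 : 𝒞 ⊆ IsManifold.maximalAtlas (𝓡 n) ∞ B) (hcover : ∀ b, ∃ e ∈ 𝒞, b ∈ e.source)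
    (h : ∀ e ∈ 𝒞, ∀ e' ∈ 𝒞, ∀ b ∈ e.source ∩ e'.source,
      ∃ A : Matrix.GeneralLinearGroup (Fin n) ℤ,
        fderiv ℝ (e.symm.trans e') (e b) = integerLinear A.val) :
    IsIntegralAffineManifold n B := by
  have := ChartedSpace.locallyConnectedSpace (EuclideanSpace ℝ (Fin n)) B
  choose c hc hcmem using hcover
  obtain ⟨V, hVopen, hVconn, hVmem, hVsource, hVmeet⟩ :=
    exists_preconnected_refinement fun b => (c b).open_source.mem_nhds (hcmem b)
  refine ⟨range fun b => (c b).restr (V b), ?_, fun b => ⟨_, mem_range_self b, ?_⟩, ?_⟩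
  · rintro _ ⟨b, rfl⟩
    exact restr_mem_maximalAtlas _ (h𝒞 (hc b)) (hVopen b)
  · rw [OpenPartialHomeomorph.restr_source' _ _ (hVopen b)]
    exact ⟨hcmem b, hVmem b⟩
  rintro _ ⟨a, rfl⟩ _ ⟨b, rfl⟩
  have hsource (x) (hx : x ∈ (((c a).restr (V a)).symm.trans ((c b).restr (V b))).source) :
      x ∈ (c a).target ∧ (c a).symm x ∈ V a ∩ V b := by
    have hxV : (c a).symm x ∈ ((c a).restr (V a)).source :=
      ((c a).restr (V a)).symm.map_source hx.1
    rw [OpenPartialHomeomorph.restr_source' _ _ (hVopen a)] at hxV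
    exact ⟨hx.1.1, hxV.2, interior_subset hx.2.2⟩
  rcases (V a ∩ V b).eq_empty_or_nonempty with hempty | hmeet
  · exact ⟨1, 0, fun x hx => (hempty.subset (hsource x hx).2).elim⟩
  have hab : ∃ A t, ∀ y ∈ V a ∩ V b, c b y = integralAffineMap A t (c a y) := by
    have htransition {W} := exists_integralAffineMap_transition_eq (W := W) (h𝒞 (hc a)) (h𝒞 (hc b))
      (h _ (hc a) _ (hc b))
    rcases hVmeet a b hmeet with hab | hba
    · obtain ⟨A, t, hA⟩ := htransition (hVopen a) (hVconn a) (hVsource a) hab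
      exact ⟨A, t, fun y hy => hA y hy.1⟩
    · obtain ⟨A, t, hA⟩ := htransition (hVopen b) (hVconn b) hba (hVsource b)
      exact ⟨A, t, fun y hy => hA y hy.2⟩
  obtain ⟨A, t, hA⟩ := hab
  refine ⟨A, t, fun x hx => (hA _ (hsource x hx).2).trans ?_⟩
  rw [(c a).right_inv (hsource x hx).1]

end Refinement

section Forward

open Set

variable {n : ℕ} {B : Type*} [TopologicalSpace B] [ChartedSpace (EuclideanSpace ℝ (Fin n)) B]
  [IsManifold (𝓡 n) ∞ B] {e e' : OpenPartialHomeomorph B (EuclideanSpace ℝ (Fin n))} {b : B}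

theorem fderiv_transition_apply (he : e ∈ IsManifold.maximalAtlas (𝓡 n) ∞ B)
    (he' : e' ∈ IsManifold.maximalAtlas (𝓡 n) ∞ B) (hb : b ∈ e.source ∩ e'.source)
    (v : EuclideanSpace ℝ (Fin n)) :
    fderiv ℝ (e.symm.trans e') (e b) v =
      mfderiv (𝓡 n) (𝓡 n) e' b (mfderiv (𝓡 n) (𝓡 n) e.symm (e b) v) := by
  let K : EuclideanSpace ℝ (Fin n) →L[ℝ] EuclideanSpace ℝ (Fin n) := mfderiv (𝓡 n) (𝓡 n) e' b
  have hK : HasMFDerivAt (𝓡 n) (𝓡 n) e' (e.symm (e b)) K := by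
    rw [e.left_inv hb.1]
    exact ((mdifferentiable_of_mem_maximalAtlas he').mdifferentiableAt hb.2).hasMFDerivAt
  have hsymm := ((mdifferentiable_of_mem_maximalAtlas he).symm.mdifferentiableAt
    (e.map_source hb.1)).hasMFDerivAt
  rw [← mfderiv_eq_fderiv]
  exact DFunLike.congr_fun (hK.comp (e b) hsymm).mfderiv v

theorem fderiv_transition_mfderiv (he : e ∈ IsManifold.maximalAtlas (𝓡 n) ∞ B)
    (he' : e' ∈ IsManifold.maximalAtlas (𝓡 n) ∞ B) (hb : b ∈ e.source ∩ e'.source)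
    (v : TangentSpace (𝓡 n) b) :
    fderiv ℝ (e.symm.trans e') (e b) (mfderiv (𝓡 n) (𝓡 n) e b v) =
      mfderiv (𝓡 n) (𝓡 n) e' b v :=
  (fderiv_transition_apply he he' hb _).trans
    (congrArg (mfderiv (𝓡 n) (𝓡 n) e' b) (mfderiv_symm_mfderiv_chart he hb.1 v))

theorem fderiv_transition_comp_fderiv_transition (he : e ∈ IsManifold.maximalAtlas (𝓡 n) ∞ B)
    (he' : e' ∈ IsManifold.maximalAtlas (𝓡 n) ∞ B) (hb : b ∈ e.source ∩ e'.source) :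
    (fderiv ℝ (e'.symm.trans e) (e' b)).comp (fderiv ℝ (e.symm.trans e') (e b)) = .id ℝ _ := by
  ext1 v
  rw [ContinuousLinearMap.comp_apply, fderiv_transition_apply he he' hb]
  exact (fderiv_transition_mfderiv he' he hb.symm _).trans (mfderiv_chart_mfderiv_symm he hb.1 v)

variable {M F : Type*}
  [TopologicalSpace M] [ChartedSpace (EuclideanSpace ℝ (Fin (2 * n))) M]
  [TopologicalSpace F] [ChartedSpace (EuclideanSpace ℝ (Fin n)) F]
  {π : M → B} {σ : TwoForm (2 * n) M}

/-- The differential of the transition map carries one standard period lattice to the other. -/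
theorem IsActionChart.exists_fderiv_transition_eq (he : IsActionChart σ π e)
    (he' : IsActionChart σ π e') (hb : b ∈ e.source ∩ e'.source) :
    ∃ A : Matrix.GeneralLinearGroup (Fin n) ℤ,
      fderiv ℝ (e.symm.trans e') (e b) = integerLinear A.val := by
  refine exists_generalLinearGroup_of_preserves_integral
    (fderiv_transition_comp_fderiv_transition he'.mem_maximalAtlas he.mem_maximalAtlas hb.symm)
    (fderiv_transition_comp_fderiv_transition he.mem_maximalAtlas he'.mem_maximalAtlas hb)
    fun l => ?_
  have hcovector : ((l.comp (fderiv ℝ (e.symm.trans e') (e b))).comp (mfderiv (𝓡 n) (𝓡 n) e b) :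
      EuclideanSpace ℝ (Fin n) →L[ℝ] ℝ) = l.comp (mfderiv (𝓡 n) (𝓡 n) e' b) := by
    ext1 v
    exact congrArg l
      (fderiv_transition_mfderiv he.mem_maximalAtlas he'.mem_maximalAtlas hb v)
  exact (he.isPeriodCovector_iff b hb.1 _).symm.trans
    ((iff_of_eq (congrArg (IsPeriodCovector σ π b) hcovector)).trans
      (he'.isPeriodCovector_iff b hb.2 l))

theorem IsLagrangianFibration.isIntegralAffineManifold
    [TopologicalSpace.PseudoMetrizableSpace B] [IsManifold (𝓡 (2 * n)) ∞ M]
    [IsManifold (𝓡 n) ∞ F] [T2Space F] (hL : IsLagrangianFibration (F := F) σ π) :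
    IsIntegralAffineManifold n B :=
  isIntegralAffineManifold_of_fderiv (𝒞 := {ψ | IsActionChart σ π ψ})
    (fun _ hψ => hψ.mem_maximalAtlas) hL.exists_isActionChart
    fun _ he _ he' _ hb => he.exists_fderiv_transition_eq he' hb

theorem IsBaseOfLagrangianFibration.isIntegralAffineManifold {n : ℕ} {B : Type u}
    [TopologicalSpace B] [TopologicalSpace.PseudoMetrizableSpace B]
    [ChartedSpace (EuclideanSpace ℝ (Fin n)) B] [IsManifold (𝓡 n) ∞ B]
    (h : IsBaseOfLagrangianFibration n B) : IsIntegralAffineManifold n B := by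
  obtain ⟨M, _, _, F, _, _, ⟨_, _, _⟩, ⟨_, _, _⟩, σ, π, hL⟩ := h
  exact hL.isIntegralAffineManifold

end Forward

section IntegerLinear

variable {n : ℕ}

open scoped RealInnerProductSpace in
theorem inner_integerLinear_transpose (P : Matrix (Fin n) (Fin n) ℤ)
    (v w : EuclideanSpace ℝ (Fin n)) :
    ⟪v, integerLinear P.transpose w⟫ = ⟪integerLinear P v, w⟫ := by
  simp only [PiLp.inner_apply, integerLinear_apply, Matrix.transpose_apply, RCLike.inner_apply,
    conj_trivial, Finset.sum_mul, Finset.mul_sum, map_sum, map_mul]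
  rw [Finset.sum_comm]
  exact Finset.sum_congr rfl fun i _ => Finset.sum_congr rfl fun j _ => by ring

end IntegerLinear

section Torus

open Set Topology Filter

/-- The torus `(ℝ/ℤ)ⁿ`, in an arbitrary universe. -/
abbrev Torus (n : ℕ) : Type u := ULift.{u} (Fin n) → AddCircle (1 : ℝ)

variable {n : ℕ}

/-- The universal covering of the torus. -/
def torusMk (v : EuclideanSpace ℝ (Fin n)) : Torus.{u} n := fun i => (v i.down : AddCircle (1 : ℝ))

/-- The endomorphism of the torus given by an integer matrix. -/
def torusEnd (P : Matrix (Fin n) (Fin n) ℤ) (θ : Torus.{u} n) : Torus.{u} n :=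
  fun i => ∑ j, P i.down j • θ ⟨j⟩

theorem continuous_torusEnd (P : Matrix (Fin n) (Fin n) ℤ) :
    Continuous (torusEnd.{u} P) := by
  unfold torusEnd
  fun_prop

theorem torusEnd_one (θ : Torus.{u} n) : torusEnd 1 θ = θ := by
  ext i
  simp [torusEnd, Matrix.one_apply]

theorem torusEnd_mul (P Q : Matrix (Fin n) (Fin n) ℤ) (θ : Torus.{u} n) :
    torusEnd (P * Q) θ = torusEnd P (torusEnd Q θ) := by
  ext i
  simp only [torusEnd, Matrix.mul_apply, Finset.sum_smul, Finset.smul_sum, mul_smul]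
  rw [Finset.sum_comm]

theorem torusEnd_torusMk (P : Matrix (Fin n) (Fin n) ℤ) (v : EuclideanSpace ℝ (Fin n)) :
    torusEnd P (torusMk.{u} v) = torusMk (integerLinear P v) := by
  ext i
  refine Eq.trans (Finset.sum_congr rfl fun j _ => ?_)
    (map_sum (QuotientAddGroup.mk' (AddSubgroup.zmultiples (1 : ℝ)))
      (fun j => (P i.down j : ℝ) * v j) Finset.univ).symm
  rw [← zsmul_eq_mul]
  rfl

theorem isOpenQuotientMap_torusMk : IsOpenQuotientMap (torusMk.{u} (n := n)) := by
  have hquotient := IsOpenQuotientMap.piMap (fun _ : ULift.{u} (Fin n) =>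
    (AddCircle.isAddQuotientCoveringMap_coe (1 : ℝ)).isOpenQuotientMap)
  have hcoords : IsOpenQuotientMap (fun (v : EuclideanSpace ℝ (Fin n)) (i : ULift.{u} (Fin n)) =>
      v i.down) :=
    ((EuclideanSpace.equiv (Fin n) ℝ).toHomeomorph.trans
      (Homeomorph.piCongrLeft (Y := fun _ => ℝ) Equiv.ulift.{u}).symm).isOpenQuotientMap
  exact hquotient.comp hcoords

theorem torusMk_surjective : Function.Surjective (torusMk.{u} (n := n)) :=
  isOpenQuotientMap_torusMk.surjective

theorem eq_of_torusMk_eq {v w : EuclideanSpace ℝ (Fin n)} (h : torusMk.{u} v = torusMk w)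
    (hvw : dist v w < 1) : v = w := by
  ext i
  have hmk : (v i : AddCircle (1 : ℝ)) = w i := congrFun h ⟨i⟩
  obtain ⟨k, hk⟩ := (AddCircle.coe_eq_zero_iff (1 : ℝ) (x := v i - w i)).1
    (by rw [AddCircle.coe_sub, hmk, sub_self])
  have hk : (k : ℝ) = v i - w i := by simpa using hk
  have habs : |(k : ℝ)| < 1 := by
    rw [hk]
    rw [dist_eq_norm] at hvw
    exact (PiLp.norm_apply_le (v - w) i).trans_lt hvw
  obtain rfl : k = 0 := Int.abs_lt_one_iff.1 (by exact_mod_cast habs)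
  rw [Int.cast_zero] at hk
  exact sub_eq_zero.1 hk.symm

theorem isLocalHomeomorph_torusMk : IsLocalHomeomorph (torusMk.{u} (n := n)) := by
  rw [isLocalHomeomorph_iff_isOpenEmbedding_restrict]
  intro v
  refine ⟨Metric.ball v (1 / 2), Metric.ball_mem_nhds _ (by norm_num), ?_⟩
  refine .of_continuous_injective_isOpenMap
    (isOpenQuotientMap_torusMk.continuous.comp continuous_subtype_val) ?_
    (isOpenQuotientMap_torusMk.isOpenMap.domRestrict Metric.isOpen_ball)
  rintro ⟨a, ha⟩ ⟨b, hb⟩ hab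
  refine Subtype.ext (eq_of_torusMk_eq hab ?_)
  rw [Metric.mem_ball] at ha hb
  linarith [dist_triangle_right a b v]

theorem eventuallyEq_of_torusMk_eq {X : Type*} [TopologicalSpace X] {S : Set X} (hS : IsOpen S)
    {f g : X → EuclideanSpace ℝ (Fin n)} (hf : ContinuousOn f S) (hg : ContinuousOn g S)
    (h : ∀ x ∈ S, torusMk.{u} (f x) = torusMk (g x)) {x₀ : X} (hx₀ : x₀ ∈ S) :
    f =ᶠ[𝓝 x₀] fun x => g x + (f x₀ - g x₀) := by
  have hcont : ContinuousAt (fun x => dist (f x) (g x + (f x₀ - g x₀))) x₀ :=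
    (hf.continuousAt (hS.mem_nhds hx₀)).dist
      ((hg.continuousAt (hS.mem_nhds hx₀)).add continuousAt_const)
  have hdist : ∀ᶠ x in 𝓝 x₀, dist (f x) (g x + (f x₀ - g x₀)) < 1 :=
    hcont.eventually_lt continuousAt_const (by simp)
  filter_upwards [hdist, hS.mem_nhds hx₀] with x hx hxS
  refine eq_of_torusMk_eq.{u} ?_ hx
  ext i
  have hmk : (f x i.down : AddCircle (1 : ℝ)) = g x i.down := congrFun (h x hxS) i
  have hmk₀ : (f x₀ i.down : AddCircle (1 : ℝ)) = g x₀ i.down := congrFun (h x₀ hx₀) i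
  simp [torusMk, hmk, hmk₀]

/-- The charts of the torus are the local inverses of the universal covering. -/
noncomputable instance : ChartedSpace (EuclideanSpace ℝ (Fin n)) (Torus.{u} n) :=
  isLocalHomeomorph_torusMk.chartedSpace torusMk_surjective

theorem torusMk_chartAt {θ θ' : Torus.{u} n}
    (h : θ' ∈ (chartAt (EuclideanSpace ℝ (Fin n)) θ).source) :
    torusMk (chartAt (EuclideanSpace ℝ (Fin n)) θ θ') = θ' :=
  isLocalHomeomorph_torusMk.apply_localInverseAt_of_mem h.1

theorem chartAt_torus_symm (θ : Torus.{u} n) :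
    ⇑(chartAt (EuclideanSpace ℝ (Fin n)) θ).symm = torusMk :=
  isLocalHomeomorph_torusMk.localInverseAt_symm _

theorem contDiffOn_torus_transition (θ θ' : Torus.{u} n) :
    ContDiffOn ℝ ∞
      ((chartAt (EuclideanSpace ℝ (Fin n)) θ).symm.trans (chartAt (EuclideanSpace ℝ (Fin n)) θ'))
      ((chartAt (EuclideanSpace ℝ (Fin n)) θ).symm.trans
        (chartAt (EuclideanSpace ℝ (Fin n)) θ')).source := by
  intro x hx
  set G := (chartAt (EuclideanSpace ℝ (Fin n)) θ).symm.trans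
    (chartAt (EuclideanSpace ℝ (Fin n)) θ')
  have htranslation := eventuallyEq_of_torusMk_eq.{u} G.open_source G.continuousOn continuousOn_id
    (fun y hy => (torusMk_chartAt hy.2).trans (congrFun (chartAt_torus_symm θ) y)) hx
  exact ((contDiffAt_id.add contDiffAt_const).congr_of_eventuallyEq
    htranslation).contDiffWithinAt

instance : IsManifold (𝓡 n) ∞ (Torus.{u} n) := by
  have : HasGroupoid (Torus.{u} n) (contDiffGroupoid ∞ (𝓡 n)) := by
    refine ⟨?_⟩
    rintro _ _ ⟨θ, rfl⟩ ⟨θ', rfl⟩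
    exact mem_contDiffGroupoid_of_contDiffOn (contDiffOn_torus_transition θ θ')
      (contDiffOn_torus_transition θ' θ)
  exact IsManifold.mk' _ _ _

theorem contMDiff_torusMk : ContMDiff (𝓡 n) (𝓡 n) ∞ (torusMk.{u} (n := n)) := by
  intro v
  set c := chartAt (EuclideanSpace ℝ (Fin n)) (torusMk.{u} v)
  have hcont : Continuous (torusMk.{u} (n := n)) := isOpenQuotientMap_torusMk.continuous
  have htranslation := eventuallyEq_of_torusMk_eq.{u} (c.open_source.preimage hcont)
    (c.continuousOn.comp hcont.continuousOn fun x hx => hx) continuousOn_id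
    (fun y hy => torusMk_chartAt hy)
    (mem_chart_source (EuclideanSpace ℝ (Fin n)) (torusMk.{u} v) : v ∈ torusMk ⁻¹' c.source)
  refine contMDiffAt_iff_target.2 ⟨hcont.continuousAt, ?_⟩
  rw [contMDiffAt_iff_contDiffAt]
  exact (contDiffAt_id.add contDiffAt_const).congr_of_eventuallyEq htranslation

end Torus

section BundleTopology

open Set Topology

variable {B M F : Type*} [TopologicalSpace B] [TopologicalSpace M] [TopologicalSpace F] {π : M → B}

theorem t2Space_of_trivialization [T2Space B] [T2Space F] (hπ : Continuous π)
    (h : ∀ b, ∃ e : Bundle.Trivialization F π, b ∈ e.baseSet) : T2Space M := by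
  refine ⟨fun x y hxy => ?_⟩
  by_cases hb : π x = π y
  · obtain ⟨e, he⟩ := h (π x)
    have hx : x ∈ e.source := e.mem_source.2 he
    have hy : y ∈ e.source := e.mem_source.2 (hb ▸ he)
    obtain ⟨U, V, hU, hV, hxU, hyV, hUV⟩ := t2_separation (e.injOn.ne hx hy hxy)
    refine ⟨e.source ∩ e ⁻¹' U, e.source ∩ e ⁻¹' V,
      e.toOpenPartialHomeomorph.isOpen_inter_preimage hU,
      e.toOpenPartialHomeomorph.isOpen_inter_preimage hV, ⟨hx, hxU⟩, ⟨hy, hyV⟩, ?_⟩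
    exact (hUV.preimage e).mono inter_subset_right inter_subset_right
  · obtain ⟨U, V, hU, hV, hxU, hyV, hUV⟩ := t2_separation hb
    exact ⟨_, _, hU.preimage hπ, hV.preimage hπ, hxU, hyV, hUV.preimage π⟩

theorem secondCountableTopology_of_trivialization [SecondCountableTopology B]
    [SecondCountableTopology F] (h : ∀ b, ∃ e : Bundle.Trivialization F π, b ∈ e.baseSet) :
    SecondCountableTopology M := by
  choose e he using h
  obtain ⟨s, hs, hcover⟩ := TopologicalSpace.countable_cover_nhds
    fun b => (e b).open_baseSet.mem_nhds (he b)
  have := hs.to_subtype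
  have (b : s) : SecondCountableTopology (e b).source :=
    (e b).toOpenPartialHomeomorph.toHomeomorphSourceTarget.secondCountableTopology
  refine TopologicalSpace.secondCountableTopology_of_countable_cover
    (U := fun b : s => (e b).source) (fun b => (e b).open_source) ?_
  refine eq_univ_of_forall fun x => ?_
  have hx : π x ∈ ⋃ b ∈ s, (e b).baseSet := hcover ▸ mem_univ _
  obtain ⟨b, hb, hxb⟩ := mem_iUnion₂.1 hx
  exact mem_iUnion.2 ⟨⟨b, hb⟩, (e b).mem_source.2 hxb⟩

end BundleTopology

section StandardForm

open scoped RealInnerProductSpace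

/-- The standard symplectic form `⟨v₁, w₂⟩ - ⟨w₁, v₂⟩` on `E × E`, where the second factor is
identified with the dual of the first. -/
noncomputable def standardSymplecticForm (E : Type*) [NormedAddCommGroup E]
    [InnerProductSpace ℝ E] : (E × E) [⋀^Fin 2]→L[ℝ] ℝ where
  toFun v := ⟪(v 0).1, (v 1).2⟫ - ⟪(v 1).1, (v 0).2⟫
  map_update_add' := by
    intro _ m i x y
    fin_cases i <;> simp [inner_add_left, inner_add_right] <;> ring
  map_update_smul' := by
    intro _ m i c x
    fin_cases i <;> simp [inner_smul_left, inner_smul_right] <;> ring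
  cont := by fun_prop
  map_eq_zero_of_eq' := by
    intro v i j h hij
    fin_cases i <;> fin_cases j <;> simp_all

variable {E : Type*} [NormedAddCommGroup E] [InnerProductSpace ℝ E]

theorem standardSymplecticForm_apply (v w : E × E) :
    standardSymplecticForm E ![v, w] = ⟪v.1, w.2⟫ - ⟪w.1, v.2⟫ := rfl

theorem standardSymplecticForm_nondegenerate {v : E × E}
    (h : ∀ w, standardSymplecticForm E ![v, w] = 0) : v = 0 := by
  have hfst := h (0, v.1)
  have hsnd := h (v.2, 0)
  simp only [standardSymplecticForm_apply, inner_zero_left, inner_zero_right, sub_zero, zero_sub,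
    neg_eq_zero, inner_self_eq_zero] at hfst hsnd
  exact Prod.ext hfst hsnd

/-- An arbitrary linear identification of `ℝⁿ × ℝⁿ` with `ℝ²ⁿ`. -/
noncomputable def prodEuclidean (n : ℕ) :
    (EuclideanSpace ℝ (Fin n) × EuclideanSpace ℝ (Fin n)) ≃L[ℝ] EuclideanSpace ℝ (Fin (2 * n)) :=
  ContinuousLinearEquiv.ofFinrankEq (by simp [two_mul])

/-- The standard symplectic form on `ℝ²ⁿ`, transported along `prodEuclidean`. -/
noncomputable def euclideanSymplecticForm (n : ℕ) :
    EuclideanSpace ℝ (Fin (2 * n)) [⋀^Fin 2]→L[ℝ] ℝ :=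
  (standardSymplecticForm (EuclideanSpace ℝ (Fin n))).compContinuousLinearMap
    ((prodEuclidean n).symm : EuclideanSpace ℝ (Fin (2 * n)) →L[ℝ]
      EuclideanSpace ℝ (Fin n) × EuclideanSpace ℝ (Fin n))

variable {n : ℕ}

theorem euclideanSymplecticForm_apply (v w : EuclideanSpace ℝ (Fin (2 * n))) :
    euclideanSymplecticForm n ![v, w] = standardSymplecticForm (EuclideanSpace ℝ (Fin n))
      ![(prodEuclidean n).symm v, (prodEuclidean n).symm w] := by
  rw [euclideanSymplecticForm, ContinuousAlternatingMap.compContinuousLinearMap_apply]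
  congr 1
  ext i : 1
  fin_cases i <;> rfl

theorem euclideanSymplecticForm_nondegenerate {v : EuclideanSpace ℝ (Fin (2 * n))}
    (hv : ∀ w, euclideanSymplecticForm n ![v, w] = 0) : v = 0 := by
  refine (prodEuclidean n).symm.map_eq_zero_iff.1 (standardSymplecticForm_nondegenerate fun w => ?_)
  have hw := hv (prodEuclidean n w)
  rwa [euclideanSymplecticForm_apply, ContinuousLinearEquiv.symm_apply_apply] at hw

end StandardForm

section IntegralAffineAtlas

open Set Topology Filter

/-- An integral affine atlas, with a choice of a chart around each point and of the linear and the
translation parts of the transition functions. -/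
structure IntegralAffineAtlas (n : ℕ) (B : Type u) [TopologicalSpace B]
    [ChartedSpace (EuclideanSpace ℝ (Fin n)) B] where
  charts : Set (OpenPartialHomeomorph B (EuclideanSpace ℝ (Fin n)))
  subset_maximalAtlas : charts ⊆ IsManifold.maximalAtlas (𝓡 n) ∞ B
  indexAt : B → charts
  mem_source_indexAt : ∀ b, b ∈ (indexAt b).1.source
  linearPart : charts → charts → Matrix.GeneralLinearGroup (Fin n) ℤ
  translationPart : charts → charts → EuclideanSpace ℝ (Fin n)
  transition_eq : ∀ i j : charts, ∀ x ∈ (i.1.symm.trans j.1).source,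
    i.1.symm.trans j.1 x = integralAffineMap (linearPart i j) (translationPart i j) x

theorem IsIntegralAffineManifold.nonempty_integralAffineAtlas {n : ℕ} {B : Type u}
    [TopologicalSpace B] [ChartedSpace (EuclideanSpace ℝ (Fin n)) B]
    (h : IsIntegralAffineManifold n B) : Nonempty (IntegralAffineAtlas n B) := by
  obtain ⟨𝒜, h𝒜, hcov, haff⟩ := h
  choose i hi hib using hcov
  choose A c hA using haff
  exact ⟨⟨𝒜, h𝒜, fun b => ⟨i b, hi b⟩, hib, fun i j => A i i.2 j j.2, fun i j => c i i.2 j j.2,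
    fun i j => hA i i.2 j j.2⟩⟩

namespace IntegralAffineAtlas

variable {n : ℕ} {B : Type u} [TopologicalSpace B] [ChartedSpace (EuclideanSpace ℝ (Fin n)) B]
  (𝔞 : IntegralAffineAtlas n B)

theorem mem_transition_source {i j : 𝔞.charts} {b : B} (hi : b ∈ i.1.source)
    (hj : b ∈ j.1.source) : i.1 b ∈ (i.1.symm.trans j.1).source := by
  simp [hi, hj]

theorem apply_eq {i j : 𝔞.charts} {b : B} (hi : b ∈ i.1.source) (hj : b ∈ j.1.source) :
    j.1 b = integerLinear (𝔞.linearPart i j).val (i.1 b) + 𝔞.translationPart i j := by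
  rw [← integralAffineMap_eq, ← 𝔞.transition_eq i j _ (𝔞.mem_transition_source hi hj),
    OpenPartialHomeomorph.trans_apply, i.1.left_inv hi]

theorem hasFDerivAt_transition {i j : 𝔞.charts} {b : B} (hi : b ∈ i.1.source)
    (hj : b ∈ j.1.source) :
    HasFDerivAt (j.1 ∘ i.1.symm) (integerLinear (𝔞.linearPart i j).val) (i.1 b) := by
  refine ((integerLinear (𝔞.linearPart i j).val).hasFDerivAt.add_const
    (𝔞.translationPart i j)).congr_of_eventuallyEq ?_
  filter_upwards [(i.1.symm.trans j.1).open_source.mem_nhds (𝔞.mem_transition_source hi hj)]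
    with x hx
  exact 𝔞.transition_eq i j x hx

theorem linearPart_mul {i j k : 𝔞.charts} {b : B} (hi : b ∈ i.1.source) (hj : b ∈ j.1.source)
    (hk : b ∈ k.1.source) :
    (𝔞.linearPart j k).val * (𝔞.linearPart i j).val = (𝔞.linearPart i k).val := by
  apply integerLinear_injective
  rw [integerLinear_mul]
  have hjk : HasFDerivAt (k.1 ∘ j.1.symm) (integerLinear (𝔞.linearPart j k).val)
      ((j.1 ∘ i.1.symm) (i.1 b)) := by
    rw [Function.comp_apply, i.1.left_inv hi]
    exact 𝔞.hasFDerivAt_transition hj hk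
  have hcocycle : k.1 ∘ i.1.symm =ᶠ[𝓝 (i.1 b)] (k.1 ∘ j.1.symm) ∘ (j.1 ∘ i.1.symm) := by
    filter_upwards [(i.1.symm.trans j.1).open_source.mem_nhds (𝔞.mem_transition_source hi hj)]
      with x hx
    exact congrArg k.1 (j.1.left_inv hx.2).symm
  exact ((hjk.comp _ (𝔞.hasFDerivAt_transition hi hj)).congr_of_eventuallyEq hcocycle).unique
    (𝔞.hasFDerivAt_transition hi hk)

theorem linearPart_self {i : 𝔞.charts} {b : B} (hi : b ∈ i.1.source) :
    (𝔞.linearPart i i).val = 1 := by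
  have hidem : 𝔞.linearPart i i * 𝔞.linearPart i i = 𝔞.linearPart i i :=
    Units.ext (𝔞.linearPart_mul hi hi hi)
  exact congrArg Units.val (mul_eq_left.1 hidem)

/-- The bundle of tori `T*B / Λ`, where `Λ` is the lattice spanned by the differentials of the
affine coordinates. -/
noncomputable def bundleCore : FiberBundleCore 𝔞.charts B (Torus.{u} n) where
  baseSet i := i.1.source
  isOpen_baseSet i := i.1.open_source
  indexAt := 𝔞.indexAt
  mem_baseSet_at := 𝔞.mem_source_indexAt
  coordChange i j _ θ := torusEnd (𝔞.linearPart j i).val.transpose θ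
  coordChange_self i b hb θ := by
    rw [𝔞.linearPart_self hb, Matrix.transpose_one, torusEnd_one]
  continuousOn_coordChange i j :=
    ((continuous_torusEnd _).comp continuous_snd).continuousOn
  coordChange_comp i j k b hb θ := by
    rw [← torusEnd_mul, ← Matrix.transpose_mul, 𝔞.linearPart_mul hb.2 hb.1.2 hb.1.1]

/-- The total space of the torus bundle. -/
abbrev Total : Type u := 𝔞.bundleCore.TotalSpace

/-- The affine coordinates on the base and the linear coordinates on the universal cover of the
fibre parametrize the total space. -/
noncomputable def param (i : 𝔞.charts) (w : EuclideanSpace ℝ (Fin n) × EuclideanSpace ℝ (Fin n)) :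
    𝔞.Total :=
  (𝔞.bundleCore.localTriv i).toOpenPartialHomeomorph.symm (i.1.symm w.1, torusMk w.2)

theorem localTriv_param {i j : 𝔞.charts}
    {w : EuclideanSpace ℝ (Fin n) × EuclideanSpace ℝ (Fin n)} (hi : w.1 ∈ i.1.target)
    (hj : i.1.symm w.1 ∈ j.1.source) :
    𝔞.bundleCore.localTriv j (𝔞.param i w) =
      (i.1.symm w.1, torusMk (integerLinear (𝔞.linearPart j i).val.transpose w.2)) := by
  rw [← torusEnd_torusMk]
  refine Prod.ext rfl ?_
  exact 𝔞.bundleCore.coordChange_comp i (𝔞.indexAt (i.1.symm w.1)) j (i.1.symm w.1)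
    ⟨⟨i.1.map_target hi, 𝔞.mem_source_indexAt _⟩, hj⟩ (torusMk w.2)

theorem continuousOn_param (i : 𝔞.charts) :
    ContinuousOn (𝔞.param i) (Prod.fst ⁻¹' i.1.target) := by
  refine (𝔞.bundleCore.localTriv i).toOpenPartialHomeomorph.continuousOn_symm.comp
    (ContinuousOn.prodMk (i.1.continuousOn_symm.comp continuousOn_fst fun w hw => hw)
      (isOpenQuotientMap_torusMk.continuous.comp continuous_snd).continuousOn) fun w hw => ?_
  exact (𝔞.bundleCore.mem_localTriv_target i _).2 (i.1.map_target hw)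

/-- The chart of the total space given by affine coordinates on the base and linear coordinates
on the fibre. -/
noncomputable def totalChart (p : 𝔞.Total) :
    OpenPartialHomeomorph 𝔞.Total (EuclideanSpace ℝ (Fin (2 * n))) :=
  ((𝔞.bundleCore.localTriv (𝔞.indexAt p.1)).toOpenPartialHomeomorph.trans
    ((𝔞.indexAt p.1).1.prod (chartAt (EuclideanSpace ℝ (Fin n)) (M := Torus.{u} n) p.2))).trans
    (prodEuclidean n).toHomeomorph.toOpenPartialHomeomorph

theorem mem_totalChart_source {p q : 𝔞.Total} : q ∈ (𝔞.totalChart p).source ↔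
    q.1 ∈ (𝔞.indexAt p.1).1.source ∧ (𝔞.bundleCore.localTriv (𝔞.indexAt p.1) q).2 ∈
      (chartAt (EuclideanSpace ℝ (Fin n)) (M := Torus.{u} n) p.2).source := by
  simp only [totalChart, OpenPartialHomeomorph.trans_source, OpenPartialHomeomorph.prod_source,
    Homeomorph.toOpenPartialHomeomorph_source, preimage_univ, inter_univ, mem_inter_iff,
    mem_preimage, mem_prod]
  exact ⟨fun ⟨_, hbase, hfibre⟩ => ⟨hbase, hfibre⟩,
    fun ⟨hbase, hfibre⟩ => ⟨(𝔞.bundleCore.mem_localTriv_source _ _).2 hbase, hbase, hfibre⟩⟩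

theorem mem_totalChart_source_self (p : 𝔞.Total) : p ∈ (𝔞.totalChart p).source := by
  rw [mem_totalChart_source]
  refine ⟨𝔞.mem_source_indexAt _, ?_⟩
  have hlocalTriv : 𝔞.bundleCore.localTriv (𝔞.indexAt p.1) p = ⟨p.1, p.2⟩ :=
    𝔞.bundleCore.localTrivAt_apply p
  rw [hlocalTriv]
  exact mem_chart_source _ _

theorem totalChart_symm_apply (p : 𝔞.Total) (z : EuclideanSpace ℝ (Fin (2 * n))) :
    (𝔞.totalChart p).symm z = 𝔞.param (𝔞.indexAt p.1) ((prodEuclidean n).symm z) := by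
  rw [param, ← chartAt_torus_symm (n := n) p.2]
  rfl

theorem totalChart_symm_fst_mem {p : 𝔞.Total} {z : EuclideanSpace ℝ (Fin (2 * n))}
    (hz : z ∈ (𝔞.totalChart p).target) :
    ((prodEuclidean n).symm z).1 ∈ (𝔞.indexAt p.1).1.target := by
  simp only [totalChart, OpenPartialHomeomorph.trans_target, OpenPartialHomeomorph.prod_target,
    mem_inter_iff, mem_preimage, mem_prod] at hz
  exact hz.2.1.1

theorem totalChart_fst (p q : 𝔞.Total) :
    ((prodEuclidean n).symm (𝔞.totalChart p q)).1 = (𝔞.indexAt p.1).1 q.1 := by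
  simp [totalChart]

theorem torusMk_totalChart_snd {p q : 𝔞.Total} (h : q ∈ (𝔞.totalChart p).source) :
    torusMk ((prodEuclidean n).symm (𝔞.totalChart p q)).2 =
      (𝔞.bundleCore.localTriv (𝔞.indexAt p.1) q).2 := by
  simpa [totalChart] using torusMk_chartAt (𝔞.mem_totalChart_source.1 h).2

/-- The linear part of the change of coordinates on the total space: the base coordinates
transform by `A ∈ GL(n, ℤ)`, the fibre coordinates by the transpose of `A⁻¹`. -/
noncomputable def blockLinear (i j : 𝔞.charts) :
    (EuclideanSpace ℝ (Fin n) × EuclideanSpace ℝ (Fin n)) →L[ℝ]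
      (EuclideanSpace ℝ (Fin n) × EuclideanSpace ℝ (Fin n)) :=
  (integerLinear (𝔞.linearPart i j).val).prodMap
    (integerLinear (𝔞.linearPart j i).val.transpose)

theorem standardSymplecticForm_blockLinear {i j : 𝔞.charts} {b : B} (hi : b ∈ i.1.source)
    (hj : b ∈ j.1.source) :
    (standardSymplecticForm (EuclideanSpace ℝ (Fin n))).compContinuousLinearMap
      (𝔞.blockLinear i j) = standardSymplecticForm (EuclideanSpace ℝ (Fin n)) := by
  have hinverse (v) :
      integerLinear (𝔞.linearPart j i).val (integerLinear (𝔞.linearPart i j).val v) = v := by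
    rw [← ContinuousLinearMap.comp_apply, ← integerLinear_mul, 𝔞.linearPart_mul hi hj hi,
      𝔞.linearPart_self hi, integerLinear_one]
    rfl
  ext v
  change inner ℝ (integerLinear (𝔞.linearPart i j).val (v 0).1)
      (integerLinear (𝔞.linearPart j i).val.transpose (v 1).2) -
    inner ℝ (integerLinear (𝔞.linearPart i j).val (v 1).1)
      (integerLinear (𝔞.linearPart j i).val.transpose (v 0).2) = _
  rw [inner_integerLinear_transpose, inner_integerLinear_transpose, hinverse, hinverse]
  rfl

theorem totalChart_param_fst {p : 𝔞.Total} {i : 𝔞.charts}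
    {w : EuclideanSpace ℝ (Fin n) × EuclideanSpace ℝ (Fin n)} (hw : w.1 ∈ i.1.target)
    (hp : 𝔞.param i w ∈ (𝔞.totalChart p).source) :
    ((prodEuclidean n).symm (𝔞.totalChart p (𝔞.param i w))).1 =
      integerLinear (𝔞.linearPart i (𝔞.indexAt p.1)).val w.1 +
        𝔞.translationPart i (𝔞.indexAt p.1) := by
  have happly := 𝔞.apply_eq (i.1.map_target hw) (𝔞.mem_totalChart_source.1 hp).1
  rw [i.1.right_inv hw] at happly
  exact (𝔞.totalChart_fst p _).trans happly

theorem torusMk_totalChart_param_snd {p : 𝔞.Total} {i : 𝔞.charts}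
    {w : EuclideanSpace ℝ (Fin n) × EuclideanSpace ℝ (Fin n)} (hw : w.1 ∈ i.1.target)
    (hp : 𝔞.param i w ∈ (𝔞.totalChart p).source) :
    torusMk.{u} ((prodEuclidean n).symm (𝔞.totalChart p (𝔞.param i w))).2 =
      torusMk (integerLinear (𝔞.linearPart (𝔞.indexAt p.1) i).val.transpose w.2) := by
  rw [𝔞.torusMk_totalChart_snd hp, 𝔞.localTriv_param hw (𝔞.mem_totalChart_source.1 hp).1]

theorem totalChart_param_eventuallyEq {p : 𝔞.Total} {i : 𝔞.charts}
    {w₀ : EuclideanSpace ℝ (Fin n) × EuclideanSpace ℝ (Fin n)} (hw₀ : w₀.1 ∈ i.1.target)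
    (hp : 𝔞.param i w₀ ∈ (𝔞.totalChart p).source) :
    ∃ c, (fun w => 𝔞.totalChart p (𝔞.param i w)) =ᶠ[𝓝 w₀]
      fun w => prodEuclidean n (𝔞.blockLinear i (𝔞.indexAt p.1) w) + c := by
  set L := integerLinear (𝔞.linearPart (𝔞.indexAt p.1) i).val.transpose
  set S := (Prod.fst ⁻¹' i.1.target) ∩ 𝔞.param i ⁻¹' (𝔞.totalChart p).source
  have hS : IsOpen S := (𝔞.continuousOn_param i).isOpen_inter_preimage
    (i.1.open_target.preimage continuous_fst) (𝔞.totalChart p).open_source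
  let f := fun w => (prodEuclidean n).symm (𝔞.totalChart p (𝔞.param i w))
  have hf : ContinuousOn f S := (prodEuclidean n).symm.continuous.comp_continuousOn
    ((𝔞.totalChart p).continuousOn.comp ((𝔞.continuousOn_param i).mono inter_subset_left)
      fun w hw => hw.2)
  have hsnd := eventuallyEq_of_torusMk_eq.{u} hS (continuous_snd.comp_continuousOn hf)
    (L.continuous.comp continuous_snd).continuousOn
    (fun w hw => 𝔞.torusMk_totalChart_param_snd hw.1 hw.2) ⟨hw₀, hp⟩
  refine ⟨prodEuclidean n (𝔞.translationPart i (𝔞.indexAt p.1), (f w₀).2 - L w₀.2), ?_⟩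
  filter_upwards [hsnd, hS.mem_nhds ⟨hw₀, hp⟩] with w hw hwS
  rw [← map_add, ← ContinuousLinearEquiv.symm_apply_eq]
  exact Prod.ext (𝔞.totalChart_param_fst hwS.1 hwS.2) hw

end IntegralAffineAtlas

end IntegralAffineAtlas

section TorusBundle

open Set Topology Filter

namespace IntegralAffineAtlas

variable {n : ℕ} {B : Type u} [TopologicalSpace B] [ChartedSpace (EuclideanSpace ℝ (Fin n)) B]
  (𝔞 : IntegralAffineAtlas n B)

/-- The charts of the torus bundle are the maps `totalChart`. -/
noncomputable instance : ChartedSpace (EuclideanSpace ℝ (Fin (2 * n))) 𝔞.Total where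
  atlas := range 𝔞.totalChart
  chartAt := 𝔞.totalChart
  mem_chart_source := 𝔞.mem_totalChart_source_self
  chart_mem_atlas := mem_range_self

theorem totalChart_transition_eventuallyEq {p q : 𝔞.Total} {z : EuclideanSpace ℝ (Fin (2 * n))}
    (hz : z ∈ (𝔞.totalChart p).target)
    (hq : (𝔞.totalChart p).symm z ∈ (𝔞.totalChart q).source) :
    ∃ c, (fun z => 𝔞.totalChart q ((𝔞.totalChart p).symm z)) =ᶠ[𝓝 z] fun z =>
      prodEuclidean n (𝔞.blockLinear (𝔞.indexAt p.1) (𝔞.indexAt q.1) ((prodEuclidean n).symm z)) +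
        c := by
  rw [totalChart_symm_apply] at hq
  obtain ⟨c, hc⟩ := 𝔞.totalChart_param_eventuallyEq (𝔞.totalChart_symm_fst_mem hz) hq
  refine ⟨c, ?_⟩
  filter_upwards [(prodEuclidean n).symm.continuous.continuousAt.eventually hc] with y hy
  rw [totalChart_symm_apply]
  exact hy

theorem contDiffOn_totalChart_transition (p q : 𝔞.Total) :
    ContDiffOn ℝ ∞ ((𝔞.totalChart p).symm.trans (𝔞.totalChart q))
      ((𝔞.totalChart p).symm.trans (𝔞.totalChart q)).source := by
  intro z hz
  obtain ⟨c, hc⟩ := 𝔞.totalChart_transition_eventuallyEq hz.1 hz.2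
  refine ContDiffAt.contDiffWithinAt (ContDiffAt.congr_of_eventuallyEq ?_ hc)
  fun_prop

instance : IsManifold (𝓡 (2 * n)) ∞ 𝔞.Total := by
  have : HasGroupoid 𝔞.Total (contDiffGroupoid ∞ (𝓡 (2 * n))) := by
    refine ⟨?_⟩
    rintro _ _ ⟨p, rfl⟩ ⟨q, rfl⟩
    exact mem_contDiffGroupoid_of_contDiffOn (𝔞.contDiffOn_totalChart_transition p q)
      (𝔞.contDiffOn_totalChart_transition q p)
  exact IsManifold.mk' _ _ _

theorem totalChart_source_mem_nhds (p : 𝔞.Total) : (𝔞.totalChart p).source ∈ 𝓝 p :=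
  (𝔞.totalChart p).open_source.mem_nhds (𝔞.mem_totalChart_source_self p)

theorem contMDiffAt_totalChart (p : 𝔞.Total) :
    ContMDiffAt (𝓡 (2 * n)) (𝓡 (2 * n)) ∞ (𝔞.totalChart p) p :=
  (contMDiffOn_chart (x := p)).contMDiffAt (𝔞.totalChart_source_mem_nhds p)

theorem contMDiff_proj : ContMDiff (𝓡 (2 * n)) (𝓡 n) ∞ 𝔞.bundleCore.proj := by
  intro p
  have hbase : ContMDiff (𝓡 (2 * n)) (𝓡 n) ∞
      (fun z : EuclideanSpace ℝ (Fin (2 * n)) => ((prodEuclidean n).symm z).1) :=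
    contMDiff_iff_contDiff.2 (by fun_prop)
  have hsymm : ContMDiffAt (𝓡 n) (𝓡 n) ∞ (𝔞.indexAt p.1).1.symm
      ((prodEuclidean n).symm (𝔞.totalChart p p)).1 := by
    rw [totalChart_fst]
    exact contMDiffAt_symm_of_mem_maximalAtlas (𝔞.subset_maximalAtlas (𝔞.indexAt p.1).2)
      ((𝔞.indexAt p.1).1.map_source (𝔞.mem_source_indexAt _))
  refine (hsymm.comp p (hbase.contMDiffAt.comp p
    (𝔞.contMDiffAt_totalChart p))).congr_of_eventuallyEq ?_
  filter_upwards [𝔞.totalChart_source_mem_nhds p] with q hq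
  rw [Function.comp_apply, Function.comp_apply, totalChart_fst,
    (𝔞.indexAt p.1).1.left_inv (𝔞.mem_totalChart_source.1 hq).1]

theorem contMDiffOn_param (i : 𝔞.charts) :
    ContMDiffOn ((𝓡 n).prod (𝓡 n)) (𝓡 (2 * n)) ∞ (𝔞.param i) (Prod.fst ⁻¹' i.1.target) := by
  intro w hw
  refine ContMDiffAt.contMDiffWithinAt ?_
  have hs := 𝔞.mem_totalChart_source_self (𝔞.param i w)
  obtain ⟨c, hc⟩ := 𝔞.totalChart_param_eventuallyEq hw hs
  refine contMDiffAt_iff_target.2 ⟨(𝔞.continuousOn_param i).continuousAt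
    ((i.1.open_target.preimage continuous_fst).mem_nhds hw), ?_⟩
  rw [← modelWithCornersSelf_prod, chartedSpaceSelf_prod, contMDiffAt_iff_contDiffAt]
  refine ContDiffAt.congr_of_eventuallyEq ?_ hc
  fun_prop

theorem localTriv_snd_eq {p q : 𝔞.Total} {i : 𝔞.charts} (hq : q ∈ (𝔞.totalChart p).source)
    (hi : q.1 ∈ i.1.source) :
    (𝔞.bundleCore.localTriv i q).2 =
      torusMk (integerLinear (𝔞.linearPart i (𝔞.indexAt p.1)).val.transpose
        ((prodEuclidean n).symm (𝔞.totalChart p q)).2) := by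
  rw [← torusEnd_torusMk, 𝔞.torusMk_totalChart_snd hq]
  exact (𝔞.bundleCore.coordChange_comp (𝔞.indexAt q.1) (𝔞.indexAt p.1) i q.1
    ⟨⟨𝔞.mem_source_indexAt _, (𝔞.mem_totalChart_source.1 hq).1⟩, hi⟩ q.2).symm

theorem contMDiffOn_localTriv (i : 𝔞.charts) :
    ContMDiffOn (𝓡 (2 * n)) ((𝓡 n).prod (𝓡 n)) ∞ (𝔞.bundleCore.localTriv i)
      (𝔞.bundleCore.localTriv i).source := by
  intro p hp
  refine ContMDiffAt.contMDiffWithinAt ?_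
  have hlinear : ContMDiff (𝓡 (2 * n)) (𝓡 n) ∞ (fun z : EuclideanSpace ℝ (Fin (2 * n)) =>
      integerLinear (𝔞.linearPart i (𝔞.indexAt p.1)).val.transpose ((prodEuclidean n).symm z).2) :=
    contMDiff_iff_contDiff.2 (by fun_prop)
  have hfibre := (contMDiff_torusMk.{u}.comp hlinear).contMDiffAt.comp p
    (𝔞.contMDiffAt_totalChart p)
  refine ((𝔞.contMDiff_proj p).prodMk hfibre).congr_of_eventuallyEq ?_
  filter_upwards [𝔞.totalChart_source_mem_nhds p,
    (𝔞.bundleCore.localTriv i).open_source.mem_nhds hp] with q hq hqi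
  exact Prod.ext rfl (𝔞.localTriv_snd_eq hq ((𝔞.bundleCore.mem_localTriv_source i q).1 hqi))

theorem contMDiffOn_localTriv_symm (i : 𝔞.charts) :
    ContMDiffOn ((𝓡 n).prod (𝓡 n)) (𝓡 (2 * n)) ∞
      (𝔞.bundleCore.localTriv i).toOpenPartialHomeomorph.symm
      (𝔞.bundleCore.localTriv i).target := by
  rintro ⟨b, θ⟩ hbθ
  have hb : b ∈ i.1.source := (𝔞.bundleCore.mem_localTriv_target i _).1 hbθ
  refine ContMDiffAt.contMDiffWithinAt ?_
  set c := chartAt (EuclideanSpace ℝ (Fin n)) θ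
  have hθ : θ ∈ c.source := mem_chart_source _ θ
  have hcoords : ContMDiffAt ((𝓡 n).prod (𝓡 n)) ((𝓡 n).prod (𝓡 n)) ∞
      (fun x : B × Torus.{u} n => (i.1 x.1, c x.2)) (b, θ) := by
    refine ContMDiffAt.prodMk ?_ ?_
    · exact (contMDiffAt_of_mem_maximalAtlas (𝔞.subset_maximalAtlas i.2) hb).comp (b, θ)
        contMDiffAt_fst
    · exact ((contMDiffOn_chart (x := θ)).contMDiffAt (c.open_source.mem_nhds hθ)).comp (b, θ)
        contMDiffAt_snd
  have hparam : ContMDiffAt ((𝓡 n).prod (𝓡 n)) (𝓡 (2 * n)) ∞ (𝔞.param i) (i.1 b, c θ) :=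
    (𝔞.contMDiffOn_param i).contMDiffAt
      ((i.1.open_target.preimage continuous_fst).mem_nhds (i.1.map_source hb))
  refine (hparam.comp (b, θ) hcoords).congr_of_eventuallyEq ?_
  filter_upwards [prod_mem_nhds (i.1.open_source.mem_nhds hb) (c.open_source.mem_nhds hθ)]
    with x hx
  rw [Function.comp_apply, param, i.1.left_inv hx.1, torusMk_chartAt hx.2]

/-- The linear part of the change of coordinates on the total space, on `ℝ²ⁿ`. -/
noncomputable def euclideanBlockLinear (i j : 𝔞.charts) :
    EuclideanSpace ℝ (Fin (2 * n)) →L[ℝ] EuclideanSpace ℝ (Fin (2 * n)) :=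
  (prodEuclidean n).toContinuousLinearMap.comp
    ((𝔞.blockLinear i j).comp (prodEuclidean n).symm.toContinuousLinearMap)

theorem euclideanSymplecticForm_euclideanBlockLinear {i j : 𝔞.charts} {b : B}
    (hi : b ∈ i.1.source) (hj : b ∈ j.1.source) :
    (euclideanSymplecticForm n).compContinuousLinearMap (𝔞.euclideanBlockLinear i j) =
      euclideanSymplecticForm n := by
  ext v
  have hblock := DFunLike.congr_fun (𝔞.standardSymplecticForm_blockLinear hi hj)
    fun k => (prodEuclidean n).symm (v k)
  simp only [euclideanSymplecticForm, ContinuousAlternatingMap.compContinuousLinearMap_apply]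
    at hblock ⊢
  refine Eq.trans ?_ hblock
  congr 1
  ext k : 1
  exact (prodEuclidean n).symm_apply_apply _

/-- The canonical symplectic form on the torus bundle. In the preferred chart at each point it is
the standard form. -/
noncomputable def symplecticForm : TwoForm (2 * n) 𝔞.Total := fun _ => euclideanSymplecticForm n

theorem hasFDerivAt_totalChart_transition {p q : 𝔞.Total} {z : EuclideanSpace ℝ (Fin (2 * n))}
    (hz : z ∈ (𝔞.totalChart p).target)
    (hq : (𝔞.totalChart p).symm z ∈ (𝔞.totalChart q).source) :
    HasFDerivAt (fun z => 𝔞.totalChart q ((𝔞.totalChart p).symm z))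
      (𝔞.euclideanBlockLinear (𝔞.indexAt p.1) (𝔞.indexAt q.1)) z := by
  obtain ⟨c, hc⟩ := 𝔞.totalChart_transition_eventuallyEq hz hq
  exact ((ContinuousLinearMap.hasFDerivAt _).add_const c).congr_of_eventuallyEq hc

theorem symplecticForm_inChart {p : 𝔞.Total} {y : EuclideanSpace ℝ (Fin (2 * n))}
    (hy : y ∈ (𝔞.totalChart p).target) :
    𝔞.symplecticForm.inChart p y = euclideanSymplecticForm n := by
  set q := (𝔞.totalChart p).symm y
  have hderiv : HasMFDerivAt (𝓡 (2 * n)) (𝓡 (2 * n)) (extChartAt (𝓡 (2 * n)) p).symm y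
      (𝔞.euclideanBlockLinear (𝔞.indexAt p.1) (𝔞.indexAt q.1)) :=
    ⟨(𝔞.totalChart p).continuousAt_symm hy, (𝔞.hasFDerivAt_totalChart_transition hy
      (𝔞.mem_totalChart_source_self q)).hasFDerivWithinAt⟩
  have hqp : q.1 ∈ (𝔞.indexAt p.1).1.source :=
    (𝔞.mem_totalChart_source.1 ((𝔞.totalChart p).map_target hy)).1
  rw [TwoForm.inChart, hderiv.mfderiv]
  exact 𝔞.euclideanSymplecticForm_euclideanBlockLinear hqp (𝔞.mem_source_indexAt q.1)

theorem extChartAt_total_target (p : 𝔞.Total) :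
    (extChartAt (𝓡 (2 * n)) p).target = (𝔞.totalChart p).target := by
  rw [extChartAt_target, modelWithCornersSelf_coe_symm, modelWithCornersSelf_coe, preimage_id,
    range_id, inter_univ]
  rfl

theorem isSymplecticForm : IsSymplecticForm 𝔞.symplecticForm where
  smooth p := by
    rw [extChartAt_total_target]
    exact contDiffOn_const.congr fun y hy => 𝔞.symplecticForm_inChart hy
  closed p y hy := by
    rw [extChartAt_total_target] at hy
    have hconst : 𝔞.symplecticForm.inChart p =ᶠ[𝓝 y] fun _ => euclideanSymplecticForm n := by
      filter_upwards [(𝔞.totalChart p).open_target.mem_nhds hy] with z hz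
      exact 𝔞.symplecticForm_inChart hz
    rw [extDeriv, hconst.fderiv_eq, fderiv_fun_const]
    exact map_zero (ContinuousAlternatingMap.alternatizeUncurryFinCLM ℝ _ ℝ)
  nondegenerate _ _ hv := euclideanSymplecticForm_nondegenerate hv

theorem hasMFDerivAt_totalChart_fst (x : 𝔞.Total) :
    HasMFDerivAt (𝓡 (2 * n)) (𝓡 n)
      (fun q : 𝔞.Total => ((prodEuclidean n).symm (𝔞.totalChart x q)).1) x
      ((ContinuousLinearMap.fst ℝ _ _).comp (prodEuclidean n).symm.toContinuousLinearMap) := by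
  have hx := 𝔞.mem_totalChart_source_self x
  set D := (ContinuousLinearMap.fst ℝ _ _).comp (prodEuclidean n).symm.toContinuousLinearMap
  refine ⟨D.continuous.continuousAt.comp ((𝔞.totalChart x).continuousAt hx), ?_⟩
  refine (D.hasFDerivAt.congr_of_eventuallyEq ?_).hasFDerivWithinAt
  filter_upwards [(𝔞.totalChart x).open_target.mem_nhds ((𝔞.totalChart x).map_source hx)] with z hz
  exact congrArg D ((𝔞.totalChart x).right_inv hz)

theorem fst_eq_zero_of_mfderiv_proj_eq_zero [IsManifold (𝓡 n) ∞ B] {x : 𝔞.Total}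
    {v : TangentSpace (𝓡 (2 * n)) x}
    (hv : mfderiv (𝓡 (2 * n)) (𝓡 n) 𝔞.bundleCore.proj x v = 0) :
    ((prodEuclidean n).symm v).1 = 0 := by
  set i := 𝔞.indexAt x.1
  have hproj := ((𝔞.contMDiff_proj x).mdifferentiableAt (by simp)).hasMFDerivAt
  have hchart := ((contMDiffAt_of_mem_maximalAtlas (𝔞.subset_maximalAtlas i.2)
    (𝔞.mem_source_indexAt x.1)).mdifferentiableAt (by simp)).hasMFDerivAt
  have hcoords : (fun q : 𝔞.Total => ((prodEuclidean n).symm (𝔞.totalChart x q)).1) =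
      i.1 ∘ 𝔞.bundleCore.proj := funext fun q => 𝔞.totalChart_fst x q
  have hfst := 𝔞.hasMFDerivAt_totalChart_fst x
  rw [hcoords] at hfst
  have hchain := DFunLike.congr_fun (hasMFDerivAt_unique hfst
    (HasMFDerivAt.comp (g := i.1) (f := 𝔞.bundleCore.proj) x hchart hproj)) v
  exact hchain.trans ((congrArg (mfderiv (𝓡 n) (𝓡 n) i.1 x.1) hv).trans (map_zero _))

theorem isLagrangianFibration [IsManifold (𝓡 n) ∞ B] :
    IsLagrangianFibration (F := Torus.{u} n) 𝔞.symplecticForm 𝔞.bundleCore.proj where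
  symplectic := 𝔞.isSymplecticForm
  compact_fibre := inferInstance
  connected_fibre := inferInstance
  smooth := 𝔞.contMDiff_proj
  locallyTrivial b := ⟨𝔞.bundleCore.localTriv (𝔞.indexAt b), 𝔞.mem_source_indexAt b,
    𝔞.contMDiffOn_localTriv _, 𝔞.contMDiffOn_localTriv_symm _⟩
  lagrangian x v w hv hw := by
    refine (euclideanSymplecticForm_apply v w).trans ?_
    rw [standardSymplecticForm_apply,
      𝔞.fst_eq_zero_of_mfderiv_proj_eq_zero hv, 𝔞.fst_eq_zero_of_mfderiv_proj_eq_zero hw]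
    simp

end IntegralAffineAtlas

theorem IsIntegralAffineManifold.isBaseOfLagrangianFibration {n : ℕ} {B : Type u}
    [TopologicalSpace B] [T2Space B] [SecondCountableTopology B]
    [ChartedSpace (EuclideanSpace ℝ (Fin n)) B] [IsManifold (𝓡 n) ∞ B]
    (h : IsIntegralAffineManifold n B) : IsBaseOfLagrangianFibration n B := by
  obtain ⟨𝔞⟩ := h.nonempty_integralAffineAtlas
  have htriv : ∀ b, ∃ e : Bundle.Trivialization (Torus.{u} n) 𝔞.bundleCore.proj, b ∈ e.baseSet :=
    fun b => ⟨𝔞.bundleCore.localTriv (𝔞.indexAt b), 𝔞.mem_source_indexAt b⟩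
  exact ⟨𝔞.Total, inferInstance, inferInstance, Torus.{u} n, inferInstance, inferInstance,
    ⟨inferInstance, t2Space_of_trivialization 𝔞.bundleCore.continuous_proj htriv,
      secondCountableTopology_of_trivialization htriv⟩,
    ⟨inferInstance, inferInstance, inferInstance⟩,
    𝔞.symplecticForm, 𝔞.bundleCore.proj, 𝔞.isLagrangianFibration⟩

end TorusBundle

theorem lemma2p1_general (n : ℕ) (B : Type u) [TopologicalSpace B] [T2Space B]
    [SecondCountableTopology B] [ChartedSpace (EuclideanSpace ℝ (Fin n)) B]
    [IsManifold (𝓡 n) ∞ B] :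
    IsBaseOfLagrangianFibration n B ↔ IsIntegralAffineManifold n B := by
  have := ChartedSpace.locallyCompactSpace (EuclideanSpace ℝ (Fin n)) B
  have := Manifold.metrizableSpace (𝓡 n) B
  exact ⟨fun h => h.isIntegralAffineManifold, fun h => h.isBaseOfLagrangianFibration⟩

theorem lemma2p1 (n : ℕ) (B : Type u) [TopologicalSpace B] [T2Space B]
    [SecondCountableTopology B] [ConnectedSpace B]
    [ChartedSpace (EuclideanSpace ℝ (Fin n)) B] [IsManifold (𝓡 n) ∞ B] :
    IsBaseOfLagrangianFibration n B ↔ IsIntegralAffineManifold n B := by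
  exact lemma2p1_general n B
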